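/- All rings are commutative, noetherian and have a non-zero identity. Let $(R,\mathfrak m,k)$ be a local ring with a dualizing complex $D$, that is, a homologically bounded $R$-complex with finitely generated homology modules that is isomorphic in the derived category to a bounded complex of injective modules and for which the homothety morphism $R\to\mathbf R\mathrm{Hom}_R(D,D)$ is an isomorphism in the derived category. The Auslander class $\mathcal A(R)$ consists of the $R$-complexes $Z$ such that $Z$ and $D\otimes^{\mathbf L}_R Z$ are homologically bounded and the canonical morphism $Z\to\mathbf R\mathrm{Hom}_R(D,D\otimes^{\mathbf L}_R Z)$ is an isomorphism in the derived category. The Bass class $\mathcal B(R)$ consists of the $R$-complexes $Z$ such that $Z$ and $\mathbf R\mathrm{Hom}_R(D,Z)$ are homologically bounded and the canonical morphism $D\otimes^{\mathbf L}_R\mathbf R\mathrm{Hom}_R(D,Z)\to Z$ is an isomorphism in the derived category. Let $Q$ be a ring, let $R$ (as above) and $S$ be $Q$-algebras, and let $X$ and $Y$ be homologically bounded complexes of $(R,S)$-bimodules (that is, of $R\otimes_Q S$-modules). Let $F$ be a homologically bounded $S$-complex of finite flat dimension (isomorphic in the derived category of $S$ to a bounded complex of flat $S$-modules), and let $I$ be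 a homologically bounded $S$-complex of finite injective dimension (isomorphic in the derived category of $S$ to a bounded complex of injective $S$-modules). Regard $\mathbf R\mathrm{Hom}_S(X,I)$, $X\otimes^{\mathbf L}_S F$, $\mathbf R\mathrm{Hom}_S(Y,I)$ and $Y\otimes^{\mathbf L}_S F$ as $R$-complexes through the $R$-actions on $X$ and $Y$. Then: (i) if $X\in\mathcal A(R)$, then $\mathbf R\mathrm{Hom}_S(X,I)\in\mathcal B(R)$ and $X\otimes^{\mathbf L}_S F\in\mathcal A(R)$; (ii) if $Y\in\mathcal B(R)$, then $\mathbf R\mathrm{Hom}_S(Y,I)\in\mathcal A(R)$ and $Y\otimes^{\mathbf L}_S F\in\mathcal B(R)$. -/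

import Mathlib

open scoped TensorProduct

universe v u

namespace FoxbyClasses

open CategoryTheory Limits MonoidalCategory Opposite

noncomputable section

/-! ### Boundedness, equivalence, resolutions

Complexes are indexed cohomologically: `K.X n` is the module in homological degree `-n`. -/

section Resolutions

variable {C : Type*} [Category* C] [Abelian C]

/-- `K` is homologically bounded: its homology vanishes in almost all degrees. -/
def HomologicallyBounded (K : CochainComplex C ℤ) : Prop :=
  ∃ a b : ℤ, K.IsGE a ∧ K.IsLE b

/-- `K` is bounded: its objects vanish in almost all degrees. -/
def StrictlyBounded (K : CochainComplex C ℤ) : Prop :=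
  ∃ a b : ℤ, K.IsStrictlyGE a ∧ K.IsStrictlyLE b

attribute [local instance] HasDerivedCategory.standard in
/-- `K ≃ L`: the complexes are isomorphic in the derived category. -/
def Equivalent (K L : CochainComplex C ℤ) : Prop :=
  Nonempty (DerivedCategory.Q.obj K ≅ DerivedCategory.Q.obj L)

/-- A projective resolution of `K`: a quasi-isomorphism `P ⟶ K` from a complex of projectives that
vanishes in high cohomological (that is, low homological) degrees. -/
structure ProjRes (K : CochainComplex C ℤ) where
  /-- the resolving complex -/
  P : CochainComplex C ℤ
  /-- the augmentation -/
  π : P ⟶ K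
  quasiIso : QuasiIso π
  projective : ∀ n, Projective (P.X n)
  bounded : ∃ b : ℤ, P.IsStrictlyLE b

/-- An injective resolution of `K`: a quasi-isomorphism `K ⟶ J` to a complex of injectives that
vanishes in low cohomological (that is, high homological) degrees. -/
structure InjRes (K : CochainComplex C ℤ) where
  /-- the resolving complex -/
  J : CochainComplex C ℤ
  /-- the coaugmentation -/
  ι : K ⟶ J
  quasiIso : QuasiIso ι
  injective : ∀ n, Injective (J.X n)
  bounded : ∃ a : ℤ, J.IsStrictlyGE a

theorem nonempty_injRes [EnoughInjectives C] (K : CochainComplex C ℤ)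
    (hK : HomologicallyBounded K) : Nonempty (InjRes K) := by
  obtain ⟨a, _, ha, _⟩ := hK
  obtain ⟨L, i, hi, hL, hL'⟩ :=
    CochainComplex.Plus.modelCategoryQuillen.exists_quasiIso_injective (K.truncGE a) a
  exact ⟨⟨L, K.πTruncGE a ≫ i, inferInstance, hL, a, hL'⟩⟩

theorem quasiIso_restrictionMap_neg {K L : CochainComplex C ℤ} (f : K ⟶ L) [hf : QuasiIso f] :
    QuasiIso (HomologicalComplex.restrictionMap f ComplexShape.embeddingDownIntUpInt) where
  quasiIsoAt n := by
    have h : QuasiIsoAt f (-n) := inferInstance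
    rw [quasiIsoAt_iff' f (-n - 1) (-n) (-n + 1) (by simp) (by simp)] at h
    rw [quasiIsoAt_iff' _ (n + 1) n (n - 1) (by simp) (by simp)]
    have e₁ : - n - 1 = -(n + 1) := by lia
    have e₂ : - n + 1 = -(n - 1) := by lia
    rw [e₁, e₂] at h
    exact h

theorem exists_projective (K : CochainComplex C ℤ) [EnoughProjectives C] (b : ℤ)
    [K.IsStrictlyLE b] : ∃ (P : CochainComplex C ℤ) (π : P ⟶ K), QuasiIso π ∧
      (∀ n, Projective (P.X n)) ∧ P.IsStrictlyLE b := by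
  let E := CochainComplex.opEquivalence C
  have : (E.functor.obj (op K)).IsStrictlyGE (-b) := by
    rw [CochainComplex.isStrictlyGE_iff]
    intro i hi
    exact (K.isZero_of_isStrictlyLE b (-i) (by lia)).op
  obtain ⟨L, i, hi, hL, hL'⟩ :=
    CochainComplex.Plus.modelCategoryQuillen.exists_quasiIso_injective (E.functor.obj (op K)) (-b)
  have h₁ := quasiIso_restrictionMap_neg i
  have h₂ : QuasiIso (E.inverse.map i).unop := by
    rw [← HomologicalComplex.quasiIso_opFunctor_map_iff]
    exact h₁
  refine ⟨(E.inverse.obj L).unop, (E.inverse.map i).unop ≫ (E.unit.app (op K)).unop,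
    inferInstance, fun n ↦ ?_, ?_⟩
  · exact (inferInstance : Projective (L.X (-n)).unop)
  · rw [CochainComplex.isStrictlyLE_iff]
    intro n hn
    exact (L.isZero_of_isStrictlyGE (-b) (-n) (by lia)).unop

theorem nonempty_projRes [EnoughProjectives C] (K : CochainComplex C ℤ)
    (hK : HomologicallyBounded K) : Nonempty (ProjRes K) := by
  obtain ⟨_, b, _, hb⟩ := hK
  obtain ⟨P, π, hπ, hP, hP'⟩ := exists_projective (K.truncLE b) b
  exact ⟨⟨P, π ≫ K.ιTruncLE b, inferInstance, hP, b, hP'⟩⟩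

/-- A chosen projective resolution of a homologically bounded complex. -/
def projRes [EnoughProjectives C] (K : CochainComplex C ℤ) (hK : HomologicallyBounded K) :
    ProjRes K :=
  (nonempty_projRes K hK).some

/-- A chosen injective resolution of a homologically bounded complex. -/
def injRes [EnoughInjectives C] (K : CochainComplex C ℤ) (hK : HomologicallyBounded K) :
    InjRes K :=
  (nonempty_injRes K hK).some

end Resolutions

/-! ### Complexes over one ring -/

section OneRing

variable {R : Type u} [CommRing R]

/-- `K ∈ 𝓕(R)`: homologically bounded, and equivalent to a bounded complex of flat modules. -/
structure HasFiniteFlatDim (K : CochainComplex (ModuleCat.{u} R) ℤ) : Prop where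
  homologicallyBounded : HomologicallyBounded K
  exists_equivalent : ∃ U : CochainComplex (ModuleCat.{u} R) ℤ,
    Equivalent K U ∧ StrictlyBounded U ∧ ∀ n, Module.Flat R (U.X n)

/-- `K ∈ 𝓘(R)`: homologically bounded, and equivalent to a bounded complex of injective modules. -/
structure HasFiniteInjDim (K : CochainComplex (ModuleCat.{u} R) ℤ) : Prop where
  homologicallyBounded : HomologicallyBounded K
  exists_equivalent : ∃ U : CochainComplex (ModuleCat.{u} R) ℤ,
    Equivalent K U ∧ StrictlyBounded U ∧ ∀ n, Injective (U.X n)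

open CochainComplex.HomComplex in
/-- The complex `Hom_R(P, Z)` of `R`-modules. -/
@[simps]
def homComplex (P Z : CochainComplex (ModuleCat.{u} R) ℤ) : CochainComplex (ModuleCat.{u} R) ℤ where
  X n := ModuleCat.of R (Cochain P Z n)
  d i j := ModuleCat.ofHom (δ_hom R P Z i j)
  shape i j hij := by ext; simp [δ_shape _ _ hij]
  d_comp_d' _ _ _ _ _ := by ext; simp [δ_δ]

/-- The complex `P ⊗_R X` of `R`-modules. -/
abbrev tensorComplex (P X : CochainComplex (ModuleCat.{u} R) ℤ) :
    CochainComplex (ModuleCat.{u} R) ℤ :=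
  HomologicalComplex.tensorObj P X

theorem tensorComplex_d_tmul (P X : CochainComplex (ModuleCat.{u} R) ℤ) (i n j i' n' k : ℤ)
    (hij : i + n = j) (hi : i + 1 = i') (hn : n + 1 = n') (hik : i' + n = k) (hnk : i + n' = k)
    (p : P.X i) (x : X.X n) :
    ((tensorComplex P X).d j k).hom
        ((HomologicalComplex.ιTensorObj P X i n j hij).hom (p ⊗ₜ x)) =
      (HomologicalComplex.ιTensorObj P X i' n k hik).hom ((P.d i i').hom p ⊗ₜ x) +
        i.negOnePow •
          (HomologicalComplex.ιTensorObj P X i n' k hnk).hom (p ⊗ₜ (X.d n n').hom x) := by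
  have h : HomologicalComplex.ιTensorObj P X i n j hij ≫ (tensorComplex P X).d j k =
      ((curriedTensor (ModuleCat.{u} R)).map (P.d i i')).app (X.X n) ≫
        HomologicalComplex.ιTensorObj P X i' n k hik +
      i.negOnePow • (((curriedTensor (ModuleCat.{u} R)).obj (P.X i)).map (X.d n n') ≫
        HomologicalComplex.ιTensorObj P X i n' k hnk) := by
    rw [HomologicalComplex.mapBifunctor.d_eq, Preadditive.comp_add,
      HomologicalComplex.mapBifunctor.ι_D₁, HomologicalComplex.mapBifunctor.ι_D₂,
      HomologicalComplex.mapBifunctor.d₁_eq P X (curriedTensor (ModuleCat.{u} R)) _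
        (show (ComplexShape.up ℤ).Rel i i' from hi) n k hik,
      HomologicalComplex.mapBifunctor.d₂_eq P X (curriedTensor (ModuleCat.{u} R)) _ i
        (show (ComplexShape.up ℤ).Rel n n' from hn) k hnk]
    congr 1
    exact one_smul _ _
  exact LinearMap.congr_fun (congrArg ModuleCat.Hom.hom h) (p ⊗ₜ x)

open CochainComplex.HomComplex in
/-- For `x ∈ X^n`, the cochain `P ⟶ P ⊗_R X` of degree `n` given by `p ↦ (-1)^(in) p ⊗ x` on
`P^i`. -/
def unitCochain (P X : CochainComplex (ModuleCat.{u} R) ℤ) (n : ℤ) :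
    X.X n →ₗ[R] Cochain P (tensorComplex P X) n where
  toFun x := Cochain.mk fun i j hij ↦
    (i * n).negOnePow • ModuleCat.ofHom
      ((HomologicalComplex.ιTensorObj P X i n j hij).hom ∘ₗ
        (TensorProduct.mk R (P.X i) (X.X n)).flip x)
  map_add' x y := by
    ext i j hij p
    simp
  map_smul' r x := by
    ext i j hij p
    simp [smul_comm r]

/-- The canonical morphism `X ⟶ Hom_R(P, P ⊗_R X)`. -/
def unitHom (P X : CochainComplex (ModuleCat.{u} R) ℤ) :
    X ⟶ homComplex P (tensorComplex P X) where
  f n := ModuleCat.ofHom (unitCochain P X n)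
  comm' n m hnm := by
    obtain rfl : n + 1 = m := hnm
    refine ModuleCat.hom_ext (LinearMap.ext fun x ↦ ?_)
    change CochainComplex.HomComplex.δ n (n + 1) (unitCochain P X n x) =
      unitCochain P X (n + 1) ((X.d n (n + 1)).hom x)
    ext i j hij p
    rw [CochainComplex.HomComplex.δ_v n (n + 1) rfl _ i j hij (j - 1) (i + 1) rfl rfl]
    have h := tensorComplex_d_tmul P X i n (j - 1) (i + 1) (n + 1) j (by lia) rfl rfl (by lia)
      (by lia) p x
    have e₁ : (n + 1).negOnePow * ((i + 1) * n).negOnePow = -(i * n).negOnePow := by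
      rw [← Int.negOnePow_add, show n + 1 + (i + 1) * n = i * n + 2 * n + 1 by ring,
        Int.negOnePow_succ, Int.negOnePow_add, Int.negOnePow_two_mul, mul_one]
    have e₂ : (i * n).negOnePow * i.negOnePow = (i * (n + 1)).negOnePow := by
      rw [← Int.negOnePow_add]; congr 1; ring
    simp only [unitCochain, LinearMap.coe_mk, AddHom.coe_mk, CochainComplex.HomComplex.Cochain.mk_v,
      Linear.units_smul_comp, Linear.comp_units_smul, ModuleCat.hom_add, ModuleCat.hom_comp,
      ModuleCat.hom_smul, ModuleCat.hom_ofHom, LinearMap.add_apply, LinearMap.comp_apply,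
      LinearMap.smul_apply, LinearMap.flip_apply, TensorProduct.mk_apply]
    rw [h, smul_add, smul_smul, smul_smul, e₁, e₂, Units.neg_smul]
    abel

open CochainComplex.HomComplex in
/-- The map `(P ⊗_R Hom_R(P, Y))^j ⟶ Y^j` given by `p ⊗ f ↦ (-1)^(in) f(p)` for `p ∈ P^i` and `f` of
degree `n`, where `i + n = j`. -/
def counitMap (P Y : CochainComplex (ModuleCat.{u} R) ℤ) (j : ℤ) :
    (tensorComplex P (homComplex P Y)).X j ⟶ Y.X j :=
  HomologicalComplex.mapBifunctorDesc fun i n hij ↦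
    (i * n).negOnePow • ModuleCat.ofHom (TensorProduct.lift (LinearMap.flip
      { toFun := fun z : Cochain P Y n ↦ (z.v i j hij).hom
        map_add' := fun _ _ ↦ rfl
        map_smul' := fun _ _ ↦ rfl }))

open CochainComplex.HomComplex in
theorem counitMap_tmul (P Y : CochainComplex (ModuleCat.{u} R) ℤ) (i n j : ℤ) (hij : i + n = j)
    (p : P.X i) (z : Cochain P Y n) :
    (counitMap P Y j).hom
        ((HomologicalComplex.ιTensorObj P (homComplex P Y) i n j hij).hom (p ⊗ₜ z)) =
      (i * n).negOnePow • (z.v i j hij).hom p := by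
  have h := HomologicalComplex.ι_mapBifunctorDesc (K₁ := P) (K₂ := homComplex P Y)
    (F := curriedTensor (ModuleCat.{u} R)) (c := ComplexShape.up ℤ) (j := j) (A := Y.X j)
    (fun i n hij ↦ (i * n).negOnePow • ModuleCat.ofHom (TensorProduct.lift (LinearMap.flip
      { toFun := fun z : Cochain P Y n ↦ (z.v i j hij).hom
        map_add' := fun _ _ ↦ rfl
        map_smul' := fun _ _ ↦ rfl }))) i n hij
  exact LinearMap.congr_fun (congrArg ModuleCat.Hom.hom h) (p ⊗ₜ z)

/-- The canonical morphism `P ⊗_R Hom_R(P, Y) ⟶ Y`. -/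
def counitHom (P Y : CochainComplex (ModuleCat.{u} R) ℤ) :
    tensorComplex P (homComplex P Y) ⟶ Y where
  f j := counitMap P Y j
  comm' j k hjk := by
    obtain rfl : j + 1 = k := hjk
    refine HomologicalComplex.mapBifunctor.hom_ext fun i n hij ↦ ?_
    refine ModuleCat.hom_ext (TensorProduct.ext' fun p
      (z : CochainComplex.HomComplex.Cochain P Y n) ↦ ?_)
    replace hij : i + n = j := hij
    have h := tensorComplex_d_tmul P (homComplex P Y) i n j (i + 1) (n + 1) (j + 1) hij rfl rfl
      (by lia) (by lia) p z
    have hv := congrArg (fun f ↦ f.hom p)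
      (CochainComplex.HomComplex.δ_v n (n + 1) rfl z i (j + 1) (by lia) j (i + 1) (by lia) rfl)
    change (Y.d j (j + 1)).hom ((counitMap P Y j).hom
        ((HomologicalComplex.ιTensorObj P (homComplex P Y) i n j hij).hom (p ⊗ₜ z))) =
      (counitMap P Y (j + 1)).hom (((tensorComplex P (homComplex P Y)).d j (j + 1)).hom
        ((HomologicalComplex.ιTensorObj P (homComplex P Y) i n j hij).hom (p ⊗ₜ z)))
    have e₁ : i.negOnePow * (i * (n + 1)).negOnePow = (i * n).negOnePow := by
      rw [← Int.negOnePow_add, show i + i * (n + 1) = i * n + 2 * i by ring,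
        Int.negOnePow_add, Int.negOnePow_two_mul, mul_one]
    have e₂ : (i * n).negOnePow * (n + 1).negOnePow = -((i + 1) * n).negOnePow := by
      rw [← Int.negOnePow_add, show i * n + (n + 1) = (i + 1) * n + 1 by ring,
        Int.negOnePow_succ]
    have hd : ((homComplex P Y).d n (n + 1)).hom z =
      CochainComplex.HomComplex.δ n (n + 1) z := rfl
    rw [h, map_add, map_zsmul_unit, hd, counitMap_tmul, counitMap_tmul, counitMap_tmul,
      map_zsmul_unit, smul_smul, e₁]
    simp only [ModuleCat.hom_add, ModuleCat.hom_comp, ModuleCat.hom_smul, LinearMap.add_apply,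
      LinearMap.comp_apply, LinearMap.smul_apply] at hv
    rw [hv, smul_add, smul_smul, e₂, Units.neg_smul]
    abel

/-- The homothety morphism `R ⟶ Hom_R(P, D)`, `r ↦ r • π`, of a morphism `π : P ⟶ D`. -/
def homothety {P D : CochainComplex (ModuleCat.{u} R) ℤ} (π : P ⟶ D) :
    (HomologicalComplex.single (ModuleCat.{u} R) (ComplexShape.up ℤ) 0).obj (ModuleCat.of R R) ⟶
      homComplex P D :=
  HomologicalComplex.mkHomFromSingle
    (ModuleCat.ofHom (LinearMap.toSpanSingleton R (CochainComplex.HomComplex.Cochain P D 0)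
      (CochainComplex.HomComplex.Cochain.ofHom π)))
    (fun i _ ↦ by
      ext
      change CochainComplex.HomComplex.δ 0 i 
        ((1 : R) • CochainComplex.HomComplex.Cochain.ofHom π) = 0
      rw [one_smul, CochainComplex.HomComplex.δ_ofHom])

/-- `D` is a dualizing complex for `R`: it has finite injective dimension and finitely generated
homology modules, and the homothety morphism `R ⟶ RHom_R(D, D)` is an isomorphism in the derived
category. -/
structure IsDualizingComplex (D : CochainComplex (ModuleCat.{u} R) ℤ) : Prop where
  finiteInjDim : HasFiniteInjDim D
  finite_homology : ∀ n, Module.Finite R (D.homology n)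
  quasiIso_homothety :
    QuasiIso (homothety (projRes D finiteInjDim.homologicallyBounded).π)

section Foxby

variable (D : CochainComplex (ModuleCat.{u} R) ℤ) (hD : HomologicallyBounded D)

/-- `D ⊗ᴸ_R X`, computed by the projective resolution of `D`. -/
abbrev lTensor (X : CochainComplex (ModuleCat.{u} R) ℤ) : CochainComplex (ModuleCat.{u} R) ℤ :=
  tensorComplex (projRes D hD).P X

/-- `RHom_R(D, Y)`, computed by the projective resolution of `D`. -/
abbrev rHom (Y : CochainComplex (ModuleCat.{u} R) ℤ) : CochainComplex (ModuleCat.{u} R) ℤ :=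
  homComplex (projRes D hD).P Y

/-- The canonical morphism `X ⟶ RHom_R(D, D ⊗ᴸ_R X)`. -/
abbrev rUnit (X : CochainComplex (ModuleCat.{u} R) ℤ) : X ⟶ rHom D hD (lTensor D hD X) :=
  unitHom (projRes D hD).P X

/-- The canonical morphism `D ⊗ᴸ_R RHom_R(D, Y) ⟶ Y`. -/
abbrev rCounit (Y : CochainComplex (ModuleCat.{u} R) ℤ) : lTensor D hD (rHom D hD Y) ⟶ Y :=
  counitHom (projRes D hD).P Y

/-- The Auslander class `𝓐(R)` with respect to `D`. -/
structure AuslanderClass (X : CochainComplex (ModuleCat.{u} R) ℤ) : Prop where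
  homologicallyBounded : HomologicallyBounded X
  homologicallyBounded_lTensor : HomologicallyBounded (lTensor D hD X)
  quasiIso_rUnit : QuasiIso (rUnit D hD X)

/-- The Bass class `𝓑(R)` with respect to `D`. -/
structure BassClass (Y : CochainComplex (ModuleCat.{u} R) ℤ) : Prop where
  homologicallyBounded : HomologicallyBounded Y
  homologicallyBounded_rHom : HomologicallyBounded (rHom D hD Y)
  quasiIso_rCounit : QuasiIso (rCounit D hD Y)

end Foxby

end OneRing

/-! ### Complexes of bimodules

For `Q`-algebras `R` and `S`, an `(R, S)`-bimodule on which the two `Q`-actions agree is a module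
over `R ⊗[Q] S`. -/

section Bimodules

variable {Q : Type v} {R S : Type u} [CommRing Q] [CommRing R] [CommRing S] [Algebra Q R]
  [Algebra Q S]

variable (Q R S) in
/-- The underlying `R`-module of an `(R, S)`-bimodule. -/
abbrev toLeft : ModuleCat.{u} (R ⊗[Q] S) ⥤ ModuleCat.{u} R :=
  ModuleCat.restrictScalars (Algebra.TensorProduct.includeLeftRingHom : R →+* R ⊗[Q] S)

variable (Q R S) in
/-- The underlying `S`-module of an `(R, S)`-bimodule. -/
abbrev toRight : ModuleCat.{u} (R ⊗[Q] S) ⥤ ModuleCat.{u} S :=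
  ModuleCat.restrictScalars
    (Algebra.TensorProduct.includeRight : S →ₐ[Q] R ⊗[Q] S).toRingHom

variable (Q R S) in
/-- The underlying complex of `R`-modules of a complex of `(R, S)`-bimodules. -/
abbrev leftComplex (X : CochainComplex (ModuleCat.{u} (R ⊗[Q] S)) ℤ) :
    CochainComplex (ModuleCat.{u} R) ℤ :=
  ((toLeft Q R S).mapHomologicalComplex (ComplexShape.up ℤ)).obj X

variable (Q R S) in
/-- The underlying complex of `S`-modules of a complex of `(R, S)`-bimodules. -/
abbrev rightComplex (X : CochainComplex (ModuleCat.{u} (R ⊗[Q] S)) ℤ) :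
    CochainComplex (ModuleCat.{u} S) ℤ :=
  ((toRight Q R S).mapHomologicalComplex (ComplexShape.up ℤ)).obj X

/-- The `R`-action on the underlying `S`-module of an `(R, S)`-bimodule. -/
@[reducible]
def leftModule (M : ModuleCat.{u} (R ⊗[Q] S)) : Module R ((toRight Q R S).obj M) :=
  inferInstanceAs (Module R ((toLeft Q R S).obj M))

attribute [local instance] leftModule

theorem smulCommClass_leftModule (M : ModuleCat.{u} (R ⊗[Q] S)) :
    SMulCommClass S R ((toRight Q R S).obj M) where
  smul_comm _ _ m := smul_comm (M := R ⊗[Q] S) (N := R ⊗[Q] S) (α := M) _ _ m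

attribute [local instance] smulCommClass_leftModule

/-- The map `M ⊗_S N ⟶ M' ⊗_S N'` induced by `f` and `g`; `R` acts through `M` and `M'`. -/
def bimodTensorMap {M M' : ModuleCat.{u} (R ⊗[Q] S)} {N N' : ModuleCat.{u} S} (f : M ⟶ M')
    (g : N ⟶ N') :
    ((toRight Q R S).obj M ⊗[S] N) →ₗ[R] ((toRight Q R S).obj M' ⊗[S] N') where
  toFun := TensorProduct.map ((toRight Q R S).map f).hom g.hom
  map_add' := map_add _
  map_smul' r x := by
    induction x using TensorProduct.induction_on with
    | zero => simp only [smul_zero, map_zero]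
    | tmul m n =>
      have h : ((toRight Q R S).map f).hom (r • m) =
        r • ((toRight Q R S).map f).hom m := ((toLeft Q R S).map f).hom.map_smul r m
      simp only [TensorProduct.smul_tmul', TensorProduct.map_tmul, h, RingHom.id_apply]
    | add x y hx hy => simp only [smul_add, map_add, hx, hy]

theorem bimodTensor_hom_ext {M : ModuleCat.{u} (R ⊗[Q] S)} {N : ModuleCat.{u} S} {T : Type u}
    [AddCommGroup T] [Module R T] {h h' : ((toRight Q R S).obj M ⊗[S] N) →ₗ[R] T}
    (H : ∀ m n, h (m ⊗ₜ n) = h' (m ⊗ₜ n)) : h = h' := by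
  refine LinearMap.ext fun x ↦ ?_
  induction x using TensorProduct.induction_on with
  | zero => simp only [map_zero]
  | tmul m n => exact H m n
  | add x y hx hy => simp only [map_add, hx, hy]

/-- The bifunctor `(M, N) ↦ M ⊗_S N`, with `R` acting on `M ⊗_S N` through `M`. -/
def bimodTensor : ModuleCat.{u} (R ⊗[Q] S) ⥤ ModuleCat.{u} S ⥤ ModuleCat.{u} R where
  obj M :=
    { obj N := ModuleCat.of R ((toRight Q R S).obj M ⊗[S] N)
      map g := ModuleCat.ofHom (bimodTensorMap (𝟙 M) g)
      map_id _ := ModuleCat.hom_ext (bimodTensor_hom_ext fun _ _ ↦ rfl)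
      map_comp _ _ := ModuleCat.hom_ext (bimodTensor_hom_ext fun _ _ ↦ rfl) }
  map f :=
    { app N := ModuleCat.ofHom (bimodTensorMap f (𝟙 N))
      naturality _ _ _ := ModuleCat.hom_ext (bimodTensor_hom_ext fun _ _ ↦ rfl) }
  map_id _ := NatTrans.ext (funext fun _ ↦
    ModuleCat.hom_ext (bimodTensor_hom_ext fun _ _ ↦ rfl))
  map_comp _ _ := NatTrans.ext (funext fun _ ↦
    ModuleCat.hom_ext (bimodTensor_hom_ext fun _ _ ↦ rfl))

instance : (bimodTensor (Q := Q) (R := R) (S := S)).Additive where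
  map_add {_ _ f f'} := NatTrans.ext (funext fun _ ↦
    ModuleCat.hom_ext (bimodTensor_hom_ext fun m n ↦
      TensorProduct.add_tmul (((toRight Q R S).map f).hom m) (((toRight Q R S).map f').hom m) n))

instance (M : ModuleCat.{u} (R ⊗[Q] S)) : (bimodTensor.obj M).Additive where
  map_add {_ _ g g'} := ModuleCat.hom_ext (bimodTensor_hom_ext fun m n ↦
    TensorProduct.tmul_add m (g.hom n) (g'.hom n))

/-- The complex `X ⊗_S F` of `R`-modules, for a complex `X` of `(R, S)`-bimodules and a complex `F`
of `S`-modules. -/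
abbrev bimodTensorComplex (X : CochainComplex (ModuleCat.{u} (R ⊗[Q] S)) ℤ)
    (F : CochainComplex (ModuleCat.{u} S) ℤ) : CochainComplex (ModuleCat.{u} R) ℤ :=
  HomologicalComplex.mapBifunctor X F bimodTensor (ComplexShape.up ℤ)

section BimodHom

open CochainComplex CochainComplex.HomComplex

/-- Multiplication by `r : R` on a complex of `(R, S)`-bimodules, as an endomorphism of the
underlying complex of `S`-modules. -/
def leftMul (X : CochainComplex (ModuleCat.{u} (R ⊗[Q] S)) ℤ) (r : R) :
    rightComplex Q R S X ⟶ rightComplex Q R S X :=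
  ((toRight Q R S).mapHomologicalComplex (ComplexShape.up ℤ)).map ((r ⊗ₜ[Q] (1 : S)) • 𝟙 X)

theorem leftMul_one (X : CochainComplex (ModuleCat.{u} (R ⊗[Q] S)) ℤ) :
    leftMul X (1 : R) = 𝟙 _ := by
  simp [leftMul, ← Algebra.TensorProduct.one_def]

theorem leftMul_add (X : CochainComplex (ModuleCat.{u} (R ⊗[Q] S)) ℤ) (r r' : R) :
    leftMul X (r + r') = leftMul X r + leftMul X r' := by
  simp only [leftMul, TensorProduct.add_tmul, add_smul, Functor.map_add]

theorem leftMul_zero (X : CochainComplex (ModuleCat.{u} (R ⊗[Q] S)) ℤ) :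
    leftMul X (0 : R) = 0 := by
  simp only [leftMul, TensorProduct.zero_tmul, zero_smul, Functor.map_zero]

theorem leftMul_mul (X : CochainComplex (ModuleCat.{u} (R ⊗[Q] S)) ℤ) (r r' : R) :
    leftMul X (r * r') = leftMul X r ≫ leftMul X r' := by
  rw [mul_comm r r']
  simp only [leftMul, ← Functor.map_comp, Linear.smul_comp, Linear.comp_smul, smul_smul,
    Category.id_comp, Algebra.TensorProduct.tmul_mul_tmul, mul_one]

/-- `R` acts on `Hom_S(X, J)` through `X`: `(r • f) x = f (r • x)`. -/
@[reducible]
def bimodCochainModule (X : CochainComplex (ModuleCat.{u} (R ⊗[Q] S)) ℤ)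
    (J : CochainComplex (ModuleCat.{u} S) ℤ) (n : ℤ) :
    Module R (Cochain (rightComplex Q R S X) J n) where
  smul r z := (Cochain.ofHom (leftMul X r)).comp z (zero_add n)
  one_smul z := by
    change (Cochain.ofHom (leftMul X 1)).comp z (zero_add n) = z
    rw [leftMul_one, Cochain.id_comp]
  mul_smul r r' z := by
    change (Cochain.ofHom (leftMul X (r * r'))).comp z (zero_add n) =
      (Cochain.ofHom (leftMul X r)).comp
        ((Cochain.ofHom (leftMul X r')).comp z (zero_add n)) (zero_add n)
    rw [leftMul_mul, Cochain.ofHom_comp, Cochain.comp_assoc_of_first_is_zero_cochain]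
  smul_zero r := Cochain.comp_zero _ _
  smul_add r z z' := Cochain.comp_add _ _ _ _
  add_smul r r' z := by
    change (Cochain.ofHom (leftMul X (r + r'))).comp z (zero_add n) =
      (Cochain.ofHom (leftMul X r)).comp z (zero_add n) +
        (Cochain.ofHom (leftMul X r')).comp z (zero_add n)
    rw [leftMul_add, Cochain.ofHom_add, Cochain.add_comp]
  zero_smul z := by
    change (Cochain.ofHom (leftMul X 0)).comp z (zero_add n) = 0
    rw [leftMul_zero, Cochain.ofHom_zero, Cochain.zero_comp]

attribute [local instance] bimodCochainModule

/-- The complex `Hom_S(X, J)` of `R`-modules, for a complex `X` of `(R, S)`-bimodules and a complex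
`J` of `S`-modules. -/
def bimodHomComplex (X : CochainComplex (ModuleCat.{u} (R ⊗[Q] S)) ℤ)
    (J : CochainComplex (ModuleCat.{u} S) ℤ) : CochainComplex (ModuleCat.{u} R) ℤ where
  X n := ModuleCat.of R (Cochain (rightComplex Q R S X) J n)
  d n m := ModuleCat.ofHom
    { toFun := fun z ↦ δ n m z
      map_add' := fun z z' ↦ δ_add n m z z'
      map_smul' := fun r z ↦ δ_ofHom_comp (leftMul X r) z m }
  shape n m hnm :=
    ModuleCat.hom_ext (LinearMap.ext fun z ↦ δ_shape n m hnm z)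
  d_comp_d' n m k _ _ :=
    ModuleCat.hom_ext (LinearMap.ext fun z ↦ δ_δ n m k z)

end BimodHom

/-- `X ⊗ᴸ_S F` as a complex of `R`-modules, computed by the projective resolution of `F`. -/
abbrev bimodLTensor (X : CochainComplex (ModuleCat.{u} (R ⊗[Q] S)) ℤ)
    (F : CochainComplex (ModuleCat.{u} S) ℤ) (hF : HomologicallyBounded F) :
    CochainComplex (ModuleCat.{u} R) ℤ :=
  bimodTensorComplex X (projRes F hF).P

/-- `RHom_S(X, I)` as a complex of `R`-modules, computed by the injective resolution of `I`. -/
abbrev bimodRHom (X : CochainComplex (ModuleCat.{u} (R ⊗[Q] S)) ℤ)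
    (I : CochainComplex (ModuleCat.{u} S) ℤ) (hI : HomologicallyBounded I) :
    CochainComplex (ModuleCat.{u} R) ℤ :=
  bimodHomComplex X (injRes I hI).J

end Bimodules

end

end FoxbyClasses

/-!
Write `P` for a bounded-above complex of finitely generated projective modules resolving `D`; both
classes can be computed with `P`. Over a single ring, homomorphism evaluation
`P ⊗ Hom(W, U) ≅ Hom(Hom(P, W), U)` and the adjunction `Hom(P ⊗ X, U) ≅ Hom(P, Hom(X, U))` show
that `Hom(-, U)` exchanges the two classes for every bounded complex `U` of injectives. Character
duality, which detects quasi-isomorphisms and boundedness, provides converses.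

For a complex over an `A`-algebra `B`, membership with respect to `P` over `A` is the same as
membership with respect to `B ⊗ P` over `B`. With `B = R ⊗[Q] S`, the isomorphism
`Hom_S(X, U) ≅ Hom_B(X, Hom_S(B, U))` reduces the claims about `RHom_S(X, I)` to duality over `B`.
The character dual of `X ⊗_S F` is `Hom_S(X, -)` of the character dual of `F`, which has finite
injective dimension, so the claims about tensor products follow from those about homomorphisms.
-/

namespace FoxbyClasses

open CategoryTheory Limits MonoidalCategory Opposite

noncomputable section

section Boundedness

variable {C : Type*} [Category* C] [Abelian C] {K L : CochainComplex C ℤ}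

theorem homologicallyBounded_iff :
    HomologicallyBounded K ↔ ∃ a b : ℤ, ∀ n, (n < a ∨ b < n) → K.ExactAt n := by
  simp only [HomologicallyBounded, CochainComplex.isGE_iff, CochainComplex.isLE_iff, or_imp,
    forall_and]

theorem HomologicallyBounded.of_exactAt (hK : HomologicallyBounded K)
    (h : ∀ n, K.ExactAt n → L.ExactAt n) : HomologicallyBounded L := by
  rw [homologicallyBounded_iff] at hK ⊢
  obtain ⟨a, b, hab⟩ := hK
  exact ⟨a, b, fun n hn ↦ h n (hab n hn)⟩

theorem homologicallyBounded_iff_of_quasiIso (f : K ⟶ L) [QuasiIso f] :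
    HomologicallyBounded K ↔ HomologicallyBounded L :=
  ⟨fun h ↦ h.of_exactAt fun n ↦ (exactAt_iff_of_quasiIsoAt f n).1,
    fun h ↦ h.of_exactAt fun n ↦ (exactAt_iff_of_quasiIsoAt f n).2⟩

theorem StrictlyBounded.homologicallyBounded (hK : StrictlyBounded K) :
    HomologicallyBounded K := by
  obtain ⟨a, b, _, _⟩ := hK
  exact ⟨a, b, inferInstance, inferInstance⟩

end Boundedness

section DerivedCategory

variable {C : Type*} [Category* C] [Abelian C] {K L M : CochainComplex C ℤ}

attribute [local instance] HasDerivedCategory.standard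

theorem isIso_Qh_map_quotient_map (f : K ⟶ L) [QuasiIso f] :
    IsIso (DerivedCategory.Qh.map ((HomotopyCategory.quotient C (.up ℤ)).map f)) :=
  (NatIso.isIso_map_iff (DerivedCategory.quotientCompQhIso C) f).2
    (inferInstanceAs (IsIso (DerivedCategory.Q.map f)))

theorem bijective_precomp_of_isKInjective (f : K ⟶ L) [QuasiIso f]
    (U : CochainComplex C ℤ) [U.IsKInjective] :
    Function.Bijective fun g : (HomotopyCategory.quotient C _).obj L ⟶
      (HomotopyCategory.quotient C _).obj U ↦ (HomotopyCategory.quotient C _).map f ≫ g := by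
  have := isIso_Qh_map_quotient_map f
  have h := CochainComplex.IsKInjective.Qh_map_bijective (C := C) (L := U)
  refine (Function.Bijective.of_comp_iff' (h _) _).1 ?_
  convert (CategoryTheory.Iso.homFromEquiv (asIso (DerivedCategory.Qh.map
    ((HomotopyCategory.quotient C _).map f)))).symm.bijective.comp (h _) using 1
  ext g
  simp

theorem bijective_postcomp_of_isKProjective (P : CochainComplex C ℤ) [P.IsKProjective]
    (f : K ⟶ L) [QuasiIso f] :
    Function.Bijective fun g : (HomotopyCategory.quotient C _).obj P ⟶
      (HomotopyCategory.quotient C _).obj K ↦ g ≫ (HomotopyCategory.quotient C _).map f := by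
  have := isIso_Qh_map_quotient_map f
  have h := CochainComplex.IsKProjective.Qh_map_bijective (C := C) P
  refine (Function.Bijective.of_comp_iff' (h _) _).1 ?_
  convert (asIso (DerivedCategory.Qh.map
    ((HomotopyCategory.quotient C _).map f))).homToEquiv.bijective.comp (h _) using 1
  ext g
  simp

theorem Equivalent.of_quasiIso (f : K ⟶ L) [QuasiIso f] : Equivalent K L :=
  ⟨asIso (DerivedCategory.Q.map f)⟩

theorem Equivalent.symm (h : Equivalent K L) : Equivalent L K :=
  ⟨h.some.symm⟩

theorem Equivalent.trans (h : Equivalent K L) (h' : Equivalent L M) : Equivalent K M :=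
  ⟨h.some ≪≫ h'.some⟩

theorem Equivalent.nonempty_homotopyEquiv (h : Equivalent K L) [K.IsKInjective]
    [L.IsKInjective] : Nonempty (HomotopyEquiv K L) := by
  obtain ⟨e⟩ := h
  let E := DerivedCategory.quotientCompQhIso C
  have full {X Y : CochainComplex C ℤ} [Y.IsKInjective] :=
    CochainComplex.IsKInjective.Qh_map_bijective ((HomotopyCategory.quotient C _).obj X) Y
  obtain ⟨a, ha⟩ := full.surjective (E.hom.app K ≫ e.hom ≫ E.inv.app L)
  obtain ⟨b, hb⟩ := full.surjective (E.hom.app L ≫ e.inv ≫ E.inv.app K)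
  exact ⟨HomotopyCategory.homotopyEquivOfIso
    ⟨a, b, full.injective (by simp [ha, hb]), full.injective (by simp [ha, hb])⟩⟩

theorem Equivalent.exists_quasiIso (h : Equivalent K L) [K.IsKProjective] :
    ∃ f : K ⟶ L, QuasiIso f := by
  obtain ⟨e⟩ := h
  let E := DerivedCategory.quotientCompQhIso C
  obtain ⟨a, ha⟩ := (CochainComplex.IsKProjective.Qh_map_bijective K
    ((HomotopyCategory.quotient C _).obj L)).surjective (E.hom.app K ≫ e.hom ≫ E.inv.app L)
  obtain ⟨f, rfl⟩ := (HomotopyCategory.quotient C _).map_surjective a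
  refine ⟨f, ?_⟩
  rw [← DerivedCategory.isIso_Q_map_iff_quasiIso, ← NatIso.isIso_map_iff E f]
  change IsIso (DerivedCategory.Qh.map ((HomotopyCategory.quotient C _).map f))
  rw [ha]
  infer_instance

theorem exists_quasiIso_lift [K.IsKProjective] (p : K ⟶ M) [QuasiIso p] (f : L ⟶ M)
    [QuasiIso f] : ∃ g : K ⟶ L, QuasiIso g :=
  ((Equivalent.of_quasiIso p).trans (Equivalent.of_quasiIso f).symm).exists_quasiIso

end DerivedCategory

section HomComplexMaps

open CochainComplex CochainComplex.HomComplex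

variable {A : Type u} [CommRing A] {K L M P Z K' L' : CochainComplex (ModuleCat.{u} A) ℤ}

theorem isIso_of_bijective (f : K ⟶ L) (h : ∀ n, Function.Bijective (f.f n).hom) : IsIso f := by
  have (n : ℤ) : IsIso (f.f n) := (ConcreteCategory.isIso_iff_bijective _).2 (h n)
  exact HomologicalComplex.Hom.isIso_of_components f

/-- Precomposition `Hom(L, Z) ⟶ Hom(K, Z)` with a morphism `K ⟶ L`. -/
def homMapLeft (f : K ⟶ L) (Z : CochainComplex (ModuleCat.{u} A) ℤ) :
    homComplex L Z ⟶ homComplex K Z where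
  f n := ModuleCat.ofHom
    { toFun := fun z : Cochain L Z n ↦ (Cochain.ofHom f).comp z (zero_add n)
      map_add' := fun _ _ ↦ Cochain.comp_add _ _ _ _
      map_smul' := fun _ _ ↦ Cochain.comp_smul _ _ _ _ }
  comm' _ m _ := ModuleCat.hom_ext (LinearMap.ext fun z ↦ δ_ofHom_comp f z m)

/-- Postcomposition `Hom(P, K) ⟶ Hom(P, L)` with a morphism `K ⟶ L`. -/
def homMapRight (P : CochainComplex (ModuleCat.{u} A) ℤ) (f : K ⟶ L) :
    homComplex P K ⟶ homComplex P L where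
  f n := ModuleCat.ofHom
    { toFun := fun z : Cochain P K n ↦ z.comp (Cochain.ofHom f) (add_zero n)
      map_add' := fun _ _ ↦ Cochain.add_comp _ _ _ _
      map_smul' := fun _ _ ↦ Cochain.smul_comp _ _ _ _ }
  comm' _ m _ := ModuleCat.hom_ext (LinearMap.ext fun z ↦ δ_comp_ofHom z f m)

theorem homMapLeft_comp (f : K ⟶ L) (g : L ⟶ M) :
    homMapLeft (f ≫ g) Z = homMapLeft g Z ≫ homMapLeft f Z := by
  ext n (z : Cochain M Z n) : 3
  change (Cochain.ofHom (f ≫ g)).comp z (zero_add n) =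
    (Cochain.ofHom f).comp ((Cochain.ofHom g).comp z (zero_add n)) (zero_add n)
  rw [Cochain.ofHom_comp, Cochain.comp_assoc_of_first_is_zero_cochain]

theorem homMapRight_comp (f : K ⟶ L) (g : L ⟶ M) :
    homMapRight P (f ≫ g) = homMapRight P f ≫ homMapRight P g := by
  ext n (z : Cochain P K n) : 3
  change z.comp (Cochain.ofHom (f ≫ g)) (add_zero n) =
    (z.comp (Cochain.ofHom f) (add_zero n)).comp (Cochain.ofHom g) (add_zero n)
  rw [Cochain.ofHom_comp, Cochain.comp_assoc_of_third_is_zero_cochain]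

theorem quasiIso_iff_bijective_toHom (φ : homComplex K L ⟶ homComplex K' L')
    (ψ : ∀ n : ℤ, ((HomotopyCategory.quotient _ _).obj K ⟶
      (HomotopyCategory.quotient _ _).obj (L⟦n⟧)) → ((HomotopyCategory.quotient _ _).obj K' ⟶
        (HomotopyCategory.quotient _ _).obj (L'⟦n⟧)))
    (hψ : ∀ (n : ℤ) (z : Cocycle K L n) (z' : Cocycle K' L' n), z'.1 = (φ.f n).hom z.1 →
      CohomologyClass.toHom (CohomologyClass.mk z') =
        ψ n (CohomologyClass.toHom (CohomologyClass.mk z))) :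
    QuasiIso φ ↔ ∀ n, Function.Bijective (ψ n) := by
  rw [← HomologicalComplex.quasiIso_map_iff_of_preservesHomology φ
    (forget₂ (ModuleCat.{u} A) AddCommGrpCat.{u}), quasiIso_iff]
  refine forall_congr' fun n ↦ ?_
  let φ' : HomComplex K L ⟶ HomComplex K' L' :=
    ((forget₂ (ModuleCat.{u} A) AddCommGrpCat.{u}).mapHomologicalComplex _).map φ
  let γ : ShortComplex.LeftHomologyMapData
      ((HomologicalComplex.shortComplexFunctor _ _ n).map φ')
      (leftHomologyData K L n) (leftHomologyData K' L' n) := default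
  have hγ : CohomologyClass.toHom ∘ γ.φH.hom = ψ n ∘ CohomologyClass.toHom := by
    ext c
    obtain ⟨z, rfl⟩ := c.mk_surjective
    have hi : (γ.φK.hom z).1 = (φ.f n).hom z.1 :=
      congrArg (fun g ↦ g.hom z) γ.commi
    have hπ : γ.φH.hom (CohomologyClass.mk z) = CohomologyClass.mk (γ.φK.hom z) :=
      ConcreteCategory.congr_hom γ.commπ z
    exact (congrArg _ hπ).trans (hψ n z _ hi)
  rw [quasiIsoAt_iff]
  refine γ.quasiIso_iff.trans ((ConcreteCategory.isIso_iff_bijective _).trans ?_)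
  rw [← Function.Bijective.of_comp_iff (ψ n) (CohomologyClass.toHom_bijective K L n), ← hγ]
  exact (Function.Bijective.of_comp_iff' (CohomologyClass.toHom_bijective K' L' n) _).symm

theorem quasiIso_homMapLeft_iff (f : K ⟶ L) :
    QuasiIso (homMapLeft f Z) ↔ ∀ n : ℤ, Function.Bijective
      fun g : (HomotopyCategory.quotient _ _).obj L ⟶
        (HomotopyCategory.quotient _ _).obj (Z⟦n⟧) ↦ (HomotopyCategory.quotient _ _).map f ≫ g := by
  refine quasiIso_iff_bijective_toHom _ _ fun n z z' h ↦ ?_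
  obtain rfl : z' = z.precomp f := Cocycle.ext h
  rw [CohomologyClass.toHom_mk, CohomologyClass.toHom_mk, Cocycle.equivHomShift_symm_precomp,
    Functor.map_comp]

theorem quasiIso_homMapRight_iff (f : K ⟶ L) :
    QuasiIso (homMapRight P f) ↔ ∀ n : ℤ, Function.Bijective
      fun g : (HomotopyCategory.quotient _ _).obj P ⟶ (HomotopyCategory.quotient _ _).obj (K⟦n⟧) ↦
        g ≫ (HomotopyCategory.quotient _ _).map (f⟦n⟧') := by
  refine quasiIso_iff_bijective_toHom _ _ fun n z z' h ↦ ?_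
  obtain rfl : z' = z.postcomp f := Cocycle.ext h
  rw [CohomologyClass.toHom_mk, CohomologyClass.toHom_mk, Cocycle.equivHomShift_symm_postcomp,
    Functor.map_comp]

theorem quasiIso_homMapLeft (f : K ⟶ L) [QuasiIso f] (U : CochainComplex (ModuleCat.{u} A) ℤ)
    [U.IsKInjective] : QuasiIso (homMapLeft f U) :=
  (quasiIso_homMapLeft_iff f).2 fun n ↦ bijective_precomp_of_isKInjective f (U⟦n⟧)

theorem quasiIso_homMapRight (P : CochainComplex (ModuleCat.{u} A) ℤ) [P.IsKProjective]
    (f : K ⟶ L) [QuasiIso f] : QuasiIso (homMapRight P f) := by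
  refine (quasiIso_homMapRight_iff f).2 fun n ↦ ?_
  have : QuasiIso (f⟦n⟧') := inferInstance
  exact bijective_postcomp_of_isKProjective P (f⟦n⟧')

theorem quasiIso_homMapLeft_hom (e : HomotopyEquiv K L) (Z : CochainComplex (ModuleCat.{u} A) ℤ) :
    QuasiIso (homMapLeft e.hom Z) :=
  (quasiIso_homMapLeft_iff e.hom).2 fun _ ↦
    (HomotopyCategory.isoOfHomotopyEquiv e).homFromEquiv.symm.bijective

theorem quasiIso_homMapRight_hom (P : CochainComplex (ModuleCat.{u} A) ℤ)
    (e : HomotopyEquiv K L) : QuasiIso (homMapRight P e.hom) := by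
  refine (quasiIso_homMapRight_iff e.hom).2 fun n ↦ ?_
  have : IsIso ((HomotopyCategory.quotient (ModuleCat.{u} A) (.up ℤ)).map e.hom) :=
    (HomotopyCategory.isoOfHomotopyEquiv e).isIso_hom
  have : IsIso ((HomotopyCategory.quotient (ModuleCat.{u} A) (.up ℤ)).map (e.hom⟦n⟧')) :=
    (NatIso.isIso_map_iff ((HomotopyCategory.quotient _ _).commShiftIso n) e.hom).2
      (inferInstanceAs (IsIso (((HomotopyCategory.quotient _ _).map e.hom)⟦n⟧')))
  exact (asIso ((HomotopyCategory.quotient _ _).map (e.hom⟦n⟧'))).homToEquiv.bijective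

end HomComplexMaps

/-! ### The adjunction between tensor product and homomorphisms, on elements -/

section Elements

open CochainComplex.HomComplex

variable {A : Type u} [CommRing A] {K L P P' W X X' : CochainComplex (ModuleCat.{u} A) ℤ}
  {M : Type u} [AddCommGroup M] [Module A M] {i j n : ℤ}

/-- The bilinear map `P^i × X^n ⟶ (P ⊗ X)^j`, where `i + n = j`. -/
def tmul (P X : CochainComplex (ModuleCat.{u} A) ℤ) (h : i + n = j) :
    P.X i →ₗ[A] X.X n →ₗ[A] (tensorComplex P X).X j :=
  (TensorProduct.mk A (P.X i) (X.X n)).compr₂ (HomologicalComplex.ιTensorObj P X i n j h).hom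

theorem tensorComplex_hom_ext {f g : (tensorComplex P X).X j →ₗ[A] M}
    (h : ∀ i n (hij : i + n = j) p x, f (tmul P X hij p x) = g (tmul P X hij p x)) : f = g := by
  have : ModuleCat.ofHom f = ModuleCat.ofHom g :=
    HomologicalComplex.mapBifunctor.hom_ext fun i n hij ↦
      ModuleCat.hom_ext (TensorProduct.ext' fun p x ↦ h i n hij p x)
  exact congrArg ModuleCat.Hom.hom this

theorem tensorComplex_addHom_ext {G : Type*} [AddCommGroup G]
    {g g' : (tensorComplex P X).X j →+ G}
    (h : ∀ i n (hij : i + n = j) p x, g (tmul P X hij p x) = g' (tmul P X hij p x)) : g = g' := by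
  let N : Submodule A ((tensorComplex P X).X j) :=
    { carrier := {t | ∀ a : A, g (a • t) = g' (a • t)}
      zero_mem' := fun a ↦ by simp
      add_mem' := fun hx hy a ↦ by rw [smul_add, map_add, map_add, hx, hy]
      smul_mem' := fun b x hx a ↦ by rw [smul_smul, hx] }
  have hN : N.mkQ = 0 := tensorComplex_hom_ext fun i n hij p x ↦ by
    rw [LinearMap.zero_apply, Submodule.mkQ_apply, Submodule.Quotient.mk_eq_zero]
    intro a
    rw [← LinearMap.smul_apply, ← map_smul, h]
  refine AddMonoidHom.ext fun t ↦ ?_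
  have ht : t ∈ N := by
    rw [← Submodule.ker_mkQ N, hN]
    trivial
  simpa using ht 1

/-- The linear map out of `(P ⊗ X)^j` given by bilinear maps. -/
def tensorLift (φ : ∀ i n, i + n = j → P.X i →ₗ[A] X.X n →ₗ[A] M) :
    (tensorComplex P X).X j →ₗ[A] M :=
  (HomologicalComplex.mapBifunctorDesc (K₁ := P) (K₂ := X)
    (F := curriedTensor (ModuleCat.{u} A)) (c := ComplexShape.up ℤ) (j := j)
    (A := ModuleCat.of A M)
    fun i n hij ↦ ModuleCat.ofHom (TensorProduct.lift (φ i n hij))).hom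

theorem tensorLift_tmul (φ : ∀ i n, i + n = j → P.X i →ₗ[A] X.X n →ₗ[A] M)
    {i n : ℤ} (hij : i + n = j) (p : P.X i) (x : X.X n) :
    tensorLift φ (tmul P X hij p x) = φ i n hij p x := by
  have h := HomologicalComplex.ι_mapBifunctorDesc (K₁ := P) (K₂ := X)
    (F := curriedTensor (ModuleCat.{u} A)) (c := ComplexShape.up ℤ) (j := j)
    (A := ModuleCat.of A M)
    (fun i n hij ↦ ModuleCat.ofHom (TensorProduct.lift (φ i n hij))) i n hij
  exact LinearMap.congr_fun (congrArg ModuleCat.Hom.hom h) (p ⊗ₜ x)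

theorem d_tmul {i' n' k : ℤ} (hij : i + n = j) (hi : i + 1 = i') (hn : n + 1 = n')
    (hik : i' + n = k) (hnk : i + n' = k) (p : P.X i) (x : X.X n) :
    ((tensorComplex P X).d j k).hom (tmul P X hij p x) =
      tmul P X hik ((P.d i i').hom p) x +
        i.negOnePow • tmul P X hnk p ((X.d n n').hom x) :=
  tensorComplex_d_tmul P X i n j i' n' k hij hi hn hik hnk p x

/-- The morphism `P ⊗ X ⟶ P' ⊗ X'` induced by `f` and `g`. -/
abbrev tensorMap (f : P ⟶ P') (g : X ⟶ X') : tensorComplex P X ⟶ tensorComplex P' X' :=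
  HomologicalComplex.tensorHom f g

theorem tensorMap_tmul (f : P ⟶ P') (g : X ⟶ X') (hij : i + n = j) (p : P.X i) (x : X.X n) :
    ((tensorMap f g).f j).hom (tmul P X hij p x) =
      tmul P' X' hij ((f.f i).hom p) ((g.f n).hom x) := by
  have h := HomologicalComplex.ι_mapBifunctorMap f g (curriedTensor (ModuleCat.{u} A))
    (ComplexShape.up ℤ) i n j hij
  exact LinearMap.congr_fun (congrArg ModuleCat.Hom.hom h) (p ⊗ₜ x)

theorem tensorComplex_ext {f g : tensorComplex P X ⟶ W}
    (h : ∀ i n j (hij : i + n = j) p x,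
      (f.f j).hom (tmul P X hij p x) = (g.f j).hom (tmul P X hij p x)) : f = g :=
  HomologicalComplex.hom_ext _ _ fun j ↦
    ModuleCat.hom_ext (tensorComplex_hom_ext fun i n hij p x ↦ h i n j hij p x)

/-- The components of an element of `Hom(P, W)`. -/
def homEval (P W : CochainComplex (ModuleCat.{u} A) ℤ) (h : i + n = j) :
    (homComplex P W).X n →ₗ[A] P.X i →ₗ[A] W.X j where
  toFun z := (Cochain.v z i j h).hom
  map_add' _ _ := rfl
  map_smul' _ _ := rfl

/-- The linear map to `Hom(P, W)^n` with given components. -/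
def homMk (f : ∀ i j, i + n = j → M →ₗ[A] P.X i →ₗ[A] W.X j) :
    M →ₗ[A] (homComplex P W).X n where
  toFun m := Cochain.mk fun i j h ↦ ModuleCat.ofHom (f i j h m)
  map_add' m m' := Cochain.ext _ _ fun i j h ↦ ModuleCat.hom_ext ((f i j h).map_add m m')
  map_smul' r m := Cochain.ext _ _ fun i j h ↦ ModuleCat.hom_ext ((f i j h).map_smul r m)

@[simp]
theorem homEval_homMk (f : ∀ i j, i + n = j → M →ₗ[A] P.X i →ₗ[A] W.X j)
    (m : M) {i j : ℤ} (h : i + n = j) : homEval P W h (homMk f m) = f i j h m := rfl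

theorem homEval_ext {z z' : (homComplex P W).X n}
    (h : ∀ i j (hij : i + n = j) p, homEval P W hij z p = homEval P W hij z' p) : z = z' :=
  Cochain.ext _ _ fun i j hij ↦ ModuleCat.hom_ext (LinearMap.ext fun p ↦ h i j hij p)

theorem homEval_d {m i' j' : ℤ} (hm : n + 1 = m) (hi : i + 1 = i') (hj : j + 1 = j')
    (hij : i + n = j) (hij' : i + m = j') (h : i' + n = j') (z : (homComplex P W).X n) (p : P.X i) :
    homEval P W hij' (((homComplex P W).d n m).hom z) p =
      (W.d j j').hom (homEval P W hij z p) +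
        m.negOnePow • homEval P W h z ((P.d i i').hom p) := by
  have := δ_v n m hm z i j' hij' j i' (by lia) hi
  exact LinearMap.congr_fun (congrArg ModuleCat.Hom.hom this) p

theorem homEval_homMapLeft (f : K ⟶ L) (Z : CochainComplex (ModuleCat.{u} A) ℤ)
    (hij : i + n = j) (z : (homComplex L Z).X n) (x : K.X i) :
    homEval K Z hij (((homMapLeft f Z).f n).hom z) x = homEval L Z hij z ((f.f i).hom x) :=
  LinearMap.congr_fun (congrArg ModuleCat.Hom.hom
    ((Cochain.zero_cochain_comp_v (Cochain.ofHom f) z i j hij).trans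
      (congrArg (· ≫ Cochain.v z i j hij) (Cochain.ofHom_v f i)))) x

theorem homEval_homMapRight (P : CochainComplex (ModuleCat.{u} A) ℤ) (f : K ⟶ L)
    (hij : i + n = j) (z : (homComplex P K).X n) (p : P.X i) :
    homEval P L hij (((homMapRight P f).f n).hom z) p = (f.f j).hom (homEval P K hij z p) :=
  LinearMap.congr_fun (congrArg ModuleCat.Hom.hom
    ((Cochain.comp_zero_cochain_v z (Cochain.ofHom f) i j hij).trans
      (congrArg (Cochain.v z i j hij ≫ ·) (Cochain.ofHom_v f j)))) p

theorem homComplex_ext {f g : K ⟶ homComplex P W}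
    (h : ∀ n (x : K.X n) i j (hij : i + n = j) p,
      homEval P W hij ((f.f n).hom x) p = homEval P W hij ((g.f n).hom x) p) : f = g :=
  HomologicalComplex.hom_ext _ _ fun n ↦ ModuleCat.hom_ext (LinearMap.ext fun x ↦
    homEval_ext fun i j hij p ↦ h n x i j hij p)

end Elements

section Adjunction

open CochainComplex.HomComplex

variable {A : Type u} [CommRing A] {P P' W W' X X' : CochainComplex (ModuleCat.{u} A) ℤ}
  {i j k l m n : ℤ}

/-- The morphism `X ⟶ Hom(P, W)` adjoint to `φ : P ⊗ X ⟶ W`. -/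
def adj (φ : tensorComplex P X ⟶ W) : X ⟶ homComplex P W :=
  unitHom P X ≫ homMapRight P φ

/-- The morphism `P ⊗ X ⟶ W` adjoint to `ψ : X ⟶ Hom(P, W)`. -/
def coadj (ψ : X ⟶ homComplex P W) : tensorComplex P X ⟶ W :=
  tensorMap (𝟙 P) ψ ≫ counitHom P W

theorem homEval_adj (φ : tensorComplex P X ⟶ W) (x : X.X n) (hij : i + n = j) (p : P.X i) :
    homEval P W hij (((adj φ).f n).hom x) p =
      (i * n).negOnePow • (φ.f j).hom (tmul P X hij p x) :=
  (homEval_homMapRight P φ hij (unitCochain P X n x) p).trans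
    (map_zsmul_unit (φ.f j).hom (i * n).negOnePow (tmul P X hij p x))

theorem coadj_tmul (ψ : X ⟶ homComplex P W) (hij : i + n = j) (p : P.X i) (x : X.X n) :
    ((coadj ψ).f j).hom (tmul P X hij p x) =
      (i * n).negOnePow • homEval P W hij ((ψ.f n).hom x) p := by
  change (counitMap P W j).hom (((tensorMap (𝟙 P) ψ).f j).hom (tmul P X hij p x)) = _
  rw [tensorMap_tmul]
  exact counitMap_tmul P W i n j hij p _

theorem adj_coadj (ψ : X ⟶ homComplex P W) : adj (coadj ψ) = ψ := by
  refine homComplex_ext fun n x i j hij p ↦ ?_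
  rw [homEval_adj, coadj_tmul, smul_smul, Int.units_mul_self, one_smul]

theorem coadj_adj (φ : tensorComplex P X ⟶ W) : coadj (adj φ) = φ := by
  refine tensorComplex_ext fun i n j hij p x ↦ ?_
  rw [coadj_tmul, homEval_adj, smul_smul, Int.units_mul_self, one_smul]

theorem adj_comp (φ : tensorComplex P X ⟶ W) (g : W ⟶ W') :
    adj (φ ≫ g) = adj φ ≫ homMapRight P g := by
  rw [adj, homMapRight_comp, adj, Category.assoc]

theorem adj_tensorMap_left (e : P' ⟶ P) (φ : tensorComplex P X ⟶ W) :
    adj (tensorMap e (𝟙 X) ≫ φ) = adj φ ≫ homMapLeft e W := by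
  refine homComplex_ext fun n x i j hij p ↦ ?_
  rw [HomologicalComplex.comp_f, ModuleCat.hom_comp, LinearMap.comp_apply, homEval_homMapLeft,
    homEval_adj, homEval_adj, HomologicalComplex.comp_f, ModuleCat.hom_comp,
    LinearMap.comp_apply, tensorMap_tmul]
  rfl

theorem adj_tensorMap_right (f : X' ⟶ X) (φ : tensorComplex P X ⟶ W) :
    adj (tensorMap (𝟙 P) f ≫ φ) = f ≫ adj φ := by
  refine homComplex_ext fun n x i j hij p ↦ ?_
  rw [HomologicalComplex.comp_f, ModuleCat.hom_comp, LinearMap.comp_apply,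
    homEval_adj, homEval_adj, HomologicalComplex.comp_f, ModuleCat.hom_comp,
    LinearMap.comp_apply, tensorMap_tmul]
  rfl

theorem coadj_comp_homMapRight (g : W ⟶ W') (ψ : X ⟶ homComplex P W) :
    coadj (ψ ≫ homMapRight P g) = coadj ψ ≫ g := by
  rw [← coadj_adj (coadj ψ ≫ g), adj_comp, adj_coadj]

theorem tensorMap_id (P X : CochainComplex (ModuleCat.{u} A) ℤ) :
    tensorMap (𝟙 P) (𝟙 X) = 𝟙 _ := by
  refine tensorComplex_ext fun i n j hij p x ↦ ?_
  rw [tensorMap_tmul]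
  rfl

theorem homMapRight_id (P Z : CochainComplex (ModuleCat.{u} A) ℤ) :
    homMapRight P (𝟙 Z) = 𝟙 _ :=
  homComplex_ext fun _ x _ _ hij p ↦ homEval_homMapRight P (𝟙 Z) hij x p

theorem adj_id (P X : CochainComplex (ModuleCat.{u} A) ℤ) :
    adj (𝟙 (tensorComplex P X)) = unitHom P X := by
  rw [adj, homMapRight_id, Category.comp_id]

theorem coadj_id (P Y : CochainComplex (ModuleCat.{u} A) ℤ) :
    coadj (𝟙 (homComplex P Y)) = counitHom P Y := by
  rw [coadj, tensorMap_id, Category.id_comp]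

variable (P X) in
/-- Currying `Hom(P ⊗ X, U)^n ⟶ Hom(P, Hom(X, U))^n`. -/
def curryMap (U : CochainComplex (ModuleCat.{u} A) ℤ) (n : ℤ) :
    (homComplex (tensorComplex P X) U).X n →ₗ[A] (homComplex P (homComplex X U)).X n :=
  homMk fun i j hij ↦ LinearMap.flip
    { toFun := fun p ↦ homMk fun k l hkl ↦
        (tmul P X (rfl : i + k = i + k) p).lcomp A _ ∘ₗ
          homEval (tensorComplex P X) U (show i + k + n = l by lia)
      map_add' := fun p p' ↦ by
        refine LinearMap.ext fun z ↦ homEval_ext fun k l hkl x ↦ ?_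
        simp
      map_smul' := fun r p ↦ by
        refine LinearMap.ext fun z ↦ homEval_ext fun k l hkl x ↦ ?_
        simp }

theorem homEval_curryMap (U : CochainComplex (ModuleCat.{u} A) ℤ) (hij : i + n = j)
    (hkl : k + j = l) (hik : i + k = m) (hm : m + n = l)
    (z : (homComplex (tensorComplex P X) U).X n) (p : P.X i) (x : X.X k) :
    homEval X U hkl (homEval P (homComplex X U) hij (curryMap P X U n z) p) x =
      homEval (tensorComplex P X) U hm z (tmul P X hik p x) := by
  subst hik
  rfl

variable (P X) in
/-- Currying `Hom(P ⊗ X, U) ⟶ Hom(P, Hom(X, U))`. -/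
def curry (U : CochainComplex (ModuleCat.{u} A) ℤ) :
    homComplex (tensorComplex P X) U ⟶ homComplex P (homComplex X U) where
  f n := ModuleCat.ofHom (curryMap P X U n)
  comm' n m hnm := by
    obtain rfl : n + 1 = m := hnm
    refine ModuleCat.hom_ext (LinearMap.ext fun z ↦ ?_)
    refine homEval_ext fun i j hij p ↦ homEval_ext fun k l hkl x ↦ ?_
    obtain rfl : j = i + n + 1 := by lia
    obtain rfl : l = i + k + n + 1 := by lia
    change homEval X U hkl (homEval P (homComplex X U) hij
        (((homComplex P (homComplex X U)).d n (n + 1)).hom (curryMap P X U n z)) p) x =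
      homEval X U hkl (homEval P (homComplex X U) hij
        (curryMap P X U (n + 1) (((homComplex (tensorComplex P X) U).d n (n + 1)).hom z)) p) x
    rw [homEval_curryMap U hij hkl rfl (by lia),
      homEval_d (i' := i + k + 1) (j := i + k + n) rfl rfl rfl rfl _ (by lia),
      homEval_d (i' := i + 1) (j := i + n) rfl rfl rfl rfl _ (by lia),
      d_tmul (i' := i + 1) (n' := k + 1) rfl rfl rfl (by lia) (by lia), map_add, map_add,
      LinearMap.add_apply,
      homEval_d (i' := k + 1) (j := i + k + n) rfl rfl rfl (by lia) _ (by lia),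
      homEval_curryMap U _ _ rfl rfl, homEval_curryMap U _ _ (show i + (k + 1) = i + k + 1 by lia)
      (by lia), map_zsmul_unit, map_zsmul_unit, LinearMap.smul_apply,
      homEval_curryMap U _ _ (show i + 1 + k = i + k + 1 by lia) (by lia), smul_add, smul_smul,
      ← Int.negOnePow_add, show n + 1 + i = i + n + 1 by ring]
    abel

theorem bijective_curryMap (U : CochainComplex (ModuleCat.{u} A) ℤ) (n : ℤ) :
    Function.Bijective (curryMap P X U n) := by
  refine ⟨(injective_iff_map_eq_zero _).2 fun z hz ↦ homEval_ext fun m l hml y ↦ ?_, fun w ↦ ?_⟩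
  · have : homEval (tensorComplex P X) U hml z = 0 := tensorComplex_hom_ext fun i k hik p x ↦ by
      rw [← homEval_curryMap U rfl (show k + (i + n) = l by lia) hik hml, hz]
      simp
    rw [this]
    simp
  · let z : (homComplex (tensorComplex P X) U).X n := homMk (M := A) (fun m l hml ↦
      LinearMap.toSpanSingleton A _ (tensorLift fun i k hik ↦
        homEval X U (show k + (i + n) = l by lia) ∘ₗ homEval P (homComplex X U) rfl w)) 1
    refine ⟨z, homEval_ext fun i j hij p ↦ homEval_ext fun k l hkl x ↦ ?_⟩
    subst hij
    rw [homEval_curryMap U rfl hkl rfl (by lia), homEval_homMk, LinearMap.toSpanSingleton_apply,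
      one_smul, tensorLift_tmul]
    rfl

instance isIso_curry (U : CochainComplex (ModuleCat.{u} A) ℤ) : IsIso (curry P X U) :=
  isIso_of_bijective _ fun n ↦ bijective_curryMap U n

theorem curry_naturality_left (e : P' ⟶ P) (U : CochainComplex (ModuleCat.{u} A) ℤ) :
    homMapLeft (tensorMap e (𝟙 X)) U ≫ curry P' X U =
      curry P X U ≫ homMapLeft e (homComplex X U) := by
  refine homComplex_ext fun n z i j hij p ↦ homEval_ext fun k l hkl x ↦ ?_
  simp only [HomologicalComplex.comp_f, ModuleCat.hom_comp, LinearMap.comp_apply]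
  rw [homEval_homMapLeft]
  refine (homEval_curryMap U hij hkl rfl (by lia) _ p x).trans ?_
  rw [homEval_homMapLeft, tensorMap_tmul]
  exact (homEval_curryMap U hij hkl rfl (by lia) z _ x).symm

theorem curry_naturality_right (f : X' ⟶ X) (U : CochainComplex (ModuleCat.{u} A) ℤ) :
    homMapLeft (tensorMap (𝟙 P) f) U ≫ curry P X' U =
      curry P X U ≫ homMapRight P (homMapLeft f U) := by
  refine homComplex_ext fun n z i j hij p ↦ homEval_ext fun k l hkl x ↦ ?_
  simp only [HomologicalComplex.comp_f, ModuleCat.hom_comp, LinearMap.comp_apply]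
  rw [homEval_homMapRight, homEval_homMapLeft]
  refine (homEval_curryMap U hij hkl rfl (by lia) _ p x).trans ?_
  rw [homEval_homMapLeft, tensorMap_tmul]
  exact (homEval_curryMap U hij hkl rfl (by lia) z p _).symm

end Adjunction

section StrictBounds

variable {A : Type u} [CommRing A]

theorem isZero_of_forall_eq_zero {M : ModuleCat.{u} A} (h : ∀ x : M, x = 0) : IsZero M :=
  have : Subsingleton M := ⟨fun x y ↦ (h x).trans (h y).symm⟩
  ModuleCat.isZero_of_subsingleton M

theorem eq_zero_of_isZero {M : ModuleCat.{u} A} (h : IsZero M) (x : M) : x = 0 :=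
  (ModuleCat.isZero_iff_subsingleton.1 h).elim x 0

variable {P W : CochainComplex (ModuleCat.{u} A) ℤ}

theorem isZero_homComplex_X {n : ℤ}
    (h : ∀ i j, i + n = j → IsZero (P.X i) ∨ IsZero (W.X j)) :
    IsZero ((homComplex P W).X n) :=
  isZero_of_forall_eq_zero fun z ↦ homEval_ext fun i j hij p ↦ by
    obtain h | h := h i j hij
    · rw [eq_zero_of_isZero h p, map_zero, map_zero]
    · rw [eq_zero_of_isZero h (homEval P W hij z p), map_zero, LinearMap.zero_apply]

theorem isStrictlyGE_homComplex (a b : ℤ) [P.IsStrictlyLE b] [W.IsStrictlyGE a] :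
    (homComplex P W).IsStrictlyGE (a - b) := by
  rw [CochainComplex.isStrictlyGE_iff]
  refine fun n hn ↦ isZero_homComplex_X fun i j hij ↦ ?_
  by_cases hi : b < i
  · exact Or.inl (P.isZero_of_isStrictlyLE b i hi)
  · exact Or.inr (W.isZero_of_isStrictlyGE a j (by lia))

theorem isStrictlyLE_homComplex (a b : ℤ) [P.IsStrictlyGE a] [W.IsStrictlyLE b] :
    (homComplex P W).IsStrictlyLE (b - a) := by
  rw [CochainComplex.isStrictlyLE_iff]
  refine fun n hn ↦ isZero_homComplex_X fun i j hij ↦ ?_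
  by_cases hi : i < a
  · exact Or.inl (P.isZero_of_isStrictlyGE a i hi)
  · exact Or.inr (W.isZero_of_isStrictlyLE b j (by lia))

theorem StrictlyBounded.homComplex (hP : StrictlyBounded P) (hW : StrictlyBounded W) :
    StrictlyBounded (homComplex P W) := by
  obtain ⟨a, b, _, _⟩ := hP
  obtain ⟨c, d, _, _⟩ := hW
  exact ⟨c - b, d - a, isStrictlyGE_homComplex c b, isStrictlyLE_homComplex a d⟩

theorem isStrictlyLE_tensorComplex (a b : ℤ) [P.IsStrictlyLE a] [W.IsStrictlyLE b] :
    (tensorComplex P W).IsStrictlyLE (a + b) := by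
  rw [CochainComplex.isStrictlyLE_iff]
  refine fun n hn ↦ isZero_of_forall_eq_zero fun x ↦ ?_
  refine LinearMap.congr_fun (f := LinearMap.id) (g := 0)
    (tensorComplex_hom_ext fun i j hij p w ↦ ?_) x
  rw [LinearMap.id_apply, LinearMap.zero_apply]
  by_cases hi : a < i
  · rw [eq_zero_of_isZero (P.isZero_of_isStrictlyLE a i hi) p, map_zero, LinearMap.zero_apply]
  · rw [eq_zero_of_isZero (W.isZero_of_isStrictlyLE b j (by lia)) w, map_zero]

end StrictBounds

section Cones

open Pretriangulated CochainComplex.HomComplex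

theorem eq_zero_of_injective_of_surjective_precomp {C : Type*} [Category* C] [Preadditive C]
    [HasZeroObject C] [HasShift C ℤ] [∀ n : ℤ, (shiftFunctor C n).Additive] [Pretriangulated C]
    {T : Triangle C} (hT : T ∈ distTriang C) {U V : C} (e : U ≅ V⟦(1 : ℤ)⟧)
    (hU : Function.Injective fun g : T.obj₂ ⟶ U ↦ T.mor₁ ≫ g)
    (hV : Function.Surjective fun g : T.obj₂ ⟶ V ↦ T.mor₁ ≫ g) (g : T.obj₃ ⟶ U) : g = 0 := by
  have hg : T.mor₂ ≫ g = 0 := hU <| by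
    simp [← Category.assoc, comp_distTriang_mor_zero₁₂ T hT]
  obtain ⟨h, rfl⟩ := T.yoneda_exact₃ hT g hg
  obtain ⟨k, hk⟩ := (shiftFunctor C (1 : ℤ)).map_surjective (h ≫ e.hom)
  obtain ⟨l, rfl⟩ := hV k
  rw [← cancel_mono e.hom, Category.assoc, ← hk, Functor.map_comp, ← Category.assoc,
    comp_distTriang_mor_zero₃₁ T hT, zero_comp, zero_comp]

theorem quasiIso_iff_acyclic_mappingCone {C : Type*} [Category* C] [Abelian C]
    {K L : CochainComplex C ℤ} (f : K ⟶ L) :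
    QuasiIso f ↔ (CochainComplex.mappingCone f).Acyclic := by
  rw [← HomotopyCategory.quotient_obj_mem_subcategoryAcyclic_iff_acyclic,
    ← HomologicalComplex.mem_quasiIso_iff, ← HomotopyCategory.quotient_map_mem_quasiIso_iff,
    HomotopyCategory.quasiIso_eq_trW_subcategoryAcyclic]
  exact (HomotopyCategory.subcategoryAcyclic C).trW_iff_of_distinguished _
    (HomotopyCategory.mappingCone_triangleh_distinguished f)

variable {A : Type u} [CommRing A] {K L : CochainComplex (ModuleCat.{u} A) ℤ} {n : ℤ}

theorem exactAt_homComplex_iff : (homComplex K L).ExactAt n ↔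
    ∀ g : (HomotopyCategory.quotient _ _).obj K ⟶ (HomotopyCategory.quotient _ _).obj (L⟦n⟧),
      g = 0 := by
  rw [HomologicalComplex.exactAt_iff, ShortComplex.exact_iff_exact_map_forget₂]
  refine (leftHomologyData K L n).exact_iff.trans ?_
  rw [AddCommGrpCat.isZero_iff_subsingleton]
  change Subsingleton (CohomologyClass K L n) ↔ _
  rw [(Equiv.ofBijective _ (CohomologyClass.toHom_bijective K L n)).subsingleton_congr]
  exact ⟨fun _ g ↦ Subsingleton.elim _ _, fun h ↦ ⟨fun g g' ↦ (h g).trans (h g').symm⟩⟩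

theorem exactAt_homComplex_mappingCone (f : K ⟶ L) (U : CochainComplex (ModuleCat.{u} A) ℤ)
    [QuasiIso (homMapLeft f U)] (n : ℤ) :
    (homComplex (CochainComplex.mappingCone f) U).ExactAt n := by
  have h := (quasiIso_homMapLeft_iff (Z := U) f).1 inferInstance
  let Q := HomotopyCategory.quotient (ModuleCat.{u} A) (.up ℤ)
  let e : Q.obj (U⟦n⟧) ≅ (Q.obj (U⟦n - 1⟧))⟦(1 : ℤ)⟧ :=
    Q.mapIso ((shiftFunctorAdd' _ (n - 1) 1 n (by lia)).app U) ≪≫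
      (Q.commShiftIso (1 : ℤ)).app (U⟦n - 1⟧)
  exact exactAt_homComplex_iff.2 (eq_zero_of_injective_of_surjective_precomp
    (HomotopyCategory.mappingCone_triangleh_distinguished f) e (h n).1 (h (n - 1)).2)

end Cones

/-! ### Characters -/

section Characters

open CochainComplex.HomComplex

variable {A : Type u} [CommRing A]

theorem exactAt_iff_forall_exists (K : CochainComplex (ModuleCat.{u} A) ℤ) (n : ℤ) :
    K.ExactAt n ↔ ∀ x : K.X n, (K.d n (n + 1)).hom x = 0 →
      ∃ y : K.X (n - 1), (K.d (n - 1) n).hom y = x := by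
  rw [HomologicalComplex.exactAt_iff' K (n - 1) n (n + 1) (by simp) (by simp),
    ShortComplex.moduleCat_exact_iff]
  rfl

theorem exists_character_of_notMem {M : Type u} [AddCommGroup M] [Module A M]
    (N : Submodule A M) {x : M} (hx : x ∉ N) :
    ∃ χ : CharacterModule M, (∀ y ∈ N, χ y = 0) ∧ χ x ≠ 0 := by
  obtain ⟨c, hc⟩ := CharacterModule.exists_character_apply_ne_zero_of_ne_zero
    (a := N.mkQ x) (by simpa using hx)
  refine ⟨CharacterModule.dual N.mkQ c, fun y hy ↦ ?_, hc⟩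
  change c (N.mkQ y) = 0
  rw [Submodule.mkQ_apply, (Submodule.Quotient.mk_eq_zero N).2 hy, map_zero]

variable (A) in
/-- The character module of `A`, as a complex concentrated in degree `0`. -/
def charComplex : CochainComplex (ModuleCat.{u} A) ℤ :=
  (HomologicalComplex.single (ModuleCat.{u} A) (ComplexShape.up ℤ) 0).obj
    (ModuleCat.of A (CharacterModule A))

instance : (charComplex A).IsStrictlyGE 0 :=
  inferInstanceAs (CochainComplex.IsStrictlyGE
    ((HomologicalComplex.single (ModuleCat.{u} A) (ComplexShape.up ℤ) 0).obj _) 0)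

instance : (charComplex A).IsStrictlyLE 0 :=
  inferInstanceAs (CochainComplex.IsStrictlyLE
    ((HomologicalComplex.single (ModuleCat.{u} A) (ComplexShape.up ℤ) 0).obj _) 0)

variable (A) in
theorem strictlyBounded_charComplex : StrictlyBounded (charComplex A) :=
  ⟨0, 0, inferInstance, inferInstance⟩

variable (A) in
theorem charComplex_d (i j : ℤ) : (charComplex A).d i j = 0 :=
  HomologicalComplex.single_obj_d _ _ _ _ _

variable (A) in
/-- The module in degree `0` of `charComplex A`. -/
def charEquiv : (charComplex A).X 0 ≃ₗ[A] CharacterModule A :=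
  (HomologicalComplex.singleObjXSelf (ComplexShape.up ℤ) 0
    (ModuleCat.of A (CharacterModule A))).toLinearEquiv

theorem injective_of_flat (M : Type u) [AddCommGroup M] [Module A M] [Module.Flat A M] :
    Injective (ModuleCat.of A (CharacterModule M)) :=
  (Module.injective_iff_injective_object A (CharacterModule M)).1
    (Module.Flat.iff_characterModule_injective.1 inferInstance)

variable (A) in
theorem isZero_charComplex_X {n : ℤ} (hn : n ≠ 0) : IsZero ((charComplex A).X n) :=
  HomologicalComplex.isZero_single_obj_X _ _ _ _ hn

instance (n : ℤ) : Injective ((charComplex A).X n) := by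
  by_cases hn : n = 0
  · subst hn
    have := injective_of_flat (A := A) A
    exact Injective.of_iso (charEquiv A).toModuleIso.symm this
  · exact (isZero_charComplex_X A hn).injective

instance : (charComplex A).IsKInjective := CochainComplex.isKInjective_of_injective _ 0

/-- The character of `K^i` given by an element of `Hom(K, charComplex A)^n`, where `i + n = 0`. -/
def charOf (K : CochainComplex (ModuleCat.{u} A) ℤ) {n i : ℤ} (h : i + n = 0) :
    (homComplex K (charComplex A)).X n →ₗ[A] CharacterModule (K.X i) where
  toFun z :=
    { toFun := fun x ↦ charEquiv A (homEval K (charComplex A) h z x) 1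
      map_zero' := by rw [map_zero, map_zero]; rfl
      map_add' := fun x y ↦ by rw [map_add, map_add]; rfl }
  map_add' z z' := CharacterModule.ext _ fun x ↦ by
    change charEquiv A (homEval K (charComplex A) h (z + z') x) 1 = _
    rw [map_add, LinearMap.add_apply, map_add]
    rfl
  map_smul' r z := CharacterModule.ext _ fun x ↦ by
    change charEquiv A (homEval K (charComplex A) h (r • z) x) 1 =
      charEquiv A (homEval K (charComplex A) h z (r • x)) 1
    rw [map_smul, map_smul, LinearMap.smul_apply]

theorem charOf_apply (K : CochainComplex (ModuleCat.{u} A) ℤ) {n i : ℤ} (h : i + n = 0)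
    (z : (homComplex K (charComplex A)).X n) (x : K.X i) :
    charOf K h z x = charEquiv A (homEval K (charComplex A) h z x) 1 := rfl

theorem charEquiv_apply (c : (charComplex A).X 0) (r : A) :
    charEquiv A c r = charEquiv A (r • c) 1 := by
  rw [map_smul, CharacterModule.smul_apply, smul_eq_mul, mul_one]

/-- The linear map `M ⟶ CharacterModule A` given by a character of `M`. -/
def homOfCharacter {M : Type u} [AddCommGroup M] [Module A M] (χ : CharacterModule M) :
    M →ₗ[A] CharacterModule A where
  toFun x := CharacterModule.dual (LinearMap.toSpanSingleton A M x) χ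
  map_add' x y := CharacterModule.ext _ fun r ↦ by
    change χ (r • (x + y)) = χ (r • x) + χ (r • y)
    rw [smul_add, map_add]
  map_smul' s x := CharacterModule.ext _ fun r ↦ by
    change χ (r • s • x) = χ ((s * r) • x)
    rw [smul_smul, mul_comm]

theorem homOfCharacter_apply {M : Type u} [AddCommGroup M] [Module A M] (χ : CharacterModule M)
    (x : M) (r : A) : homOfCharacter χ x r = χ (r • x) := rfl

theorem bijective_charOf (K : CochainComplex (ModuleCat.{u} A) ℤ) {n i : ℤ} (h : i + n = 0) :
    Function.Bijective (charOf K h) := by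
  refine ⟨(injective_iff_map_eq_zero _).2 fun z hz ↦ homEval_ext fun k l hkl x ↦ ?_, fun χ ↦ ?_⟩
  · rw [map_zero, LinearMap.zero_apply]
    by_cases hl : l = 0
    · subst hl
      obtain rfl : k = i := by lia
      refine (charEquiv A).map_eq_zero_iff.1 (CharacterModule.ext _ fun r ↦ ?_)
      rw [charEquiv_apply, ← map_smul, ← charOf_apply, hz]
      rfl
    · exact eq_zero_of_isZero (isZero_charComplex_X A hl) _
  · refine ⟨Cochain.single (ModuleCat.ofHom ((charEquiv A).symm.toLinearMap ∘ₗ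
      homOfCharacter χ)) n, CharacterModule.ext _ fun x ↦ ?_⟩
    have := congrArg (fun f ↦ f.hom x) (Cochain.single_v (K := K) (L := charComplex A)
      (ModuleCat.ofHom ((charEquiv A).symm.toLinearMap ∘ₗ homOfCharacter χ)) n h)
    refine (congrArg (fun c ↦ charEquiv A c 1) this).trans ?_
    change charEquiv A ((charEquiv A).symm (homOfCharacter χ x)) 1 = _
    rw [LinearEquiv.apply_symm_apply, homOfCharacter_apply, one_smul]

theorem charOf_d (K : CochainComplex (ModuleCat.{u} A) ℤ) {n m i i' : ℤ} (hm : n + 1 = m)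
    (hi : i + 1 = i') (h : i' + n = 0) (h' : i + m = 0)
    (z : (homComplex K (charComplex A)).X n) (x : K.X i) :
    charOf K h' (((homComplex K (charComplex A)).d n m).hom z) x =
      m.negOnePow • charOf K h z ((K.d i i').hom x) := by
  rw [charOf_apply, homEval_d (j := -1) hm hi (by lia) (by lia) h' h, charComplex_d,
    charOf_apply, ModuleCat.hom_zero, LinearMap.zero_apply, zero_add, map_zsmul_unit]
  rfl

theorem d_eq_zero_of_charOf (K : CochainComplex (ModuleCat.{u} A) ℤ) {n i : ℤ} (h : i + n = 0)
    (z : (homComplex K (charComplex A)).X n)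
    (hz : ∀ y : K.X (i - 1), charOf K h z ((K.d (i - 1) i).hom y) = 0) :
    ((homComplex K (charComplex A)).d n (n + 1)).hom z = 0 := by
  have h' : i - 1 + (n + 1) = 0 := by lia
  refine (injective_iff_map_eq_zero (charOf K h')).1 (bijective_charOf K h').1 _ ?_
  refine CharacterModule.ext _ fun y ↦ ?_
  rw [charOf_d K rfl (by lia) h h', hz, smul_zero]
  rfl

theorem charOf_d_apply_eq_zero (K : CochainComplex (ModuleCat.{u} A) ℤ) {n i : ℤ}
    (h : i + n = 0) (w : (homComplex K (charComplex A)).X (n - 1)) (x : K.X i)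
    (hx : (K.d i (i + 1)).hom x = 0) :
    charOf K h (((homComplex K (charComplex A)).d (n - 1) n).hom w) x = 0 := by
  rw [charOf_d K (by lia) rfl (by lia) h, hx, map_zero, smul_zero]

theorem exactAt_of_exactAt_homComplex_charComplex {K : CochainComplex (ModuleCat.{u} A) ℤ}
    {n i : ℤ} (h : i + n = 0) (hK : (homComplex K (charComplex A)).ExactAt n) : K.ExactAt i := by
  rw [exactAt_iff_forall_exists] at hK ⊢
  intro x hx
  by_contra hx'
  obtain ⟨χ, hχ, hχx⟩ := exists_character_of_notMem (LinearMap.range (K.d (i - 1) i).hom) hx'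
  obtain ⟨z, rfl⟩ := (bijective_charOf K h).2 χ
  obtain ⟨w, rfl⟩ := hK z (d_eq_zero_of_charOf K h z fun y ↦ hχ _ ⟨y, rfl⟩)
  exact hχx (charOf_d_apply_eq_zero K h w x hx)

theorem HomologicallyBounded.of_homComplex_charComplex {K : CochainComplex (ModuleCat.{u} A) ℤ}
    (hK : HomologicallyBounded (homComplex K (charComplex A))) : HomologicallyBounded K := by
  rw [homologicallyBounded_iff] at hK ⊢
  obtain ⟨a, b, h⟩ := hK
  exact ⟨-b, -a, fun n hn ↦ exactAt_of_exactAt_homComplex_charComplex (n := -n) (by lia)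
    (h (-n) (by lia))⟩

theorem quasiIso_of_quasiIso_homMapLeft {K L : CochainComplex (ModuleCat.{u} A) ℤ} (f : K ⟶ L)
    [QuasiIso (homMapLeft f (charComplex A))] : QuasiIso f :=
  (quasiIso_iff_acyclic_mappingCone f).2 fun i ↦ exactAt_of_exactAt_homComplex_charComplex
    (add_neg_cancel i) (exactAt_homComplex_mappingCone f _ (-i))

theorem injective_homComplex_charComplex (V : CochainComplex (ModuleCat.{u} A) ℤ)
    (hV : ∀ n, Module.Flat A (V.X n)) (n : ℤ) :
    Injective ((homComplex V (charComplex A)).X n) := by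
  have := injective_of_flat (A := A) (V.X (-n))
  exact Injective.of_iso (LinearEquiv.ofBijective _
    (bijective_charOf V (neg_add_cancel n))).toModuleIso.symm this

end Characters

section TensorQuasiIso

variable {A : Type u} [CommRing A]

theorem quasiIso_tensorMap_right (P : CochainComplex (ModuleCat.{u} A) ℤ) [P.IsKProjective]
    {X X' : CochainComplex (ModuleCat.{u} A) ℤ} (f : X ⟶ X') [QuasiIso f] :
    QuasiIso (tensorMap (𝟙 P) f) := by
  have := quasiIso_homMapLeft f (charComplex A)
  have := quasiIso_homMapRight P (homMapLeft f (charComplex A))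
  have : QuasiIso (homMapLeft (tensorMap (𝟙 P) f) (charComplex A)) := by
    rw [← quasiIso_iff_comp_right _ (curry P X (charComplex A)), curry_naturality_right]
    infer_instance
  exact quasiIso_of_quasiIso_homMapLeft _

theorem quasiIso_tensorMap_left {P P' : CochainComplex (ModuleCat.{u} A) ℤ}
    (e : HomotopyEquiv P' P) (X : CochainComplex (ModuleCat.{u} A) ℤ) :
    QuasiIso (tensorMap e.hom (𝟙 X)) := by
  have := quasiIso_homMapLeft_hom e (homComplex X (charComplex A))
  have : QuasiIso (homMapLeft (tensorMap e.hom (𝟙 X)) (charComplex A)) := by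
    rw [← quasiIso_iff_comp_right _ (curry P' X (charComplex A)), curry_naturality_left]
    infer_instance
  exact quasiIso_of_quasiIso_homMapLeft _

end TensorQuasiIso

/-! ### Foxby equivalence with respect to a complex `P` -/

section FoxbyPairs

variable {A : Type u} [CommRing A]

/-- The conditions defining the Auslander class, with respect to an arbitrary complex `P`. -/
structure AuslanderFor (P X : CochainComplex (ModuleCat.{u} A) ℤ) : Prop where
  homologicallyBounded : HomologicallyBounded X
  homologicallyBounded_tensor : HomologicallyBounded (tensorComplex P X)
  quasiIso_unit : QuasiIso (unitHom P X)

/-- The conditions defining the Bass class, with respect to an arbitrary complex `P`. -/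
structure BassFor (P Y : CochainComplex (ModuleCat.{u} A) ℤ) : Prop where
  homologicallyBounded : HomologicallyBounded Y
  homologicallyBounded_hom : HomologicallyBounded (homComplex P Y)
  quasiIso_counit : QuasiIso (counitHom P Y)

/-- `X` and `W` correspond to each other under Foxby equivalence with respect to `P`: a
morphism `P ⊗ X ⟶ W` and its adjoint `X ⟶ Hom(P, W)` are both quasi-isomorphisms. -/
structure FoxbyPair (P X W : CochainComplex (ModuleCat.{u} A) ℤ) : Prop where
  left : HomologicallyBounded X
  right : HomologicallyBounded W
  exists_quasiIso : ∃ φ : tensorComplex P X ⟶ W, QuasiIso φ ∧ QuasiIso (adj φ)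

variable {P X W Y : CochainComplex (ModuleCat.{u} A) ℤ}

theorem AuslanderFor.foxbyPair (h : AuslanderFor P X) : FoxbyPair P X (tensorComplex P X) :=
  ⟨h.1, h.2, 𝟙 _, inferInstance, by rw [adj_id]; exact h.3⟩

theorem BassFor.foxbyPair (h : BassFor P Y) : FoxbyPair P (homComplex P Y) Y :=
  ⟨h.2, h.1, counitHom P Y, h.3, by rw [← coadj_id, adj_coadj]; infer_instance⟩

theorem FoxbyPair.auslanderFor [P.IsKProjective] (h : FoxbyPair P X W) : AuslanderFor P X := by
  obtain ⟨hX, hW, φ, hφ, hφ'⟩ := h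
  refine ⟨hX, (homologicallyBounded_iff_of_quasiIso φ).2 hW, ?_⟩
  have := quasiIso_homMapRight P φ
  exact (quasiIso_iff_comp_right (unitHom P X) (homMapRight P φ)).1 hφ'

theorem FoxbyPair.bassFor [P.IsKProjective] (h : FoxbyPair P X W) : BassFor P W := by
  obtain ⟨hX, hW, φ, hφ, hφ'⟩ := h
  refine ⟨hW, (homologicallyBounded_iff_of_quasiIso (adj φ)).1 hX, ?_⟩
  have := quasiIso_tensorMap_right P (adj φ)
  refine (quasiIso_iff_comp_left (tensorMap (𝟙 P) (adj φ)) (counitHom P W)).1 ?_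
  change QuasiIso (coadj (adj φ))
  rwa [coadj_adj]

theorem FoxbyPair.of_homotopyEquiv {P' : CochainComplex (ModuleCat.{u} A) ℤ}
    (e : HomotopyEquiv P' P) (h : FoxbyPair P X W) : FoxbyPair P' X W := by
  obtain ⟨hX, hW, φ, hφ, hφ'⟩ := h
  have := quasiIso_tensorMap_left e X
  have := quasiIso_homMapLeft_hom e W
  refine ⟨hX, hW, tensorMap e.hom (𝟙 X) ≫ φ, inferInstance, ?_⟩
  rw [adj_tensorMap_left]
  infer_instance

theorem unitHom_naturality (P : CochainComplex (ModuleCat.{u} A) ℤ) (f : X ⟶ Y) :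
    unitHom P X ≫ homMapRight P (tensorMap (𝟙 P) f) = f ≫ unitHom P Y := by
  rw [← adj_id P Y, ← adj_tensorMap_right, Category.comp_id]
  rfl

theorem counitHom_naturality (P : CochainComplex (ModuleCat.{u} A) ℤ) (f : X ⟶ Y) :
    tensorMap (𝟙 P) (homMapRight P f) ≫ counitHom P Y = counitHom P X ≫ f := by
  rw [← coadj_id P X, ← coadj_comp_homMapRight, Category.id_comp]
  rfl

theorem auslanderFor_iff_of_quasiIso [P.IsKProjective] (f : X ⟶ Y) [QuasiIso f] :
    AuslanderFor P X ↔ AuslanderFor P Y := by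
  have := quasiIso_tensorMap_right P f
  have := quasiIso_homMapRight P (tensorMap (𝟙 P) f)
  have key : QuasiIso (unitHom P X) ↔ QuasiIso (unitHom P Y) := by
    rw [← quasiIso_iff_comp_right (unitHom P X) (homMapRight P (tensorMap (𝟙 P) f)),
      unitHom_naturality, quasiIso_iff_comp_left]
  have bdd := homologicallyBounded_iff_of_quasiIso f
  have bdd' := homologicallyBounded_iff_of_quasiIso (tensorMap (𝟙 P) f)
  exact ⟨fun h ↦ ⟨bdd.1 h.1, bdd'.1 h.2, key.1 h.3⟩, fun h ↦ ⟨bdd.2 h.1, bdd'.2 h.2, key.2 h.3⟩⟩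

theorem bassFor_iff_of_quasiIso [P.IsKProjective] (f : X ⟶ Y) [QuasiIso f] :
    BassFor P X ↔ BassFor P Y := by
  have := quasiIso_homMapRight P f
  have := quasiIso_tensorMap_right P (homMapRight P f)
  have key : QuasiIso (counitHom P X) ↔ QuasiIso (counitHom P Y) := by
    rw [← quasiIso_iff_comp_right (counitHom P X) f, ← counitHom_naturality,
      quasiIso_iff_comp_left]
  have bdd := homologicallyBounded_iff_of_quasiIso f
  have bdd' := homologicallyBounded_iff_of_quasiIso (homMapRight P f)
  exact ⟨fun h ↦ ⟨bdd.1 h.1, bdd'.1 h.2, key.1 h.3⟩, fun h ↦ ⟨bdd.2 h.1, bdd'.2 h.2, key.2 h.3⟩⟩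

theorem HomologicallyBounded.induction_of_quasiIso {C : Type*} [Category* C] [Abelian C]
    {p : CochainComplex C ℤ → Prop} (hp : ∀ {X Y} (f : X ⟶ Y), QuasiIso f → (p X ↔ p Y))
    (h : ∀ {X}, StrictlyBounded X → p X) {X : CochainComplex C ℤ} (hX : HomologicallyBounded X) :
    p X := by
  obtain ⟨a, b, _, _⟩ := hX
  have : (X.truncLE b).IsGE a := by
    rw [CochainComplex.isGE_iff]
    intro i hi
    exact (exactAt_iff_of_quasiIsoAt (X.ιTruncLE b) i).2 (X.exactAt_of_isGE a i hi)
  rw [← hp (X.ιTruncLE b) inferInstance, hp ((X.truncLE b).πTruncGE a) inferInstance]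
  exact h ⟨a, b, inferInstance, inferInstance⟩

theorem exists_quasiIso_tensorComplex (hP : ∃ b : ℤ, P.IsStrictlyLE b) (hX : StrictlyBounded X)
    (h : HomologicallyBounded (tensorComplex P X)) :
    ∃ W, StrictlyBounded W ∧ ∃ φ : tensorComplex P X ⟶ W, QuasiIso φ := by
  obtain ⟨b, _⟩ := hP
  obtain ⟨_, d, _, _⟩ := hX
  obtain ⟨a, _, _, _⟩ := h
  have := isStrictlyLE_tensorComplex (P := P) (W := X) b d
  exact ⟨(tensorComplex P X).truncGE a, ⟨a, b + d, inferInstance, inferInstance⟩,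
    (tensorComplex P X).πTruncGE a, inferInstance⟩

theorem exists_quasiIso_homComplex (hP : ∃ b : ℤ, P.IsStrictlyLE b) (hY : StrictlyBounded Y)
    (h : HomologicallyBounded (homComplex P Y)) :
    ∃ X, StrictlyBounded X ∧ ∃ ψ : X ⟶ homComplex P Y, QuasiIso ψ := by
  obtain ⟨b, _⟩ := hP
  obtain ⟨c, _, _, _⟩ := hY
  obtain ⟨_, a, _, _⟩ := h
  have := isStrictlyGE_homComplex (P := P) (W := Y) c b
  exact ⟨(homComplex P Y).truncLE a, ⟨c - b, a, inferInstance, inferInstance⟩,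
    (homComplex P Y).ιTruncLE a, inferInstance⟩

theorem AuslanderFor.exists_foxbyPair [P.IsKProjective] (hP : ∃ b : ℤ, P.IsStrictlyLE b)
    (hX : StrictlyBounded X) (h : AuslanderFor P X) :
    ∃ W, StrictlyBounded W ∧ FoxbyPair P X W := by
  obtain ⟨W, hW, φ, hφ⟩ := exists_quasiIso_tensorComplex hP hX h.2
  have := h.3
  have := quasiIso_homMapRight P φ
  exact ⟨W, hW, h.1, hW.homologicallyBounded, φ, hφ, by rw [adj]; infer_instance⟩

theorem BassFor.exists_foxbyPair [P.IsKProjective] (hP : ∃ b : ℤ, P.IsStrictlyLE b)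
    (hY : StrictlyBounded Y) (h : BassFor P Y) :
    ∃ X, StrictlyBounded X ∧ FoxbyPair P X Y := by
  obtain ⟨X, hX, ψ, hψ⟩ := exists_quasiIso_homComplex hP hY h.2
  have := h.3
  have := quasiIso_tensorMap_right P ψ
  exact ⟨X, hX, hX.homologicallyBounded, h.1, coadj ψ, by rw [coadj]; infer_instance,
    by rwa [adj_coadj]⟩

end FoxbyPairs

/-! ### Homomorphism evaluation -/

section HomEvaluation

open CochainComplex.HomComplex

variable {A : Type u} [CommRing A] {P X W : CochainComplex (ModuleCat.{u} A) ℤ}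

/-- The morphism `Hom(W, U) ⟶ Hom(P, Hom(X, U))` induced by `φ : P ⊗ X ⟶ W`. -/
def dualAdj (φ : tensorComplex P X ⟶ W) (U : CochainComplex (ModuleCat.{u} A) ℤ) :
    homComplex W U ⟶ homComplex P (homComplex X U) :=
  homMapLeft φ U ≫ curry P X U

/-- The morphism `P ⊗ Hom(W, U) ⟶ Hom(X, U)` induced by `φ : P ⊗ X ⟶ W`. -/
def dualPairing (φ : tensorComplex P X ⟶ W) (U : CochainComplex (ModuleCat.{u} A) ℤ) :
    tensorComplex P (homComplex W U) ⟶ homComplex X U :=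
  coadj (dualAdj φ U)

variable (P W) in
/-- Homomorphism evaluation `P ⊗ Hom(W, U) ⟶ Hom(Hom(P, W), U)`. -/
def homEvaluation (U : CochainComplex (ModuleCat.{u} A) ℤ) :
    tensorComplex P (homComplex W U) ⟶ homComplex (homComplex P W) U :=
  dualPairing (counitHom P W) U

theorem dualPairing_eq (φ : tensorComplex P X ⟶ W) (U : CochainComplex (ModuleCat.{u} A) ℤ) :
    dualPairing φ U = homEvaluation P W U ≫ homMapLeft (adj φ) U := by
  rw [homEvaluation, dualPairing, dualPairing, ← coadj_comp_homMapRight]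
  congr 1
  nth_rewrite 1 [← coadj_adj φ]
  rw [dualAdj, dualAdj, coadj, homMapLeft_comp, Category.assoc, curry_naturality_right,
    Category.assoc]

theorem homEval_homEvaluation (U : CochainComplex (ModuleCat.{u} A) ℤ) {i n j k l m : ℤ}
    (hij : i + n = j) (hkl : k + j = l) (hik : i + k = m) (hml : m + n = l) (p : P.X i)
    (g : (homComplex W U).X n) (f : (homComplex P W).X k) :
    homEval (homComplex P W) U hkl
        (((homEvaluation P W U).f j).hom (tmul P (homComplex W U) hij p g)) f =
      ((i * n).negOnePow * (i * k).negOnePow) •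
        homEval W U hml g (homEval P W hik f p) := by
  rw [homEvaluation, dualPairing, coadj_tmul, map_zsmul_unit, LinearMap.smul_apply, mul_smul]
  congr 1
  refine (homEval_curryMap U hij hkl hik hml
    (((homMapLeft (counitHom P W) U).f n).hom g) p f).trans ?_
  rw [homEval_homMapLeft, ← map_zsmul_unit]
  congr 1
  exact counitMap_tmul P W i k m hik p f

/-- The rank one homomorphism `p ↦ c(p) w` in `Hom(P, W)^k`, for `w ∈ W^m`, where `i + k = m`. -/
def rankOne {i k m : ℤ} (h : i + k = m) (c : P.X i →ₗ[A] A) :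
    W.X m →ₗ[A] (homComplex P W).X k :=
  homMk fun i' m' h' ↦ if hi : i' = i then
    LinearMap.flip (by
      obtain rfl := hi
      obtain rfl : m' = m := by lia
      exact LinearMap.lsmul A (W.X m') ∘ₗ c) else 0

theorem homEval_rankOne {i k m : ℤ} (h : i + k = m) (c : P.X i →ₗ[A] A) (w : W.X m)
    (p : P.X i) : homEval P W h (rankOne h c w) p = c p • w := by
  subst h
  simp [rankOne]

theorem homEval_rankOne_of_ne {i k m i' m' : ℤ} (h : i + k = m) (c : P.X i →ₗ[A] A) (w : W.X m)
    (h' : i' + k = m') (hi : i' ≠ i) (p : P.X i') : homEval P W h' (rankOne h c w) p = 0 := by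
  simp [rankOne, hi]

variable (P W) in
/-- The cochain `w ↦ ± h(c(-) w)` of `Hom(W, U)` given by a cochain `h` of
`Hom(Hom(P, W), U)`. The sign is the one in `homEval_homEvaluation`. -/
def contract (U : CochainComplex (ModuleCat.{u} A) ℤ) {i n j : ℤ} (hij : i + n = j)
    (c : P.X i →ₗ[A] A) :
    (homComplex (homComplex P W) U).X j →ₗ[A] (homComplex W U).X n :=
  homMk fun m l hml ↦ ((i * n).negOnePow * (i * (m - i)).negOnePow) •
    ((rankOne (show i + (m - i) = m by lia) c).lcomp A _ ∘ₗ
      homEval (homComplex P W) U (show m - i + j = l by lia))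

theorem homEval_contract (U : CochainComplex (ModuleCat.{u} A) ℤ) {i n j k l m : ℤ}
    (hij : i + n = j) (hkl : k + j = l) (hik : i + k = m) (hml : m + n = l)
    (c : P.X i →ₗ[A] A) (h : (homComplex (homComplex P W) U).X j) (w : W.X m) :
    homEval W U hml (contract P W U hij c h) w =
      ((i * n).negOnePow * (i * k).negOnePow) •
        homEval (homComplex P W) U hkl h (rankOne hik c w) := by
  obtain rfl : k = m - i := by lia
  rfl

theorem contract_homEvaluation (U : CochainComplex (ModuleCat.{u} A) ℤ) {i n j : ℤ}
    (hij : i + n = j) (c : P.X i →ₗ[A] A) (p : P.X i) (g : (homComplex W U).X n) :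
    contract P W U hij c (((homEvaluation P W U).f j).hom (tmul P (homComplex W U) hij p g)) =
      c p • g := by
  refine homEval_ext fun m l hml w ↦ ?_
  rw [homEval_contract U hij (show m - i + j = l by lia) (by lia),
    homEval_homEvaluation U hij _ (show i + (m - i) = m by lia) hml, homEval_rankOne, smul_smul,
    Int.units_mul_self, one_smul, map_smul, map_smul, LinearMap.smul_apply]

theorem contract_homEvaluation_of_ne (U : CochainComplex (ModuleCat.{u} A) ℤ)
    {i n i' n' j : ℤ} (hij : i + n = j) (hij' : i' + n' = j) (hi : i' ≠ i) (c : P.X i' →ₗ[A] A)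
    (p : P.X i) (g : (homComplex W U).X n) :
    contract P W U hij' c (((homEvaluation P W U).f j).hom (tmul P (homComplex W U) hij p g)) =
      0 := by
  refine homEval_ext fun m l hml w ↦ ?_
  rw [homEval_contract U hij' (show m - i' + j = l by lia) (by lia),
    homEval_homEvaluation U hij _ (show i + (m - i') = m - i' + i by lia) (by lia),
    homEval_rankOne_of_ne _ _ _ _ hi.symm]
  simp only [map_zero, smul_zero, LinearMap.zero_apply]

theorem homEval_homEvaluation_contract (U : CochainComplex (ModuleCat.{u} A) ℤ)
    {i n j k l : ℤ} (hij : i + n = j) (hkl : k + j = l) (c : P.X i →ₗ[A] A) (p : P.X i)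
    (h : (homComplex (homComplex P W) U).X j) (z : (homComplex P W).X k) :
    homEval (homComplex P W) U hkl (((homEvaluation P W U).f j).hom
      (tmul P (homComplex W U) hij p (contract P W U hij c h))) z =
        homEval (homComplex P W) U hkl h (rankOne rfl c (homEval P W rfl z p)) := by
  rw [homEval_homEvaluation U hij hkl rfl (by lia), homEval_contract U hij hkl rfl, smul_smul,
    Int.units_mul_self, one_smul]

section DualBases

theorem exists_dualBasis (M : Type u) [AddCommGroup M] [Module A M] [Module.Finite A M]
    [Module.Projective A M] :
    ∃ (s : ℕ) (b : Fin s → M) (c : Fin s → (M →ₗ[A] A)), ∀ x, ∑ a, c a x • b a = x := by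
  obtain ⟨s, f, g, -, -, h⟩ := Module.Finite.exists_comp_eq_id_of_projective A M
  refine ⟨s, fun a ↦ f (Pi.single a 1), fun a ↦ LinearMap.proj a ∘ₗ g, fun x ↦ ?_⟩
  have := LinearMap.congr_fun h x
  simp only [LinearMap.comp_apply, LinearMap.proj_apply, ← map_smul, ← map_sum]
  refine Eq.trans (congrArg f ?_) this
  ext t
  simp [Finset.sum_apply, Pi.single_apply]

variable {ι : ℤ → Type*} [∀ i, Fintype (ι i)] {T : Finset ℤ} {e : ∀ i, ι i → P.X i}
  {c : ∀ i, ι i → P.X i →ₗ[A] A}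

theorem sum_rankOne (hc : ∀ i p, ∑ a, c i a p • e i a = p) {k : ℤ}
    (hT : ∀ i ∉ T, IsZero (W.X (i + k))) (z : (homComplex P W).X k) :
    ∑ i ∈ T, ∑ a, rankOne rfl (c i a) (homEval P W rfl z (e i a)) = z := by
  refine homEval_ext fun i m him p ↦ ?_
  subst him
  by_cases hi : i ∈ T
  · simp only [map_sum, LinearMap.sum_apply]
    rw [Finset.sum_eq_single_of_mem i hi fun i' _ hi' ↦ Finset.sum_eq_zero fun a _ ↦
      homEval_rankOne_of_ne _ _ _ _ hi'.symm p]
    simp only [homEval_rankOne, ← map_smul, ← map_sum, hc]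
  · exact (eq_zero_of_isZero (hT i hi) _).trans (eq_zero_of_isZero (hT i hi) _).symm

variable (W T e c) in
/-- The inverse of `homEvaluation` in degree `j`, given by dual bases `e`, `c` of the modules of
`P` in the finitely many degrees `T` that contribute to it. -/
def homEvaluationInv (U : CochainComplex (ModuleCat.{u} A) ℤ) (j : ℤ) :
    (homComplex (homComplex P W) U).X j →ₗ[A] (tensorComplex P (homComplex W U)).X j :=
  ∑ i ∈ T, ∑ a, tmul P (homComplex W U) (add_sub_cancel i j) (e i a) ∘ₗ
    contract P W U (add_sub_cancel i j) (c i a)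

theorem homEvaluationInv_apply (U : CochainComplex (ModuleCat.{u} A) ℤ) (j : ℤ)
    (h : (homComplex (homComplex P W) U).X j) :
    homEvaluationInv W T e c U j h = ∑ i ∈ T, ∑ a, tmul P (homComplex W U)
      (add_sub_cancel i j) (e i a) (contract P W U (add_sub_cancel i j) (c i a) h) := by
  simp only [homEvaluationInv, LinearMap.sum_apply, LinearMap.comp_apply]

variable {U : CochainComplex (ModuleCat.{u} A) ℤ} {j : ℤ}

theorem leftInverse_homEvaluationInv (hc : ∀ i p, ∑ a, c i a p • e i a = p)
    (hT : ∀ i ∉ T, ∀ m l, m + j = i + l → IsZero (W.X m) ∨ IsZero (U.X l)) :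
    Function.LeftInverse (homEvaluationInv W T e c U j) ((homEvaluation P W U).f j).hom := by
  refine fun y ↦ LinearMap.congr_fun (f := homEvaluationInv W T e c U j ∘ₗ
    ((homEvaluation P W U).f j).hom) (g := LinearMap.id)
    (tensorComplex_hom_ext fun i n hij p g ↦ ?_) y
  obtain rfl : n = j - i := by lia
  rw [LinearMap.comp_apply, LinearMap.id_apply, homEvaluationInv_apply]
  by_cases hi : i ∈ T
  · rw [Finset.sum_eq_single_of_mem i hi fun i' _ hi' ↦ Finset.sum_eq_zero fun a _ ↦ by
      rw [contract_homEvaluation_of_ne U hij _ hi', map_zero]]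
    simp only [contract_homEvaluation]
    nth_rewrite 2 [← hc i p]
    simp only [map_smul, map_sum, LinearMap.sum_apply, LinearMap.smul_apply]
  · have hg : g = 0 := eq_zero_of_isZero
      (isZero_homComplex_X fun m l hml ↦ hT i hi m l (by lia)) g
    simp only [hg, map_zero, Finset.sum_const_zero]

theorem rightInverse_homEvaluationInv (hc : ∀ i p, ∑ a, c i a p • e i a = p)
    (hT : ∀ i ∉ T, ∀ m l, m + j = i + l → IsZero (W.X m) ∨ IsZero (U.X l)) :
    Function.RightInverse (homEvaluationInv W T e c U j) ((homEvaluation P W U).f j).hom := by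
  refine fun h ↦ homEval_ext fun k l hkl z ↦ ?_
  rw [homEvaluationInv_apply]
  simp only [map_sum, LinearMap.sum_apply, homEval_homEvaluation_contract]
  by_cases hl : IsZero (U.X l)
  · exact (eq_zero_of_isZero hl _).trans (eq_zero_of_isZero hl _).symm
  · have hW (i : ℤ) (hi : i ∉ T) : IsZero (W.X (i + k)) :=
      (hT i hi (i + k) l (by lia)).resolve_right hl
    simp only [← map_sum, sum_rankOne hc hW]

end DualBases

theorem isZero_or_isZero_of_notMem_Icc {a b c d : ℤ} [W.IsStrictlyGE a] [W.IsStrictlyLE b]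
    {U : CochainComplex (ModuleCat.{u} A) ℤ} [U.IsStrictlyGE c] [U.IsStrictlyLE d] {i j m l : ℤ}
    (hi : i ∉ Finset.Icc (a - d + j) (b - c + j)) (h : m + j = i + l) :
    IsZero (W.X m) ∨ IsZero (U.X l) := by
  by_contra! hne
  have ha : a ≤ m := not_lt.1 fun hm ↦ hne.1 (W.isZero_of_isStrictlyGE a m hm)
  have hb : m ≤ b := not_lt.1 fun hm ↦ hne.1 (W.isZero_of_isStrictlyLE b m hm)
  have hc : c ≤ l := not_lt.1 fun hl ↦ hne.2 (U.isZero_of_isStrictlyGE c l hl)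
  have hd : l ≤ d := not_lt.1 fun hl ↦ hne.2 (U.isZero_of_isStrictlyLE d l hl)
  exact hi (Finset.mem_Icc.2 ⟨by lia, by lia⟩)

theorem bijective_homEvaluation (hP : ∀ i, Module.Finite A (P.X i))
    (hP' : ∀ i, Module.Projective A (P.X i)) (hW : StrictlyBounded W)
    {U : CochainComplex (ModuleCat.{u} A) ℤ} (hU : StrictlyBounded U) (j : ℤ) :
    Function.Bijective ((homEvaluation P W U).f j).hom := by
  obtain ⟨a, b, _, _⟩ := hW
  obtain ⟨c, d, _, _⟩ := hU
  choose s e f hef using fun i ↦ exists_dualBasis (A := A) (P.X i)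
  have hT (i : ℤ) (hi : i ∉ Finset.Icc (a - d + j) (b - c + j)) (m l : ℤ)
      (h : m + j = i + l) : IsZero (W.X m) ∨ IsZero (U.X l) := isZero_or_isZero_of_notMem_Icc hi h
  exact ⟨(leftInverse_homEvaluationInv hef hT).injective,
    (rightInverse_homEvaluationInv hef hT).surjective⟩

end HomEvaluation

/-! ### Duality over one ring -/

section OneRing

variable {A : Type u} [CommRing A]

/-- `P` is bounded above and consists of finitely generated projective modules: the resolutions
by which the Foxby classes are computed. -/
structure IsFinProjective (P : CochainComplex (ModuleCat.{u} A) ℤ) : Prop where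
  finite : ∀ i, Module.Finite A (P.X i)
  projective : ∀ i, Module.Projective A (P.X i)
  bounded : ∃ b : ℤ, P.IsStrictlyLE b

theorem IsFinProjective.isKProjective {P : CochainComplex (ModuleCat.{u} A) ℤ}
    (hP : IsFinProjective P) : P.IsKProjective := by
  obtain ⟨b, _⟩ := hP.bounded
  have (n : ℤ) : Projective (P.X n) := (IsProjective.iff_projective _).1 (hP.projective n)
  exact CochainComplex.isKProjective_of_projective P b

theorem StrictlyBounded.isKInjective {C : Type*} [Category* C] [Abelian C]
    {U : CochainComplex C ℤ} (hU : StrictlyBounded U) (hU' : ∀ n, Injective (U.X n)) :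
    U.IsKInjective := by
  obtain ⟨a, _, _, _⟩ := hU
  exact CochainComplex.isKInjective_of_injective U a

variable {P X Y Z W U : CochainComplex (ModuleCat.{u} A) ℤ}

theorem IsFinProjective.isIso_homEvaluation (hP : IsFinProjective P) (hW : StrictlyBounded W)
    (hU : StrictlyBounded U) : IsIso (homEvaluation P W U) :=
  isIso_of_bijective _ (bijective_homEvaluation hP.finite hP.projective hW hU)

theorem FoxbyPair.dual (hP : IsFinProjective P) (hX : StrictlyBounded X)
    (hW : StrictlyBounded W) (hU : StrictlyBounded U) (hU' : ∀ n, Injective (U.X n))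
    (h : FoxbyPair P X W) : FoxbyPair P (homComplex W U) (homComplex X U) := by
  have := hU.isKInjective hU'
  obtain ⟨φ, hφ, hφ'⟩ := h.exists_quasiIso
  have := hP.isIso_homEvaluation hW hU
  have := quasiIso_homMapLeft φ U
  have := quasiIso_homMapLeft (adj φ) U
  refine ⟨(hW.homComplex hU).homologicallyBounded, (hX.homComplex hU).homologicallyBounded,
    dualPairing φ U, ?_, ?_⟩
  · rw [dualPairing_eq]
    infer_instance
  · rw [dualPairing, adj_coadj, dualAdj]
    infer_instance

theorem AuslanderFor.bassFor_dual (hP : IsFinProjective P) (hU : StrictlyBounded U)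
    (hU' : ∀ n, Injective (U.X n)) (h : AuslanderFor P X) : BassFor P (homComplex X U) := by
  have := hP.isKProjective
  have := hU.isKInjective hU'
  refine h.1.induction_of_quasiIso (p := fun X ↦ AuslanderFor P X → BassFor P (homComplex X U))
    (fun f _ ↦ ?_) (fun hX h ↦ ?_) h
  · have := quasiIso_homMapLeft f U
    rw [auslanderFor_iff_of_quasiIso f, bassFor_iff_of_quasiIso (homMapLeft f U)]
  · obtain ⟨W, hW, h⟩ := h.exists_foxbyPair hP.bounded hX
    exact (h.dual hP hX hW hU hU').bassFor

theorem BassFor.auslanderFor_dual (hP : IsFinProjective P) (hU : StrictlyBounded U)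
    (hU' : ∀ n, Injective (U.X n)) (h : BassFor P Y) : AuslanderFor P (homComplex Y U) := by
  have := hP.isKProjective
  have := hU.isKInjective hU'
  refine h.1.induction_of_quasiIso (p := fun Y ↦ BassFor P Y → AuslanderFor P (homComplex Y U))
    (fun f _ ↦ ?_) (fun hY h ↦ ?_) h
  · have := quasiIso_homMapLeft f U
    rw [bassFor_iff_of_quasiIso f, auslanderFor_iff_of_quasiIso (homMapLeft f U)]
  · obtain ⟨X, hX, h⟩ := h.exists_foxbyPair hP.bounded hY
    exact (h.dual hP hX hY hU hU').auslanderFor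

theorem AuslanderFor.of_strictlyBounded_of_bassFor (hP : IsFinProjective P)
    (hZ : StrictlyBounded Z) (h : BassFor P (homComplex Z (charComplex A))) :
    AuslanderFor P Z := by
  have := hP.isKProjective
  have hT : HomologicallyBounded (tensorComplex P Z) := .of_homComplex_charComplex
    ((homologicallyBounded_iff_of_quasiIso (curry P Z (charComplex A))).2 h.2)
  obtain ⟨W, hW, φ, hφ⟩ := exists_quasiIso_tensorComplex hP.bounded hZ hT
  refine FoxbyPair.auslanderFor
    ⟨hZ.homologicallyBounded, hW.homologicallyBounded, φ, hφ, ?_⟩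
  have := quasiIso_homMapLeft φ (charComplex A)
  have : QuasiIso (dualAdj φ (charComplex A)) := by rw [dualAdj]; infer_instance
  have := quasiIso_tensorMap_right P (dualAdj φ (charComplex A))
  have := h.3
  have hp : QuasiIso (dualPairing φ (charComplex A)) := by
    rw [dualPairing, coadj]; infer_instance
  have := hP.isIso_homEvaluation hW (strictlyBounded_charComplex A)
  rw [dualPairing_eq, quasiIso_iff_comp_left] at hp
  exact quasiIso_of_quasiIso_homMapLeft _

theorem BassFor.of_strictlyBounded_of_auslanderFor (hP : IsFinProjective P)
    (hZ : StrictlyBounded Z) (h : AuslanderFor P (homComplex Z (charComplex A))) :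
    BassFor P Z := by
  have := hP.isKProjective
  have := hP.isIso_homEvaluation hZ (strictlyBounded_charComplex A)
  have hT : HomologicallyBounded (homComplex P Z) := .of_homComplex_charComplex
    ((homologicallyBounded_iff_of_quasiIso (homEvaluation P Z (charComplex A))).1 h.2)
  obtain ⟨X, hX, ψ, hψ⟩ := exists_quasiIso_homComplex hP.bounded hZ hT
  refine FoxbyPair.bassFor ⟨hX.homologicallyBounded, hZ.homologicallyBounded, coadj ψ, ?_,
    by rwa [adj_coadj]⟩
  have := quasiIso_homMapLeft ψ (charComplex A)
  have : QuasiIso (dualPairing (coadj ψ) (charComplex A)) := by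
    rw [dualPairing_eq, adj_coadj]; infer_instance
  have := quasiIso_homMapRight P (dualPairing (coadj ψ) (charComplex A))
  have := h.3
  have hd : QuasiIso (dualAdj (coadj ψ) (charComplex A)) := by
    rw [← adj_coadj (dualAdj (coadj ψ) (charComplex A)), adj]
    change QuasiIso (_ ≫ homMapRight P (dualPairing (coadj ψ) (charComplex A)))
    infer_instance
  rw [dualAdj, quasiIso_iff_comp_right] at hd
  exact quasiIso_of_quasiIso_homMapLeft _

theorem AuslanderFor.of_bassFor_homComplex (hP : IsFinProjective P)
    (h : BassFor P (homComplex Z (charComplex A))) : AuslanderFor P Z := by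
  have := hP.isKProjective
  refine h.1.of_homComplex_charComplex.induction_of_quasiIso
    (p := fun Z ↦ BassFor P (homComplex Z (charComplex A)) → AuslanderFor P Z)
    (fun f _ ↦ ?_) (.of_strictlyBounded_of_bassFor hP) h
  have := quasiIso_homMapLeft f (charComplex A)
  rw [auslanderFor_iff_of_quasiIso f, bassFor_iff_of_quasiIso (homMapLeft f (charComplex A))]

theorem BassFor.of_auslanderFor_homComplex (hP : IsFinProjective P)
    (h : AuslanderFor P (homComplex Z (charComplex A))) : BassFor P Z := by
  have := hP.isKProjective
  refine h.1.of_homComplex_charComplex.induction_of_quasiIso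
    (p := fun Z ↦ AuslanderFor P (homComplex Z (charComplex A)) → BassFor P Z)
    (fun f _ ↦ ?_) (.of_strictlyBounded_of_auslanderFor hP) h
  have := quasiIso_homMapLeft f (charComplex A)
  rw [bassFor_iff_of_quasiIso f, auslanderFor_iff_of_quasiIso (homMapLeft f (charComplex A))]

end OneRing

/-! ### Change of rings -/

section ChangeOfRings

variable {A B : Type u} [CommRing A] [CommRing B] (f : A →+* B)
  {P : CochainComplex (ModuleCat.{u} A) ℤ} {Z W W' : CochainComplex (ModuleCat.{u} B) ℤ}
  {N : Type u} [AddCommGroup N] [Module B N] {i j n m : ℤ}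

/-- Restriction of scalars for complexes. -/
abbrev resComplex (Z : CochainComplex (ModuleCat.{u} B) ℤ) : CochainComplex (ModuleCat.{u} A) ℤ :=
  ((ModuleCat.restrictScalars f).mapHomologicalComplex (ComplexShape.up ℤ)).obj Z

/-- Restriction of scalars for morphisms of complexes. -/
abbrev resMap (g : Z ⟶ W) : resComplex f Z ⟶ resComplex f W :=
  ((ModuleCat.restrictScalars f).mapHomologicalComplex (ComplexShape.up ℤ)).map g

theorem homologicallyBounded_resComplex_iff (Z : CochainComplex (ModuleCat.{u} B) ℤ) :
    HomologicallyBounded (resComplex f Z) ↔ HomologicallyBounded Z := by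
  simp only [homologicallyBounded_iff, exactAt_iff_forall_exists]
  rfl

theorem quasiIso_resMap_iff (g : Z ⟶ W) : QuasiIso (resMap f g) ↔ QuasiIso g :=
  HomologicalComplex.quasiIso_map_iff_of_preservesHomology g (ModuleCat.restrictScalars f)

instance : (ModuleCat.extendScalars.{u, u, u} f).Additive :=
  (ModuleCat.extendRestrictScalarsAdj.{u, u, u} f).left_adjoint_additive

/-- Extension of scalars for complexes. -/
abbrev extComplex (P : CochainComplex (ModuleCat.{u} A) ℤ) : CochainComplex (ModuleCat.{u} B) ℤ :=
  ((ModuleCat.extendScalars f).mapHomologicalComplex (ComplexShape.up ℤ)).obj P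

/-- The identity of `Z^n`, as a map from the `B`-module to its restriction to `A`. -/
def toRes (Z : CochainComplex (ModuleCat.{u} B) ℤ) (n : ℤ) : Z.X n →+ (resComplex f Z).X n where
  toFun z := z
  map_zero' := rfl
  map_add' _ _ := rfl

/-- The identity of `Z^n`, as a map from the restriction to `A` to the `B`-module. -/
def ofRes (Z : CochainComplex (ModuleCat.{u} B) ℤ) (n : ℤ) :
    (resComplex f Z).X n →ₛₗ[f] Z.X n where
  toFun z := z
  map_add' _ _ := rfl
  map_smul' _ _ := rfl

variable {f}

@[simp]
theorem toRes_ofRes (Z : CochainComplex (ModuleCat.{u} B) ℤ) (z : (resComplex f Z).X n) :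
    toRes f Z n (ofRes f Z n z) = z := rfl

@[simp]
theorem ofRes_toRes (Z : CochainComplex (ModuleCat.{u} B) ℤ) (z : Z.X n) :
    ofRes f Z n (toRes f Z n z) = z := rfl

theorem toRes_smul (Z : CochainComplex (ModuleCat.{u} B) ℤ) (a : A) (z : Z.X n) :
    toRes f Z n (f a • z) = a • toRes f Z n z := rfl

theorem ofRes_injective (Z : CochainComplex (ModuleCat.{u} B) ℤ) (n : ℤ) :
    Function.Injective (ofRes f Z n) := fun _ _ h ↦ h

theorem ofRes_units_smul (Z : CochainComplex (ModuleCat.{u} B) ℤ) (ε : ℤˣ)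
    (z : (resComplex f Z).X n) : ofRes f Z n (ε • z) = ε • ofRes f Z n z := rfl

theorem ofRes_d (Z : CochainComplex (ModuleCat.{u} B) ℤ) (z : (resComplex f Z).X n) :
    ofRes f Z m (((resComplex f Z).d n m).hom z) = (Z.d n m).hom (ofRes f Z n z) := rfl

theorem ofRes_resMap (g : Z ⟶ W) (z : (resComplex f Z).X n) :
    ofRes f W n (((resMap f g).f n).hom z) = (g.f n).hom (ofRes f Z n z) := rfl

variable (f) in
/-- The map `P^i ⟶ (B ⊗ P)^i`. -/
def extMk (P : CochainComplex (ModuleCat.{u} A) ℤ) (i : ℤ) :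
    P.X i →ₛₗ[f] (extComplex f P).X i where
  toFun p := ((ModuleCat.extendRestrictScalarsAdj f).unit.app (P.X i)).hom p
  map_add' p p' := map_add _ p p'
  map_smul' a p := map_smul ((ModuleCat.extendRestrictScalarsAdj f).unit.app (P.X i)).hom a p

theorem extMk_d (P : CochainComplex (ModuleCat.{u} A) ℤ) (p : P.X i) :
    extMk f P j ((P.d i j).hom p) = ((extComplex f P).d i j).hom (extMk f P i p) :=
  LinearMap.congr_fun (congrArg ModuleCat.Hom.hom
    ((ModuleCat.extendRestrictScalarsAdj f).unit.naturality (P.d i j))) p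

/-- The linear map out of `(B ⊗ P)^i` determined by a semilinear map on `P^i`. -/
def extLift (g : P.X i →ₛₗ[f] N) : (extComplex f P).X i →ₗ[B] N :=
  (((ModuleCat.extendRestrictScalarsAdj f).homEquiv (P.X i) (ModuleCat.of B N)).symm
    (ModuleCat.semilinearMapAddEquiv f (P.X i) (ModuleCat.of B N) g)).hom

theorem extLift_extMk (g : P.X i →ₛₗ[f] N) (p : P.X i) :
    extLift g (extMk f P i p) = g p := by
  have h := ((ModuleCat.extendRestrictScalarsAdj f).homEquiv (P.X i)
    (ModuleCat.of B N)).apply_symm_apply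
      (ModuleCat.semilinearMapAddEquiv f (P.X i) (ModuleCat.of B N) g)
  rw [Adjunction.homEquiv_unit] at h
  exact LinearMap.congr_fun (congrArg ModuleCat.Hom.hom h) p

theorem extComplex_hom_ext {g g' : (extComplex f P).X i →ₗ[B] N}
    (h : ∀ p, g (extMk f P i p) = g' (extMk f P i p)) : g = g' := by
  have key : ∀ k k' : (ModuleCat.extendScalars f).obj (P.X i) ⟶ ModuleCat.of B N,
      (∀ p, k.hom (extMk f P i p) = k'.hom (extMk f P i p)) → k = k' := fun k k' hk ↦ by
    refine ((ModuleCat.extendRestrictScalarsAdj f).homEquiv (P.X i)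
      (ModuleCat.of B N)).injective ?_
    rw [Adjunction.homEquiv_unit, Adjunction.homEquiv_unit]
    exact ModuleCat.hom_ext (LinearMap.ext hk)
  exact congrArg ModuleCat.Hom.hom (key
    (ModuleCat.ofHom (X := (extComplex f P).X i) g)
    (ModuleCat.ofHom (X := (extComplex f P).X i) g') h)

theorem IsFinProjective.extComplex (hP : IsFinProjective P) :
    IsFinProjective (extComplex f P) where
  finite i := by
    let := f.toAlgebra
    have := hP.finite i
    exact inferInstanceAs (Module.Finite B (B ⊗[A] P.X i))
  projective i := by
    let := f.toAlgebra
    have := hP.projective i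
    exact inferInstanceAs (Module.Projective B (B ⊗[A] P.X i))
  bounded := by
    obtain ⟨b, hb⟩ := hP.bounded
    refine ⟨b, (CochainComplex.isStrictlyLE_iff _ b).2 fun i hi ↦ ?_⟩
    exact (ModuleCat.extendScalars f).map_isZero (P.isZero_of_isStrictlyLE b i hi)

variable (f) in
/-- The map `Hom_B(B ⊗ P, W)^n ⟶ Hom_A(P, W)^n` given by restriction to `P`. -/
def resHomMap (P : CochainComplex (ModuleCat.{u} A) ℤ) (W : CochainComplex (ModuleCat.{u} B) ℤ)
    (n : ℤ) : (resComplex f (homComplex (extComplex f P) W)).X n →ₗ[A]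
      (homComplex P (resComplex f W)).X n :=
  homMk fun i j h ↦
    { toFun := fun z ↦
        { toFun := fun p ↦ toRes f W j
            (homEval (extComplex f P) W h (ofRes f _ n z) (extMk f P i p))
          map_add' := fun p p' ↦ by simp only [map_add]
          map_smul' := fun a p ↦ by
            rw [LinearMap.map_smulₛₗ, map_smul, toRes_smul, RingHom.id_apply] }
      map_add' := fun _ _ ↦ rfl
      map_smul' := fun _ _ ↦ rfl }

theorem ofRes_homEval_resHomMap (hij : i + n = j)
    (z : (resComplex f (homComplex (extComplex f P) W)).X n) (p : P.X i) :
    ofRes f W j (homEval P (resComplex f W) hij (resHomMap f P W n z) p) =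
      homEval (extComplex f P) W hij (ofRes f _ n z) (extMk f P i p) := rfl

variable (f) in
/-- The morphism `Hom_B(B ⊗ P, W) ⟶ Hom_A(P, W)` given by restriction to `P`. -/
def resHom (P : CochainComplex (ModuleCat.{u} A) ℤ) (W : CochainComplex (ModuleCat.{u} B) ℤ) :
    resComplex f (homComplex (extComplex f P) W) ⟶ homComplex P (resComplex f W) where
  f n := ModuleCat.ofHom (X := (resComplex f (homComplex (extComplex f P) W)).X n)
    (Y := (homComplex P (resComplex f W)).X n) (resHomMap f P W n)
  comm' n m hnm := by
    obtain rfl : n + 1 = m := hnm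
    refine ModuleCat.hom_ext (LinearMap.ext fun z ↦ homEval_ext fun i j hij p ↦
      ofRes_injective W j ?_)
    change ofRes f W j (homEval P (resComplex f W) hij
        (((homComplex P (resComplex f W)).d n (n + 1)).hom (resHomMap f P W n z)) p) =
      ofRes f W j (homEval P (resComplex f W) hij (resHomMap f P W (n + 1)
        (((resComplex f (homComplex (extComplex f P) W)).d n (n + 1)).hom z)) p)
    rw [homEval_d (i' := i + 1) (j := j - 1) rfl rfl (by lia) (by lia) hij (by lia), map_add,
      ofRes_units_smul, ofRes_d, ofRes_homEval_resHomMap, ofRes_homEval_resHomMap,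
      ofRes_homEval_resHomMap, ofRes_d, extMk_d,
      homEval_d (i' := i + 1) (j := j - 1) rfl rfl (by lia) (by lia) hij (by lia)]

theorem ofRes_homEval_resHom (hij : i + n = j)
    (z : (resComplex f (homComplex (extComplex f P) W)).X n) (p : P.X i) :
    ofRes f W j (homEval P (resComplex f W) hij (((resHom f P W).f n).hom z) p) =
      homEval (extComplex f P) W hij (ofRes f _ n z) (extMk f P i p) := rfl

theorem bijective_resHomMap (P : CochainComplex (ModuleCat.{u} A) ℤ)
    (W : CochainComplex (ModuleCat.{u} B) ℤ) (n : ℤ) :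
    Function.Bijective (resHomMap f P W n) := by
  refine ⟨fun z z' h ↦ ofRes_injective _ n (homEval_ext fun i j hij ↦ LinearMap.congr_fun
    (extComplex_hom_ext fun p ↦ ?_)), fun w ↦ ?_⟩
  · rw [← ofRes_homEval_resHomMap, h, ofRes_homEval_resHomMap]
  · refine ⟨toRes f _ n (homMk (M := B) (P := extComplex f P) (W := W) (fun i j hij ↦
      LinearMap.toSpanSingleton B _ (extLift ((ofRes f W j).comp
        (homEval P (resComplex f W) hij w)))) 1),
      homEval_ext fun i j hij p ↦ ofRes_injective W j ?_⟩
    rw [ofRes_homEval_resHomMap, ofRes_toRes, homEval_homMk, LinearMap.toSpanSingleton_apply,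
      one_smul, extLift_extMk]
    rfl

instance (P : CochainComplex (ModuleCat.{u} A) ℤ)
    (W : CochainComplex (ModuleCat.{u} B) ℤ) : IsIso (resHom f P W) :=
  isIso_of_bijective _ fun n ↦ bijective_resHomMap P W n

theorem resHom_naturality (P : CochainComplex (ModuleCat.{u} A) ℤ) (g : W ⟶ W') :
    resMap f (homMapRight (extComplex f P) g) ≫ resHom f P W' =
      resHom f P W ≫ homMapRight P (resMap f g) := by
  refine homComplex_ext fun n z i j hij p ↦ ofRes_injective W' j ?_
  simp only [HomologicalComplex.comp_f, ModuleCat.hom_comp, LinearMap.comp_apply]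
  rw [homEval_homMapRight, ofRes_homEval_resHom, ofRes_resMap, ofRes_resMap,
    homEval_homMapRight, ofRes_homEval_resHom]

variable (f) in
/-- The morphism `P ⊗_A Z ⟶ (B ⊗ P) ⊗_B Z`. -/
def resTensor (P : CochainComplex (ModuleCat.{u} A) ℤ) (Z : CochainComplex (ModuleCat.{u} B) ℤ) :
    tensorComplex P (resComplex f Z) ⟶ resComplex f (tensorComplex (extComplex f P) Z) :=
  coadj (resMap f (unitHom (extComplex f P) Z) ≫ resHom f P _)

theorem ofRes_resTensor_tmul (hij : i + n = j) (p : P.X i)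
    (z : (resComplex f Z).X n) :
    ofRes f _ j (((resTensor f P Z).f j).hom (tmul P (resComplex f Z) hij p z)) =
      tmul (extComplex f P) Z hij (extMk f P i p) (ofRes f Z n z) := by
  rw [resTensor, coadj_tmul, ofRes_units_smul, HomologicalComplex.comp_f, ModuleCat.hom_comp,
    LinearMap.comp_apply, ofRes_homEval_resHom, ofRes_resMap, ← adj_id, homEval_adj, smul_smul,
    Int.units_mul_self, one_smul]
  rfl

section ResTensor

variable (P : CochainComplex (ModuleCat.{u} A) ℤ) (Z : CochainComplex (ModuleCat.{u} B) ℤ) (j : ℤ)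

/-- Multiplication by elements of `B` on `P ⊗_A Z`. -/
def tensorResMul (b : B) :
    (tensorComplex P (resComplex f Z)).X j →+ (tensorComplex P (resComplex f Z)).X j :=
  (((tensorMap (𝟙 P) (resMap f (b • 𝟙 Z))).f j).hom : _ →ₗ[A] _).toAddMonoidHom

theorem tensorResMul_tmul (hij : i + n = j) (b : B) (p : P.X i)
    (z : (resComplex f Z).X n) :
    tensorResMul P Z j b (tmul P (resComplex f Z) hij p z) =
      tmul P (resComplex f Z) hij p (toRes f Z n (b • ofRes f Z n z)) :=
  tensorMap_tmul _ _ hij p z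

/-- `B` acts on `P ⊗_A Z` through `Z`. -/
@[reducible]
def tensorResModule : Module B ((tensorComplex P (resComplex f Z)).X j) where
  smul b t := tensorResMul P Z j b t
  one_smul t := DFunLike.congr_fun (f := tensorResMul P Z j 1) (g := AddMonoidHom.id _)
    (tensorComplex_addHom_ext fun i n hij p z ↦ by
      rw [tensorResMul_tmul, one_smul, toRes_ofRes]; rfl) t
  mul_smul b b' t := DFunLike.congr_fun (f := tensorResMul P Z j (b * b'))
    (g := (tensorResMul P Z j b).comp (tensorResMul P Z j b'))
    (tensorComplex_addHom_ext fun i n hij p z ↦ by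
      rw [AddMonoidHom.comp_apply, tensorResMul_tmul, tensorResMul_tmul, tensorResMul_tmul,
        ofRes_toRes, mul_smul]) t
  smul_zero b := map_zero (tensorResMul P Z j b)
  smul_add b := map_add (tensorResMul P Z j b)
  add_smul b b' t := DFunLike.congr_fun (f := tensorResMul P Z j (b + b'))
    (g := tensorResMul P Z j b + tensorResMul P Z j b')
    (tensorComplex_addHom_ext fun i n hij p z ↦ by
      rw [AddMonoidHom.add_apply, tensorResMul_tmul, tensorResMul_tmul, tensorResMul_tmul,
        add_smul, map_add, map_add]) t
  zero_smul t := DFunLike.congr_fun (f := tensorResMul P Z j 0) (g := 0)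
    (tensorComplex_addHom_ext fun i n hij p z ↦ by
      rw [tensorResMul_tmul, zero_smul, map_zero, map_zero, AddMonoidHom.zero_apply]) t

attribute [local instance] tensorResModule

theorem smul_tmul_res (hij : i + n = j) (b : B) (p : P.X i) (z : Z.X n) :
    b • tmul P (resComplex f Z) hij p (toRes f Z n z) =
      tmul P (resComplex f Z) hij p (toRes f Z n (b • z)) :=
  tensorResMul_tmul P Z j hij b p (toRes f Z n z)

/-- The inverse of `resTensor`. -/
def resTensorInv :
    (tensorComplex (extComplex f P) Z).X j →ₗ[B] (tensorComplex P (resComplex f Z)).X j :=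
  tensorLift fun i n hij ↦ extLift
    { toFun := fun p ↦
        { toFun := fun z ↦ tmul P (resComplex f Z) hij p (toRes f Z n z)
          map_add' := fun z z' ↦ by simp only [map_add]
          map_smul' := fun b z ↦ (smul_tmul_res P Z j hij b p z).symm }
      map_add' := fun p p' ↦ LinearMap.ext fun z ↦ by
        simp only [map_add, LinearMap.add_apply, LinearMap.coe_mk, AddHom.coe_mk]
      map_smul' := fun a p ↦ LinearMap.ext fun z ↦ by
        simp only [LinearMap.smul_apply, LinearMap.coe_mk, AddHom.coe_mk]
        rw [smul_tmul_res, map_smul, LinearMap.smul_apply, toRes_smul, map_smul] }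

theorem resTensorInv_tmul (hij : i + n = j) (p : P.X i) (z : Z.X n) :
    resTensorInv P Z j (tmul (extComplex f P) Z hij (extMk f P i p) z) =
      tmul P (resComplex f Z) hij p (toRes f Z n z) := by
  rw [resTensorInv, tensorLift_tmul, extLift_extMk]
  rfl

theorem ofRes_resTensor_smul (b : B) (t : (tensorComplex P (resComplex f Z)).X j) :
    ofRes f _ j (((resTensor f P Z).f j).hom (b • t)) =
      b • ofRes f _ j (((resTensor f P Z).f j).hom t) := by
  let g : (tensorComplex P (resComplex f Z)).X j →+ (tensorComplex (extComplex f P) Z).X j :=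
    (ofRes f _ j).toAddMonoidHom.comp
      (((resTensor f P Z).f j).hom : _ →ₗ[A] _).toAddMonoidHom
  refine DFunLike.congr_fun (f := g.comp (tensorResMul P Z j b))
    (g := (DistribSMul.toAddMonoidHom _ b).comp g)
    (tensorComplex_addHom_ext fun i n hij p z ↦ ?_) t
  change ofRes f _ j (((resTensor f P Z).f j).hom
      (tensorResMul P Z j b (tmul P (resComplex f Z) hij p z))) =
    b • ofRes f _ j (((resTensor f P Z).f j).hom (tmul P (resComplex f Z) hij p z))
  rw [tensorResMul_tmul, ofRes_resTensor_tmul, ofRes_resTensor_tmul, ofRes_toRes, map_smul]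

theorem bijective_resTensor : Function.Bijective ((resTensor f P Z).f j).hom := by
  refine Function.bijective_iff_has_inverse.2
    ⟨fun t ↦ resTensorInv P Z j (ofRes f _ j t), fun t ↦ ?_, fun t ↦ ?_⟩
  · refine DFunLike.congr_fun (f := ((resTensorInv P Z j).toAddMonoidHom.comp
      (ofRes f _ j).toAddMonoidHom).comp
        (((resTensor f P Z).f j).hom : _ →ₗ[A] _).toAddMonoidHom) (g := AddMonoidHom.id _)
      (tensorComplex_addHom_ext fun i n hij p z ↦ ?_) t
    change resTensorInv P Z j (ofRes f _ j (((resTensor f P Z).f j).hom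
      (tmul P (resComplex f Z) hij p z))) = tmul P (resComplex f Z) hij p z
    rw [ofRes_resTensor_tmul, resTensorInv_tmul, toRes_ofRes]
  · let g : (tensorComplex P (resComplex f Z)).X j →ₗ[B] (tensorComplex (extComplex f P) Z).X j :=
      { toFun := fun t ↦ ofRes f _ j (((resTensor f P Z).f j).hom t)
        map_add' := fun t t' ↦ by simp only [map_add]
        map_smul' := fun b t ↦ ofRes_resTensor_smul P Z j b t }
    have h : g ∘ₗ resTensorInv P Z j = LinearMap.id := by
      refine tensorComplex_hom_ext fun i n hij p z ↦ ?_
      refine LinearMap.congr_fun (extComplex_hom_ext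
        (g := (g ∘ₗ resTensorInv P Z j) ∘ₗ (tmul (extComplex f P) Z hij).flip z)
        (g' := (tmul (extComplex f P) Z hij).flip z) fun p ↦ ?_) p
      simp only [LinearMap.comp_apply, LinearMap.flip_apply]
      rw [resTensorInv_tmul]
      exact ofRes_resTensor_tmul hij p (toRes f Z n z)
    exact ofRes_injective _ j (LinearMap.congr_fun h (ofRes f _ j t))

instance : IsIso (resTensor f P Z) :=
  isIso_of_bijective _ fun j ↦ bijective_resTensor P Z j

theorem adj_resTensor :
    unitHom P (resComplex f Z) ≫ homMapRight P (resTensor f P Z) =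
      resMap f (unitHom (extComplex f P) Z) ≫ resHom f P (tensorComplex (extComplex f P) Z) := by
  change adj (resTensor f P Z) = _
  rw [resTensor, adj_coadj]

theorem coadj_resHom :
    tensorMap (𝟙 P) (resHom f P Z) ≫ counitHom P (resComplex f Z) =
      resTensor f P (homComplex (extComplex f P) Z) ≫ resMap f (counitHom (extComplex f P) Z) := by
  change coadj (resHom f P Z) = _
  rw [← coadj_adj (resTensor f P (homComplex (extComplex f P) Z) ≫ _), adj_comp]
  congr 1
  rw [resTensor, adj_coadj, Category.assoc, ← resHom_naturality, ← Category.assoc,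
    ← Functor.map_comp]
  have : unitHom (extComplex f P) (homComplex (extComplex f P) Z) ≫
      homMapRight (extComplex f P) (counitHom (extComplex f P) Z) = 𝟙 _ := by
    change adj (counitHom (extComplex f P) Z) = _
    rw [← coadj_id, adj_coadj]
  rw [this, CategoryTheory.Functor.map_id, Category.id_comp]

end ResTensor

theorem auslanderFor_resComplex_iff [P.IsKProjective] :
    AuslanderFor P (resComplex f Z) ↔ AuslanderFor (extComplex f P) Z := by
  have key : QuasiIso (unitHom P (resComplex f Z)) ↔ QuasiIso (unitHom (extComplex f P) Z) := by
    have := quasiIso_homMapRight P (resTensor f P Z)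
    rw [← quasiIso_iff_comp_right _ (homMapRight P (resTensor f P Z)), adj_resTensor,
      quasiIso_iff_comp_right, quasiIso_resMap_iff]
  have bdd' : HomologicallyBounded (tensorComplex P (resComplex f Z)) ↔
      HomologicallyBounded (tensorComplex (extComplex f P) Z) := by
    rw [← homologicallyBounded_resComplex_iff f]
    exact homologicallyBounded_iff_of_quasiIso (resTensor f P Z)
  have bdd := homologicallyBounded_resComplex_iff f Z
  exact ⟨fun h ↦ ⟨bdd.1 h.1, bdd'.1 h.2, key.1 h.3⟩, fun h ↦ ⟨bdd.2 h.1, bdd'.2 h.2, key.2 h.3⟩⟩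

theorem bassFor_resComplex_iff [P.IsKProjective] :
    BassFor P (resComplex f Z) ↔ BassFor (extComplex f P) Z := by
  have key : QuasiIso (counitHom P (resComplex f Z)) ↔
      QuasiIso (counitHom (extComplex f P) Z) := by
    have := quasiIso_tensorMap_right P (resHom f P Z)
    rw [← quasiIso_iff_comp_left (tensorMap (𝟙 P) (resHom f P Z)), coadj_resHom,
      quasiIso_iff_comp_left, quasiIso_resMap_iff]
  have bdd' : HomologicallyBounded (homComplex P (resComplex f Z)) ↔
      HomologicallyBounded (homComplex (extComplex f P) Z) := by
    rw [← homologicallyBounded_resComplex_iff f]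
    exact (homologicallyBounded_iff_of_quasiIso (resHom f P Z)).symm
  have bdd := homologicallyBounded_resComplex_iff f Z
  exact ⟨fun h ↦ ⟨bdd.1 h.1, bdd'.1 h.2, key.1 h.3⟩, fun h ↦ ⟨bdd.2 h.1, bdd'.2 h.2, key.2 h.3⟩⟩

end ChangeOfRings

/-! ### Homomorphisms of bimodules into coextended modules -/

section Coextension

variable {A B : Type u} [CommRing A] [CommRing B] (f : A →+* B)
  {U : CochainComplex (ModuleCat.{u} A) ℤ}

instance : (ModuleCat.coextendScalars.{u, u, u} f).Additive :=
  (ModuleCat.restrictCoextendScalarsAdj.{u, u, u} f).right_adjoint_additive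

/-- Coextension of scalars for complexes. -/
abbrev coextComplex (J : CochainComplex (ModuleCat.{u} A) ℤ) :
    CochainComplex (ModuleCat.{u} B) ℤ :=
  ((ModuleCat.coextendScalars f).mapHomologicalComplex (ComplexShape.up ℤ)).obj J

theorem StrictlyBounded.coextComplex (hU : StrictlyBounded U) :
    StrictlyBounded (coextComplex f U) := by
  obtain ⟨a, b, _, _⟩ := hU
  exact ⟨a, b,
    (CochainComplex.isStrictlyGE_iff _ a).2 fun i hi ↦
      (ModuleCat.coextendScalars f).map_isZero (U.isZero_of_isStrictlyGE a i hi),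
    (CochainComplex.isStrictlyLE_iff _ b).2 fun i hi ↦
      (ModuleCat.coextendScalars f).map_isZero (U.isZero_of_isStrictlyLE b i hi)⟩

theorem injective_coextComplex_X {n : ℤ} (_ : Injective (U.X n)) :
    Injective ((coextComplex f U).X n) :=
  Injective.injective_of_adjoint (ModuleCat.restrictCoextendScalarsAdj f) (U.X n)

end Coextension

section BimoduleHom

open CochainComplex.HomComplex

variable {Q : Type v} {R S : Type u} [CommRing Q] [CommRing R] [CommRing S] [Algebra Q R]
  [Algebra Q S]

attribute [local instance] bimodCochainModule

variable (R) in
/-- The complex of bimodules coextended from a complex of `S`-modules. -/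
abbrev bimodCoext (J : CochainComplex (ModuleCat.{u} S) ℤ) :
    CochainComplex (ModuleCat.{u} (R ⊗[Q] S)) ℤ :=
  coextComplex (Algebra.TensorProduct.includeRight : S →ₐ[Q] R ⊗[Q] S).toRingHom J

variable (Q R S) in
/-- The adjunction between restriction and coextension of scalars along `S → R ⊗[Q] S`. -/
abbrev toRightAdj : toRight Q R S ⊣ ModuleCat.coextendScalars.{u, u, u}
    (Algebra.TensorProduct.includeRight : S →ₐ[Q] R ⊗[Q] S).toRingHom :=
  ModuleCat.restrictCoextendScalarsAdj _

variable (X : CochainComplex (ModuleCat.{u} (R ⊗[Q] S)) ℤ) (J : CochainComplex (ModuleCat.{u} S) ℤ)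
  {n i j : ℤ}

/-- The counit of coextension of scalars from `S` to `R ⊗[Q] S`. -/
def coextCounit : rightComplex Q R S (bimodCoext R J) ⟶ J where
  f j := (toRightAdj Q R S).counit.app (J.X j)
  comm' i j _ := ((toRightAdj Q R S).counit.naturality (J.d i j)).symm

/-- The adjunction between restriction and coextension, for cochains. -/
def uncoextCochain (n : ℤ) (z : Cochain X (bimodCoext R J) n) :
    Cochain (rightComplex Q R S X) J n :=
  (z.map (toRight Q R S)).comp (Cochain.ofHom (coextCounit J)) (add_zero n)

theorem uncoextCochain_v (z : Cochain X (bimodCoext R J) n) (h : i + n = j) :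
    (uncoextCochain X J n z).v i j h =
      (show (rightComplex Q R S X).X i ⟶ (rightComplex Q R S (bimodCoext R J)).X j from
        (toRight Q R S).map (z.v i j h)) ≫ (coextCounit J).f j := by
  rw [uncoextCochain, Cochain.comp_zero_cochain_v, Cochain.ofHom_v]
  rfl

theorem δ_uncoextCochain (n m : ℤ) (z : Cochain X (bimodCoext R J) n) :
    δ n m (uncoextCochain X J n z) = uncoextCochain X J m (δ n m z) := by
  rw [uncoextCochain, δ_comp_ofHom, δ_map]
  rfl

theorem bijective_uncoextCochain (n : ℤ) : Function.Bijective (uncoextCochain X J n) := by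
  have hE (i j : ℤ) : Function.Bijective fun g : X.X i ⟶ (bimodCoext R J).X j ↦
      (show (rightComplex Q R S X).X i ⟶ (rightComplex Q R S (bimodCoext R J)).X j from
        (toRight Q R S).map g) ≫ (coextCounit J).f j := by
    have h := ((toRightAdj Q R S).homEquiv (X.X i) (J.X j)).symm.bijective
    rwa [show ⇑((toRightAdj Q R S).homEquiv (X.X i) (J.X j)).symm = _ from
      funext fun g ↦ (toRightAdj Q R S).homEquiv_counit (X.X i) (J.X j) g] at h
  refine ⟨fun z z' h ↦ Cochain.ext _ _ fun i j hij ↦ (hE i j).injective ?_, fun w ↦ ?_⟩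
  · have := congrArg (fun w ↦ Cochain.v w i j hij) h
    simpa only [uncoextCochain_v] using this
  · choose g hg using fun i j ↦ (hE i j).surjective
    refine ⟨Cochain.mk fun i j hij ↦ g i j (w.v i j hij), Cochain.ext _ _ fun i j hij ↦ ?_⟩
    rw [uncoextCochain_v, Cochain.mk_v]
    exact hg i j _

/-- The isomorphism between `Hom_B(X, Hom_S(B, J))`, where `B = R ⊗[Q] S`, and `Hom_S(X, J)`. -/
def uncoext : leftComplex Q R S (homComplex X (bimodCoext R J)) ⟶ bimodHomComplex X J where
  f n := ModuleCat.ofHom (X := (leftComplex Q R S (homComplex X (bimodCoext R J))).X n)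
    (Y := (bimodHomComplex X J).X n)
    { toFun := fun z ↦ uncoextCochain X J n z
      map_add' := fun (z z' : Cochain X (bimodCoext R J) n) ↦ by
        change uncoextCochain X J n (z + z') = uncoextCochain X J n z + uncoextCochain X J n z'
        rw [uncoextCochain, Cochain.map_add, Cochain.add_comp]
        rfl
      map_smul' := fun r (z : Cochain X (bimodCoext R J) n) ↦ by
        change uncoextCochain X J n ((r ⊗ₜ[Q] (1 : S)) • z) =
          (Cochain.ofHom (leftMul X r)).comp (uncoextCochain X J n z) (zero_add n)
        refine Cochain.ext _ _ fun i j h ↦ ?_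
        rw [Cochain.zero_cochain_comp_v, Cochain.ofHom_v, uncoextCochain_v, uncoextCochain_v,
          ← Category.assoc]
        refine congrArg (· ≫ (coextCounit J).f j) (ModuleCat.hom_ext (LinearMap.ext fun x ↦ ?_))
        exact ((z.v i j h).hom.map_smul (r ⊗ₜ[Q] (1 : S)) x).symm }
  comm' n m _ := ModuleCat.hom_ext (LinearMap.ext fun z ↦ δ_uncoextCochain X J n m z)

instance : IsIso (uncoext X J) :=
  isIso_of_bijective _ fun n ↦ bijective_uncoextCochain X J n

/-- A complex of `S`-modules that is homotopy equivalent to a bounded complex of injectives. -/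
def IsFinInjective (J : CochainComplex (ModuleCat.{u} S) ℤ) : Prop :=
  ∃ U : CochainComplex (ModuleCat.{u} S) ℤ, StrictlyBounded U ∧ (∀ n, Injective (U.X n)) ∧
    Nonempty (HomotopyEquiv J U)

variable {X J} {P : CochainComplex (ModuleCat.{u} R) ℤ}

theorem IsFinInjective.exists_quasiIso (hJ : IsFinInjective J)
    (X : CochainComplex (ModuleCat.{u} (R ⊗[Q] S)) ℤ) :
    ∃ U : CochainComplex (ModuleCat.{u} (R ⊗[Q] S)) ℤ, StrictlyBounded U ∧
      (∀ n, Injective (U.X n)) ∧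
      ∃ g : homComplex X (bimodCoext R J) ⟶ homComplex X U, QuasiIso g := by
  obtain ⟨U, hU, hU', ⟨e⟩⟩ := hJ
  exact ⟨bimodCoext R U, hU.coextComplex _, fun n ↦ injective_coextComplex_X _ (hU' n), _,
    quasiIso_homMapRight_hom X
      ((ModuleCat.coextendScalars (Algebra.TensorProduct.includeRight :
        S →ₐ[Q] R ⊗[Q] S).toRingHom).mapHomotopyEquiv e)⟩

theorem AuslanderFor.bassFor_bimodHomComplex (hP : IsFinProjective P) (hJ : IsFinInjective J)
    (h : AuslanderFor P (leftComplex Q R S X)) : BassFor P (bimodHomComplex X J) := by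
  have := hP.isKProjective
  rw [auslanderFor_resComplex_iff] at h
  obtain ⟨U, hU, hU', g, _⟩ := hJ.exists_quasiIso X
  rw [← bassFor_iff_of_quasiIso (uncoext X J), bassFor_resComplex_iff]
  have := (hP.extComplex (f := Algebra.TensorProduct.includeLeftRingHom
    (A := R) (B := S) (R := Q))).isKProjective
  rw [bassFor_iff_of_quasiIso g]
  exact h.bassFor_dual hP.extComplex hU hU'

theorem BassFor.auslanderFor_bimodHomComplex (hP : IsFinProjective P) (hJ : IsFinInjective J)
    (h : BassFor P (leftComplex Q R S X)) : AuslanderFor P (bimodHomComplex X J) := by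
  have := hP.isKProjective
  rw [bassFor_resComplex_iff] at h
  obtain ⟨U, hU, hU', g, _⟩ := hJ.exists_quasiIso X
  rw [← auslanderFor_iff_of_quasiIso (uncoext X J), auslanderFor_resComplex_iff]
  have := (hP.extComplex (f := Algebra.TensorProduct.includeLeftRingHom
    (A := R) (B := S) (R := Q))).isKProjective
  rw [auslanderFor_iff_of_quasiIso g]
  exact h.auslanderFor_dual hP.extComplex hU hU'

end BimoduleHom

/-! ### Duals of tensor products of bimodules -/

section BimoduleTensor

open CochainComplex.HomComplex

variable {Q : Type v} {R S : Type u} [CommRing Q] [CommRing R] [CommRing S] [Algebra Q R]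
  [Algebra Q S]

attribute [local instance] leftModule smulCommClass_leftModule

variable (X : CochainComplex (ModuleCat.{u} (R ⊗[Q] S)) ℤ) (G : CochainComplex (ModuleCat.{u} S) ℤ)
  {i j k m n : ℤ}

/-- The inclusion of `X^i ⊗_S G^k` into `(X ⊗_S G)^m`, where `i + k = m`. -/
def bimodι (h : i + k = m) :
    ((toRight Q R S).obj (X.X i) ⊗[S] G.X k) →ₗ[R] (bimodTensorComplex X G).X m :=
  (HomologicalComplex.ιMapBifunctor X G bimodTensor (ComplexShape.up ℤ) i k m h).hom

/-- The biadditive map `X^i × G^k ⟶ (X ⊗_S G)^m`, where `i + k = m`. -/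
def bimodTmul (h : i + k = m) :
    (rightComplex Q R S X).X i →+ G.X k →+ (bimodTensorComplex X G).X m where
  toFun x :=
    { toFun := fun g ↦ bimodι X G h ((show (toRight Q R S).obj (X.X i) from x) ⊗ₜ[S] g)
      map_zero' := by rw [TensorProduct.tmul_zero, map_zero]
      map_add' := fun g g' ↦ by rw [TensorProduct.tmul_add, map_add] }
  map_zero' := AddMonoidHom.ext fun g ↦
    (congrArg (bimodι X G h) (TensorProduct.zero_tmul _ g)).trans (map_zero _)
  map_add' x x' := AddMonoidHom.ext fun g ↦
    (congrArg (bimodι X G h) (TensorProduct.add_tmul (R := S)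
      (show (toRight Q R S).obj (X.X i) from x) (show (toRight Q R S).obj (X.X i) from x')
      g)).trans (map_add _ _ _)

variable {X G}

theorem bimodTmul_smul (h : i + k = m) (s : S) (x : (rightComplex Q R S X).X i)
    (g : G.X k) : bimodTmul X G h (s • x) g = bimodTmul X G h x (s • g) :=
  congrArg (bimodι X G h) (TensorProduct.smul_tmul (R := S) s
    (show (toRight Q R S).obj (X.X i) from x) g)

theorem bimodTmul_leftMul (h : i + k = m) (r : R) (x : (rightComplex Q R S X).X i)
    (g : G.X k) :
    bimodTmul X G h (((leftMul X r).f i).hom x) g = r • bimodTmul X G h x g :=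
  (bimodι X G h).map_smul r ((show (toRight Q R S).obj (X.X i) from x) ⊗ₜ[S] g)

theorem bimodTensorComplex_hom_ext {M : Type u} [AddCommGroup M] [Module R M]
    {φ ψ : (bimodTensorComplex X G).X m →ₗ[R] M}
    (h : ∀ i k (hik : i + k = m) x g,
      φ (bimodTmul X G hik x g) = ψ (bimodTmul X G hik x g)) : φ = ψ := by
  have : ModuleCat.ofHom (X := (bimodTensorComplex X G).X m) φ = ModuleCat.ofHom ψ :=
    HomologicalComplex.mapBifunctor.hom_ext fun i k hik ↦
      ModuleCat.hom_ext (bimodTensor_hom_ext fun x g ↦ h i k hik x g)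
  exact congrArg ModuleCat.Hom.hom this

theorem bimodTensorComplex_addHom_ext {M : Type*} [AddCommGroup M]
    {φ ψ : (bimodTensorComplex X G).X m →+ M}
    (h : ∀ i k (hik : i + k = m) x g,
      φ (bimodTmul X G hik x g) = ψ (bimodTmul X G hik x g)) : φ = ψ := by
  let N : Submodule R ((bimodTensorComplex X G).X m) :=
    { carrier := {t | ∀ r : R, φ (r • t) = ψ (r • t)}
      zero_mem' := fun r ↦ by rw [smul_zero, map_zero, map_zero]
      add_mem' := fun hx hy r ↦ by rw [smul_add, map_add, map_add, hx, hy]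
      smul_mem' := fun b x hx r ↦ by rw [smul_smul, hx] }
  have hN : N.mkQ = 0 := bimodTensorComplex_hom_ext fun i n hij x g ↦ by
    rw [LinearMap.zero_apply, Submodule.mkQ_apply, Submodule.Quotient.mk_eq_zero]
    intro r
    rw [← bimodTmul_leftMul, h]
  refine AddMonoidHom.ext fun t ↦ ?_
  have ht : t ∈ N := by
    rw [← Submodule.ker_mkQ N, hN]
    trivial
  simpa using ht 1

theorem exists_character_bimodTmul
    (c : ∀ i k, i + k = m → (rightComplex Q R S X).X i →+ G.X k →+ AddCircle (1 : ℚ))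
    (hc : ∀ i k h (s : S) x g, c i k h (s • x) g = c i k h x (s • g)) :
    ∃ χ : CharacterModule ((bimodTensorComplex X G).X m),
      ∀ i k (h : i + k = m) x g, χ (bimodTmul X G h x g) = c i k h x g := by
  let c' (i k : ℤ) (h : i + k = m) : CharacterModule ((toRight Q R S).obj (X.X i) ⊗[S] G.X k) :=
    TensorProduct.liftAddHom (c i k h) (hc i k h)
  let φ : (bimodTensorComplex X G).X m ⟶ ModuleCat.of R (CharacterModule R) :=
    HomologicalComplex.mapBifunctorDesc (K₁ := X) (K₂ := G) (F := bimodTensor)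
      (c := ComplexShape.up ℤ) fun i k h ↦ ModuleCat.ofHom (homOfCharacter (A := R) (c' i k h))
  let χ : (bimodTensorComplex X G).X m →+ AddCircle (1 : ℚ) :=
    { toFun := fun t ↦ φ.hom t 1
      map_zero' := by rw [map_zero]; rfl
      map_add' := fun t t' ↦ by rw [map_add]; rfl }
  refine ⟨χ, fun i k h x g ↦ ?_⟩
  have e := HomologicalComplex.ι_mapBifunctorDesc (K₁ := X) (K₂ := G) (F := bimodTensor)
    (c := ComplexShape.up ℤ) (A := ModuleCat.of R (CharacterModule R))
    (fun i k h ↦ ModuleCat.ofHom (homOfCharacter (A := R) (c' i k h))) i k h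
  have e' := congrArg (fun ψ ↦ (show CharacterModule R from
    ψ.hom ((show (toRight Q R S).obj (X.X i) from x) ⊗ₜ[S] g)) 1) e
  refine e'.trans ?_
  change c' i k h ((1 : R) • ((show (toRight Q R S).obj (X.X i) from x) ⊗ₜ[S] g)) = c i k h x g
  rw [one_smul]
  rfl

theorem d_bimodTmul {i' k' m' : ℤ} (h : i + k = m) (hi : i + 1 = i') (hk : k + 1 = k')
    (h₁ : i' + k = m') (h₂ : i + k' = m') (x : (rightComplex Q R S X).X i) (g : G.X k) :
    ((bimodTensorComplex X G).d m m').hom (bimodTmul X G h x g) =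
      bimodTmul X G h₁ (((rightComplex Q R S X).d i i').hom x) g +
        i.negOnePow • bimodTmul X G h₂ x ((G.d k k').hom g) := by
  have e : HomologicalComplex.ιMapBifunctor X G bimodTensor (ComplexShape.up ℤ) i k m h ≫
      (bimodTensorComplex X G).d m m' =
      (bimodTensor.map (X.d i i')).app (G.X k) ≫
        HomologicalComplex.ιMapBifunctor X G bimodTensor (ComplexShape.up ℤ) i' k m' h₁ +
      i.negOnePow • ((bimodTensor.obj (X.X i)).map (G.d k k') ≫
        HomologicalComplex.ιMapBifunctor X G bimodTensor (ComplexShape.up ℤ) i k' m' h₂) := by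
    rw [HomologicalComplex.mapBifunctor.d_eq, Preadditive.comp_add,
      HomologicalComplex.mapBifunctor.ι_D₁, HomologicalComplex.mapBifunctor.ι_D₂,
      HomologicalComplex.mapBifunctor.d₁_eq X G bimodTensor _
        (show (ComplexShape.up ℤ).Rel i i' from hi) k m' h₁,
      HomologicalComplex.mapBifunctor.d₂_eq X G bimodTensor _ i
        (show (ComplexShape.up ℤ).Rel k k' from hk) m' h₂]
    congr 1
    exact one_smul _ _
  exact LinearMap.congr_fun (congrArg ModuleCat.Hom.hom e)
    ((show (toRight Q R S).obj (X.X i) from x) ⊗ₜ[S] g)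

/-- The map `x ↦ (g ↦ χ (x ⊗ g))` associated with a character `χ` of `(X ⊗_S G)^m`. -/
def bimodCurryMap (h : i + k = m)
    (χ : CharacterModule ((bimodTensorComplex X G).X m)) :
    (rightComplex Q R S X).X i →ₗ[S] CharacterModule (G.X k) where
  toFun x := AddMonoidHom.comp (show (bimodTensorComplex X G).X m →+ AddCircle (1 : ℚ) from χ)
    (bimodTmul X G h x)
  map_add' x x' := CharacterModule.ext _ fun g ↦
    (congrArg χ (DFunLike.congr_fun (map_add (bimodTmul X G h) x x') g)).trans (map_add χ _ _)
  map_smul' s x := CharacterModule.ext _ fun g ↦ congrArg χ (bimodTmul_smul h s x g)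

variable (X G) in
/-- The element `x ↦ (g ↦ χ (x ⊗ g))` of `Hom_S(X, Hom_S(G, charComplex S))^n` associated with a
character `χ` of `(X ⊗_S G)^m`, where `m + n = 0`. -/
def bimodCurryCochain (hm : m + n = 0)
    (χ : CharacterModule ((bimodTensorComplex X G).X m)) :
    Cochain (rightComplex Q R S X) (homComplex G (charComplex S)) n :=
  Cochain.mk fun i j _ ↦ ModuleCat.ofHom (X := (rightComplex Q R S X).X i)
    (Y := (homComplex G (charComplex S)).X j)
    ((LinearEquiv.ofBijective _ (bijective_charOf G (neg_add_cancel j))).symm.toLinearMap ∘ₗ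
      bimodCurryMap (show i + -j = m by lia) χ)

theorem charOf_bimodCurryCochain_v (hm : m + n = 0)
    (χ : CharacterModule ((bimodTensorComplex X G).X m)) (hij : i + n = j) (hk : k + j = 0)
    (h : i + k = m) (x : (rightComplex Q R S X).X i) (g : G.X k) :
    charOf G hk (((bimodCurryCochain X G hm χ).v i j hij).hom x) g = χ (bimodTmul X G h x g) := by
  obtain rfl : k = -j := by lia
  exact DFunLike.congr_fun ((LinearEquiv.ofBijective _ (bijective_charOf G
    (neg_add_cancel j))).apply_symm_apply (bimodCurryMap h χ x)) g

theorem charOf_δ_bimodCurryCochain {m' n' : ℤ} (hn : n + 1 = n') (hm' : m' + 1 = m)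
    (hm : m + n = 0) (χ : CharacterModule ((bimodTensorComplex X G).X m)) (hij : i + n' = j)
    (hk : k + j = 0) (h : i + k = m') (x : (rightComplex Q R S X).X i) (g : G.X k) :
    charOf G hk (((δ n n' (bimodCurryCochain X G hm χ)).v i j hij).hom x) g =
      n'.negOnePow • χ (((bimodTensorComplex X G).d m' m).hom (bimodTmul X G h x g)) := by
  have e₁ := charOf_d G (n := j - 1) (i' := k + 1) (by lia) rfl (by lia) hk
    (((bimodCurryCochain X G hm χ).v i (j - 1) (by lia)).hom x) g
  have e₂ := charOf_bimodCurryCochain_v hm χ (j := j - 1) (k := k + 1) (by lia) (by lia)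
    (by lia) x ((G.d k (k + 1)).hom g)
  have e₃ := charOf_bimodCurryCochain_v hm χ (i := i + 1) (j := j) (by lia) hk
    (by lia) (((rightComplex Q R S X).d i (i + 1)).hom x) g
  rw [d_bimodTmul (i' := i + 1) (k' := k + 1) h rfl rfl (by lia) (by lia), map_add,
    map_zsmul_unit, smul_add, smul_smul, ← Int.negOnePow_add, show n' + i = j by lia, ← e₂, ← e₃,
    ← e₁, δ_v n n' hn _ i j hij (j - 1) (i + 1) rfl rfl, add_comm, ModuleCat.hom_add,
    LinearMap.add_apply, map_add, ModuleCat.hom_comp, LinearMap.comp_apply]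
  rfl

theorem bimodHom_ext
    {z z' : Cochain (rightComplex Q R S X) (homComplex G (charComplex S)) n}
    (h : ∀ i j k (hij : i + n = j) (hk : k + j = 0) x g,
      charOf G hk ((z.v i j hij).hom x) g = charOf G hk ((z'.v i j hij).hom x) g) : z = z' :=
  Cochain.ext _ _ fun i j hij ↦ ModuleCat.hom_ext (LinearMap.ext fun x ↦
    (bijective_charOf G (neg_add_cancel j)).1
      (CharacterModule.ext _ fun g ↦ h i j (-j) hij (neg_add_cancel j) x g))

attribute [local instance] bimodCochainModule

theorem bimodCurryCochain_add (hm : m + n = 0)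
    (χ χ' : CharacterModule ((bimodTensorComplex X G).X m)) :
    bimodCurryCochain X G hm (χ + χ') =
      bimodCurryCochain X G hm χ + bimodCurryCochain X G hm χ' := by
  refine bimodHom_ext fun i j k hij hk x g ↦ ?_
  change _ = charOf G hk (((bimodCurryCochain X G hm χ).v i j hij).hom x +
    ((bimodCurryCochain X G hm χ').v i j hij).hom x) g
  rw [map_add (charOf G hk), charOf_bimodCurryCochain_v _ _ _ _ (by lia)]
  exact (congrArg₂ (· + ·) (charOf_bimodCurryCochain_v hm χ hij hk (by lia) x g)
    (charOf_bimodCurryCochain_v hm χ' hij hk (by lia) x g)).symm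

theorem bimodCurryCochain_smul (hm : m + n = 0) (r : R)
    (χ : CharacterModule ((bimodTensorComplex X G).X m)) :
    bimodCurryCochain X G hm (r • χ) =
      (Cochain.ofHom (leftMul X r)).comp (bimodCurryCochain X G hm χ) (zero_add n) := by
  refine bimodHom_ext fun i j k hij hk x g ↦ ?_
  rw [Cochain.zero_cochain_comp_v, Cochain.ofHom_v, ModuleCat.hom_comp, LinearMap.comp_apply,
    charOf_bimodCurryCochain_v _ _ _ _ (by lia), charOf_bimodCurryCochain_v _ _ _ _ (by lia),
    bimodTmul_leftMul]
  rfl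

theorem δ_bimodCurryCochain (z : (homComplex (bimodTensorComplex X G) (charComplex R)).X n) :
    δ n (n + 1) (bimodCurryCochain X G (neg_add_cancel n) (charOf _ (neg_add_cancel n) z)) =
      bimodCurryCochain X G (neg_add_cancel (n + 1)) (charOf _ (neg_add_cancel (n + 1))
        (((homComplex (bimodTensorComplex X G) (charComplex R)).d n (n + 1)).hom z)) := by
  refine bimodHom_ext fun i j k hij hk x g ↦ ?_
  rw [charOf_δ_bimodCurryCochain rfl (m' := -(n + 1)) (by lia) _ _ _ _ (by lia),
    charOf_bimodCurryCochain_v _ _ _ _ (by lia), charOf_d _ rfl (by lia) (neg_add_cancel n) _]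

attribute [local instance] bimodCochainModule

variable (X G) in
/-- The isomorphism between the dual of `X ⊗_S G` and `Hom_S(X, -)` of the dual of `G`. -/
def bimodCurry : homComplex (bimodTensorComplex X G) (charComplex R) ⟶
    bimodHomComplex X (homComplex G (charComplex S)) where
  f n := ModuleCat.ofHom (X := (homComplex (bimodTensorComplex X G) (charComplex R)).X n)
    (Y := (bimodHomComplex X (homComplex G (charComplex S))).X n)
    { toFun := fun z ↦ bimodCurryCochain X G (neg_add_cancel n) (charOf _ (neg_add_cancel n) z)
      map_add' := fun z z' ↦ by rw [map_add, bimodCurryCochain_add]; rfl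
      map_smul' := fun r z ↦ by rw [map_smul, bimodCurryCochain_smul]; rfl }
  comm' n m hnm := by
    obtain rfl : n + 1 = m := hnm
    exact ModuleCat.hom_ext (LinearMap.ext δ_bimodCurryCochain)

theorem bijective_bimodCurry (n : ℤ) :
    Function.Bijective ((bimodCurry X G).f n).hom := by
  refine ⟨fun z z' h ↦ (bijective_charOf _ (neg_add_cancel n)).1 ?_, fun w ↦ ?_⟩
  · refine bimodTensorComplex_addHom_ext fun i k hik x g ↦ ?_
    have e := congrArg (fun w : Cochain (rightComplex Q R S X) (homComplex G (charComplex S)) n ↦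
      charOf G (show k + -k = 0 by lia) ((w.v i (-k) (by lia)).hom x) g) h
    refine Eq.trans ?_ (e.trans ?_)
    · exact (charOf_bimodCurryCochain_v (neg_add_cancel n) _ _ _ hik x g).symm
    · exact charOf_bimodCurryCochain_v (neg_add_cancel n) _ _ _ hik x g
  · change Cochain (rightComplex Q R S X) (homComplex G (charComplex S)) n at w
    obtain ⟨χ, hχ⟩ := exists_character_bimodTmul (X := X) (G := G) (m := -n) (fun i k hik ↦
      { toFun := fun x ↦ charOf G (show k + -k = 0 by lia) ((w.v i (-k) (by lia)).hom x)
        map_zero' := by rw [map_zero, map_zero]; rfl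
        map_add' := fun x x' ↦ by rw [map_add, map_add]; rfl }) fun i k hik s x g ↦ by
        change charOf G _ ((w.v i (-k) _).hom (s • x)) g = charOf G _ ((w.v i (-k) _).hom x) (s • g)
        rw [map_smul, map_smul]
        rfl
    obtain ⟨z, rfl⟩ := (bijective_charOf (bimodTensorComplex X G) (neg_add_cancel n)).2 χ
    refine ⟨z, bimodHom_ext fun i j k hij hk x g ↦ ?_⟩
    obtain rfl : j = -k := by lia
    exact (charOf_bimodCurryCochain_v (neg_add_cancel n) _ hij hk (by lia) x g).trans
      (hχ i k (by lia) x g)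

instance : IsIso (bimodCurry X G) :=
  isIso_of_bijective _ bijective_bimodCurry

theorem IsFinInjective.homComplex_charComplex {V : CochainComplex (ModuleCat.{u} S) ℤ} (f : G ⟶ V)
    [QuasiIso f] (hG : ∀ n, Module.Flat S (G.X n)) (hG' : ∃ b : ℤ, G.IsStrictlyLE b)
    (hV : ∀ n, Module.Flat S (V.X n)) (hV' : StrictlyBounded V) :
    IsFinInjective (homComplex G (charComplex S)) := by
  obtain ⟨b, _⟩ := hG'
  have hU := hV'.homComplex (strictlyBounded_charComplex S)
  have hU' := injective_homComplex_charComplex V hV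
  have := hU.isKInjective hU'
  have := isStrictlyGE_homComplex (P := G) (W := charComplex S) 0 b
  have := injective_homComplex_charComplex G hG
  have : (homComplex G (charComplex S)).IsKInjective :=
    CochainComplex.isKInjective_of_injective _ (0 - b)
  have := quasiIso_homMapLeft f (charComplex S)
  exact ⟨_, hU, hU', (Equivalent.of_quasiIso (homMapLeft f (charComplex S))).symm
    |>.nonempty_homotopyEquiv⟩

variable {P : CochainComplex (ModuleCat.{u} R) ℤ}

theorem AuslanderFor.bimodTensorComplex (hP : IsFinProjective P)
    (hG : IsFinInjective (homComplex G (charComplex S)))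
    (h : AuslanderFor P (leftComplex Q R S X)) : AuslanderFor P (bimodTensorComplex X G) := by
  have := hP.isKProjective
  refine .of_bassFor_homComplex hP ?_
  rw [bassFor_iff_of_quasiIso (bimodCurry X G)]
  exact h.bassFor_bimodHomComplex hP hG

theorem BassFor.bimodTensorComplex (hP : IsFinProjective P)
    (hG : IsFinInjective (homComplex G (charComplex S)))
    (h : BassFor P (leftComplex Q R S X)) : BassFor P (bimodTensorComplex X G) := by
  have := hP.isKProjective
  refine .of_auslanderFor_homComplex hP ?_
  rw [auslanderFor_iff_of_quasiIso (bimodCurry X G)]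
  exact h.auslanderFor_bimodHomComplex hP hG

end BimoduleTensor

/-! ### Resolutions by finitely generated projective modules -/

section Subcomplex

variable {R : Type u} [CommRing R] {D K L : CochainComplex (ModuleCat.{u} R) ℤ}
  {N : ∀ n, Submodule R (D.X n)}

theorem quasiIso_of_lifts_cycles (f : K ⟶ L)
    (hinj : ∀ n (x : K.X n) (y : L.X (n - 1)), (K.d n (n + 1)).hom x = 0 →
      (L.d (n - 1) n).hom y = (f.f n).hom x → ∃ x', (K.d (n - 1) n).hom x' = x)
    (hsurj : ∀ n (y : L.X n), (L.d n (n + 1)).hom y = 0 →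
      ∃ x y', (K.d n (n + 1)).hom x = 0 ∧ (L.d (n - 1) n).hom y' = (f.f n).hom x - y) :
    QuasiIso f := by
  refine (quasiIso_iff f).2 fun n ↦ ?_
  rw [quasiIsoAt_iff' f (n - 1) n (n + 1) (by simp) (by simp)]
  let S := K.sc' (n - 1) n (n + 1)
  let T := L.sc' (n - 1) n (n + 1)
  let γ : ShortComplex.LeftHomologyMapData
    ((HomologicalComplex.shortComplexFunctor' _ _ (n - 1) n (n + 1)).map f)
    S.moduleCatLeftHomologyData T.moduleCatLeftHomologyData := default
  have hi (x : LinearMap.ker S.g.hom) : (γ.φK.hom x).1 = (f.f n).hom x.1 :=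
    congrArg (fun g ↦ g.hom x) γ.commi
  have hπ (x : LinearMap.ker S.g.hom) : γ.φH.hom (Submodule.Quotient.mk x) =
      Submodule.Quotient.mk (γ.φK.hom x) := congrArg (fun g ↦ g.hom x) γ.commπ
  rw [γ.quasiIso_iff, ConcreteCategory.isIso_iff_bijective]
  refine ⟨(injective_iff_map_eq_zero γ.φH.hom).2 fun a ha ↦ ?_, fun a ↦ ?_⟩
  · obtain ⟨x, rfl⟩ := Submodule.Quotient.mk_surjective _ a
    obtain ⟨y, hy⟩ := (Submodule.Quotient.mk_eq_zero _).1 ((hπ x).symm.trans ha)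
    obtain ⟨x', hx'⟩ := hinj n x.1 y x.2 ((congrArg Subtype.val hy).trans (hi x))
    exact (Submodule.Quotient.mk_eq_zero _).2 ⟨x', Subtype.ext hx'⟩
  · obtain ⟨y, rfl⟩ := Submodule.Quotient.mk_surjective _ a
    obtain ⟨x, y', hx, h⟩ := hsurj n y.1 y.2
    refine ⟨Submodule.Quotient.mk ⟨x, hx⟩, (hπ _).trans ((Submodule.Quotient.eq _).2 ⟨y', ?_⟩)⟩
    exact Subtype.ext (h.trans (congrArg (· - y.1) (hi ⟨x, hx⟩).symm))

theorem exists_fg_map_eq {M M' : Type*} [AddCommGroup M] [Module R M] [AddCommGroup M']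
    [Module R M'] (f : M →ₗ[R] M') {L : Submodule R M'} (hL : L.FG) (h : L ≤ LinearMap.range f) :
    ∃ L' : Submodule R M, L'.FG ∧ L'.map f = L := by
  classical
  obtain ⟨s, rfl⟩ := hL
  choose! g hg using fun x (hx : x ∈ (s : Set M')) ↦ h (Submodule.subset_span hx)
  refine ⟨Submodule.span R (s.image g : Finset M), ⟨_, rfl⟩, ?_⟩
  rw [Submodule.map_span, Finset.coe_image, Set.image_image]
  congr 1
  exact (Set.image_congr hg).trans (Set.image_id' _)

theorem exists_fg_cycles (D : CochainComplex (ModuleCat.{u} R) ℤ) (n : ℤ)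
    [Module.Finite R (D.homology n)] :
    ∃ L : Submodule R (D.X n), L.FG ∧ L ≤ LinearMap.ker (D.d n (n + 1)).hom ∧
      LinearMap.ker (D.d n (n + 1)).hom ≤ L ⊔ LinearMap.range (D.d (n - 1) n).hom := by
  let S := D.sc' (n - 1) n (n + 1)
  have e : D.homology n ≅ S.moduleCatLeftHomologyData.H :=
    D.homologyIsoSc' (n - 1) n (n + 1) (by simp) (by simp) ≪≫ S.moduleCatHomologyIso
  have : Module.Finite R (LinearMap.ker S.g.hom ⧸ LinearMap.range S.moduleCatToCycles) :=
    Module.Finite.equiv e.toLinearEquiv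
  obtain ⟨L, hL, hL'⟩ := exists_fg_map_eq (LinearMap.range S.moduleCatToCycles).mkQ
    this.fg_top (by rw [Submodule.range_mkQ])
  refine ⟨L.map (LinearMap.ker S.g.hom).subtype, hL.map _, ?_, fun x hx ↦ ?_⟩
  · rintro _ ⟨x, _, rfl⟩
    exact x.2
  · have hx' : (LinearMap.range S.moduleCatToCycles).mkQ ⟨x, hx⟩ ∈
        L.map (LinearMap.range S.moduleCatToCycles).mkQ := hL' ▸ Submodule.mem_top
    obtain ⟨⟨(y : D.X n), hy'⟩, hy, hyx⟩ := hx'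
    obtain ⟨t, ht⟩ := (Submodule.Quotient.eq _).1 hyx.symm
    have ht' : (D.d (n - 1) n).hom t = x - y := congrArg Subtype.val ht
    exact Submodule.mem_sup.2 ⟨y, ⟨⟨y, hy'⟩, hy, rfl⟩, x - y, ⟨t, ht'⟩, add_sub_cancel _ _⟩

/-- For submodules `N` of `D^n` and `N'` of `D^(n+1)`: `N` contains enough elements to bound every
coboundary in `N'` and to represent every class in `H^n(D)`. A family of submodules satisfying this
in each degree is a subcomplex whose inclusion into `D` is a quasi-isomorphism. -/
structure IsHomologyStep (D : CochainComplex (ModuleCat.{u} R) ℤ) (n : ℤ)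
    (N : Submodule R (D.X n)) (N' : Submodule R (D.X (n + 1))) : Prop where
  map_eq : N.map (D.d n (n + 1)).hom = N' ⊓ LinearMap.range (D.d n (n + 1)).hom
  ker_le : LinearMap.ker (D.d n (n + 1)).hom ≤
    (N ⊓ LinearMap.ker (D.d n (n + 1)).hom) ⊔ LinearMap.range (D.d (n - 1) n).hom

theorem IsHomologyStep.d_mem (h : ∀ n, IsHomologyStep D n (N n) (N (n + 1))) (i j : ℤ)
    (x : D.X i) (hx : x ∈ N i) : (D.d i j).hom x ∈ N j := by
  by_cases hij : i + 1 = j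
  · subst hij
    exact ((h i).map_eq.le (Submodule.mem_map_of_mem hx)).1
  · rw [D.shape i j hij]
    exact Submodule.zero_mem _

theorem IsHomologyStep.exists_d_eq (h : ∀ n, IsHomologyStep D n (N n) (N (n + 1))) {i j : ℤ}
    (hij : i + 1 = j) {y : D.X i} (hy : (D.d i j).hom y ∈ N j) :
    ∃ x ∈ N i, (D.d i j).hom x = (D.d i j).hom y := by
  subst hij
  exact (h i).map_eq.ge ⟨hy, y, rfl⟩

/-- The subcomplex of `D` formed by finitely generated submodules, as a complex of finitely
generated modules. -/
abbrev fgSubcomplex (D : CochainComplex (ModuleCat.{u} R) ℤ) (N : ∀ n, Submodule R (D.X n))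
    [∀ n, Module.Finite R (N n)] (hN : ∀ i j, ∀ x ∈ N i, (D.d i j).hom x ∈ N j) :
    CochainComplex (FGModuleCat.{u} R) ℤ where
  X n := FGModuleCat.of R (N n)
  d i j := FGModuleCat.ofHom ((D.d i j).hom.restrict (hN i j))
  shape i j hij := FGModuleCat.hom_ext (LinearMap.ext fun x ↦ Subtype.ext
    (congrArg (fun g ↦ g.hom x.1) (D.shape i j hij)))
  d_comp_d' i j k _ _ := FGModuleCat.hom_ext (LinearMap.ext fun x ↦ Subtype.ext
    (congrArg (fun g ↦ g.hom x.1) (D.d_comp_d i j k)))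

/-- The inclusion of a subcomplex formed by finitely generated submodules. -/
def fgSubcomplexι (D : CochainComplex (ModuleCat.{u} R) ℤ) (N : ∀ n, Submodule R (D.X n))
    [∀ n, Module.Finite R (N n)] (hN : ∀ i j, ∀ x ∈ N i, (D.d i j).hom x ∈ N j) :
    ((forget₂ (FGModuleCat.{u} R) (ModuleCat.{u} R)).mapHomologicalComplex _).obj
      (fgSubcomplex D N hN) ⟶ D where
  f n := ModuleCat.ofHom (N n).subtype
  comm' _ _ _ := rfl

theorem IsHomologyStep.quasiIso_fgSubcomplexι [∀ n, Module.Finite R (N n)]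
    (h : ∀ n, IsHomologyStep D n (N n) (N (n + 1))) :
    QuasiIso (fgSubcomplexι D N (IsHomologyStep.d_mem h)) := by
  refine quasiIso_of_lifts_cycles _ (fun n (x : N n) y _ hy ↦ ?_) fun n y hy ↦ ?_
  · obtain ⟨x', hx', e⟩ := IsHomologyStep.exists_d_eq h (sub_add_cancel n 1) (y := y)
      (hy ▸ x.2)
    exact ⟨(⟨x', hx'⟩ : N (n - 1)), Subtype.ext (e.trans hy)⟩
  · obtain ⟨x, hx, _, ⟨t, rfl⟩, e⟩ := Submodule.mem_sup.1 ((h n).ker_le hy)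
    exact ⟨(⟨x, hx.1⟩ : N n), -t, Subtype.ext hx.2, by
      rw [← e, map_neg]; exact (sub_add_cancel_left _ _).symm⟩

variable [IsNoetherianRing R]

theorem exists_isHomologyStep (D : CochainComplex (ModuleCat.{u} R) ℤ) (n : ℤ)
    [Module.Finite R (D.homology n)] {N' : Submodule R (D.X (n + 1))} (hN' : N'.FG) :
    ∃ N : Submodule R (D.X n), N.FG ∧ IsHomologyStep D n N N' := by
  obtain ⟨L, hL, hL₁, hL₂⟩ := exists_fg_cycles D n
  have : IsNoetherian R N' := isNoetherian_of_fg_of_noetherian N' hN'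
  have h := Submodule.FG.of_le hN' (inf_le_left : N' ⊓ LinearMap.range (D.d n (n + 1)).hom ≤ N')
  obtain ⟨M, hM, hM'⟩ := exists_fg_map_eq (D.d n (n + 1)).hom h inf_le_right
  refine ⟨M ⊔ L, hM.sup hL, ?_, hL₂.trans (sup_le_sup_right (le_inf le_sup_right hL₁) _)⟩
  rw [Submodule.map_sup, hM', LinearMap.le_ker_iff_map.1 hL₁, sup_bot_eq]

theorem exists_homologySubcomplex (D : CochainComplex (ModuleCat.{u} R) ℤ)
    (hD : ∀ n, Module.Finite R (D.homology n)) (b : ℤ) [D.IsLE b] :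
    ∃ N : ∀ n, Submodule R (D.X n), (∀ n, (N n).FG) ∧ (∀ n, b < n → N n = ⊥) ∧
      ∀ n, IsHomologyStep D n (N n) (N (n + 1)) := by
  choose step hstep using fun n (N' : {N' : Submodule R (D.X (n + 1)) // N'.FG}) ↦
    exists_isHomologyStep D n N'.2
  -- `G k n` is the `k`-th step of the descending construction started at `0` in degree `n + k`
  let G : ℕ → ∀ n, {N : Submodule R (D.X n) // N.FG} := fun k ↦
    Nat.rec (fun n ↦ ⟨⊥, Submodule.fg_bot⟩)
      (fun _ F n ↦ ⟨step n (F (n + 1)), (hstep n (F (n + 1))).1⟩) k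
  have hb (n : ℤ) (hn : b < n) : (G (b + 1 - n).toNat n).1 = ⊥ := by
    rw [show (b + 1 - n).toNat = 0 by lia]
    rfl
  refine ⟨fun n ↦ (G (b + 1 - n).toNat n).1, fun n ↦ (G (b + 1 - n).toNat n).2, hb, fun n ↦ ?_⟩
  beta_reduce
  by_cases hn : b < n
  · rw [hb n hn, hb (n + 1) (by lia)]
    refine ⟨by simp, fun x hx ↦ Submodule.mem_sup_right ?_⟩
    exact (exactAt_iff_forall_exists D n).1 (D.exactAt_of_isLE b n hn) x hx
  · rw [show (b + 1 - n).toNat = (b + 1 - (n + 1)).toNat + 1 by lia]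
    exact (hstep n (G (b + 1 - (n + 1)).toNat (n + 1))).2

theorem exists_quasiIso_fg (D : CochainComplex (ModuleCat.{u} R) ℤ)
    (hD : ∀ n, Module.Finite R (D.homology n)) (b : ℤ) [D.IsLE b] :
    ∃ (E : CochainComplex (FGModuleCat.{u} R) ℤ)
      (f : ((forget₂ (FGModuleCat.{u} R) (ModuleCat.{u} R)).mapHomologicalComplex _).obj E ⟶ D),
      E.IsStrictlyLE b ∧ QuasiIso f := by
  obtain ⟨N, hN, hb, h⟩ := exists_homologySubcomplex D hD b
  have (n : ℤ) : Module.Finite R (N n) := Module.Finite.iff_fg.2 (hN n)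
  refine ⟨_, _, (CochainComplex.isStrictlyLE_iff _ b).2 fun n hn ↦ ?_,
    IsHomologyStep.quasiIso_fgSubcomplexι h⟩
  rw [IsZero.iff_id_eq_zero]
  exact FGModuleCat.hom_ext (LinearMap.ext fun x ↦
    Subtype.ext ((Submodule.mem_bot R).1 (hb n hn ▸ x.2)))

end Subcomplex

section PseudoCoherent

variable {R : Type u} [CommRing R]

/-- A complex is pseudo-coherent if it has a bounded above resolution by finitely generated
projective modules. -/
def IsPseudoCoherent (D : CochainComplex (ModuleCat.{u} R) ℤ) : Prop :=
  ∃ (P : CochainComplex (ModuleCat.{u} R) ℤ) (f : P ⟶ D), QuasiIso f ∧ IsFinProjective P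

variable [IsNoetherianRing R]

theorem exists_epi_fgModuleCat (M : FGModuleCat.{u} R) :
    ∃ (n : ℕ) (f : FGModuleCat.of R (Fin n → R) ⟶ M), Epi f := by
  obtain ⟨n, f, hf⟩ := Module.Finite.exists_fin' R M
  refine ⟨n, FGModuleCat.ofHom f, (forget₂ (FGModuleCat.{u} R) (ModuleCat.{u} R)).epi_of_epi_map ?_⟩
  exact (ModuleCat.epi_iff_surjective _).2 hf

theorem projective_fgModuleCat_iff (M : FGModuleCat.{u} R) :
    Projective M ↔ Module.Projective R M := by
  refine ⟨fun _ ↦ ?_, fun hM ↦ ⟨fun {E X} f e _ ↦ ?_⟩⟩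
  · obtain ⟨n, f, _⟩ := exists_epi_fgModuleCat M
    refine Module.Projective.of_split (Projective.factorThru (𝟙 M) f).hom.hom f.hom.hom ?_
    rw [← FGModuleCat.hom_hom_comp, Projective.factorThru_comp, FGModuleCat.hom_hom_id]
  · let F := forget₂ (FGModuleCat.{u} R) (ModuleCat.{u} R)
    have : Projective (F.obj M) := (IsProjective.iff_projective _).1 hM
    refine ⟨F.preimage (Projective.factorThru (F.map f) (F.map e)), F.map_injective ?_⟩
    rw [F.map_comp, F.map_preimage, Projective.factorThru_comp]

instance : EnoughProjectives (FGModuleCat.{u} R) where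
  presentation M := by
    obtain ⟨n, f, hf⟩ := exists_epi_fgModuleCat M
    exact ⟨{
      p := FGModuleCat.of R (Fin n → R)
      projective := (projective_fgModuleCat_iff _).2
        (inferInstanceAs (Module.Projective R (Fin n → R)))
      f := f
      epi := hf }⟩

theorem HomologicallyBounded.isPseudoCoherent {D : CochainComplex (ModuleCat.{u} R) ℤ}
    (hD : HomologicallyBounded D) (hD' : ∀ n, Module.Finite R (D.homology n)) :
    IsPseudoCoherent D := by
  obtain ⟨_, b, _, _⟩ := hD
  obtain ⟨E, f, _, _⟩ := exists_quasiIso_fg D hD' b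
  obtain ⟨P, g, _, hP, hP'⟩ := exists_projective E b
  let F := forget₂ (FGModuleCat.{u} R) (ModuleCat.{u} R)
  refine ⟨(F.mapHomologicalComplex _).obj P, (F.mapHomologicalComplex _).map g ≫ f,
    inferInstance, fun n ↦ (P.X n).property, fun n ↦ (projective_fgModuleCat_iff _).1 (hP n), b, ?_⟩
  exact (CochainComplex.isStrictlyLE_iff _ b).2 fun n hn ↦
    F.map_isZero (P.isZero_of_isStrictlyLE b n hn)

end PseudoCoherent

/-! ### Independence of the resolution -/

section Independence

variable {R : Type u} [CommRing R] {P P' X : CochainComplex (ModuleCat.{u} R) ℤ}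

theorem auslanderFor_iff_of_homotopyEquiv [P.IsKProjective] [P'.IsKProjective]
    (e : HomotopyEquiv P P') : AuslanderFor P X ↔ AuslanderFor P' X :=
  ⟨fun h ↦ (h.foxbyPair.of_homotopyEquiv e.symm).auslanderFor,
    fun h ↦ (h.foxbyPair.of_homotopyEquiv e).auslanderFor⟩

theorem bassFor_iff_of_homotopyEquiv [P.IsKProjective] [P'.IsKProjective]
    (e : HomotopyEquiv P P') : BassFor P X ↔ BassFor P' X :=
  ⟨fun h ↦ (h.foxbyPair.of_homotopyEquiv e.symm).bassFor,
    fun h ↦ (h.foxbyPair.of_homotopyEquiv e).bassFor⟩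

theorem ProjRes.isKProjective {C : Type*} [Category* C] [Abelian C] {K : CochainComplex C ℤ}
    (r : ProjRes K) : r.P.IsKProjective := by
  obtain ⟨b, _⟩ := r.bounded
  have := r.projective
  exact CochainComplex.isKProjective_of_projective r.P b

theorem InjRes.isKInjective {C : Type*} [Category* C] [Abelian C] {K : CochainComplex C ℤ}
    (r : InjRes K) : r.J.IsKInjective := by
  obtain ⟨a, _⟩ := r.bounded
  have := r.injective
  exact CochainComplex.isKInjective_of_injective r.J a

theorem IsPseudoCoherent.exists_isFinProjective {D : CochainComplex (ModuleCat.{u} R) ℤ}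
    (hD : HomologicallyBounded D) (hD' : IsPseudoCoherent D) :
    ∃ P : CochainComplex (ModuleCat.{u} R) ℤ, IsFinProjective P ∧
      (∀ X, AuslanderClass D hD X ↔ AuslanderFor P X) ∧
      ∀ X, BassClass D hD X ↔ BassFor P X := by
  obtain ⟨P, f, _, hP⟩ := hD'
  have := hP.isKProjective
  have := (projRes D hD).isKProjective
  have := (projRes D hD).quasiIso
  obtain ⟨g, hg⟩ := exists_quasiIso_lift (projRes D hD).π f
  obtain ⟨e, _⟩ := (CochainComplex.IsKProjective.quasiIso_iff g).1 hg
  refine ⟨P, hP, fun X ↦ ?_, fun X ↦ ?_⟩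
  · rw [← auslanderFor_iff_of_homotopyEquiv e]
    exact ⟨fun h ↦ ⟨h.1, h.2, h.3⟩, fun h ↦ ⟨h.1, h.2, h.3⟩⟩
  · rw [← bassFor_iff_of_homotopyEquiv e]
    exact ⟨fun h ↦ ⟨h.1, h.2, h.3⟩, fun h ↦ ⟨h.1, h.2, h.3⟩⟩

theorem HasFiniteInjDim.isFinInjective {I : CochainComplex (ModuleCat.{u} R) ℤ}
    (hI : HasFiniteInjDim I) : IsFinInjective (injRes I hI.homologicallyBounded).J := by
  obtain ⟨U, h, hU, hU'⟩ := hI.exists_equivalent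
  let r := injRes I hI.homologicallyBounded
  have := hU.isKInjective hU'
  have := r.isKInjective
  have := r.quasiIso
  exact ⟨U, hU, hU', ((Equivalent.of_quasiIso r.ι).symm.trans h).nonempty_homotopyEquiv⟩

theorem HasFiniteFlatDim.isFinInjective {F : CochainComplex (ModuleCat.{u} R) ℤ}
    (hF : HasFiniteFlatDim F) :
    IsFinInjective (homComplex (projRes F hF.homologicallyBounded).P (charComplex R)) := by
  obtain ⟨V, h, hV, hV'⟩ := hF.exists_equivalent
  let r := projRes F hF.homologicallyBounded
  have := r.isKProjective
  have := r.quasiIso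
  obtain ⟨f, _⟩ := ((Equivalent.of_quasiIso r.π).trans h).exists_quasiIso
  refine .homComplex_charComplex f (fun n ↦ ?_) r.bounded hV' hV
  have : Module.Projective R (r.P.X n) := (IsProjective.iff_projective _).2 (r.projective n)
  infer_instance

end Independence

end

end FoxbyClasses

theorem proposition2p1_general {Q : Type v} {R S : Type u} [CommRing Q] [CommRing R] [CommRing S]
    [Algebra Q R] [Algebra Q S] {D : CochainComplex (ModuleCat.{u} R) ℤ}
    (hD : FoxbyClasses.HomologicallyBounded D) (hD' : FoxbyClasses.IsPseudoCoherent D)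
    (X : CochainComplex (ModuleCat.{u} (R ⊗[Q] S)) ℤ) {F I : CochainComplex (ModuleCat.{u} S) ℤ}
    (hF : FoxbyClasses.HasFiniteFlatDim F) (hI : FoxbyClasses.HasFiniteInjDim I) :
    (FoxbyClasses.AuslanderClass D hD (FoxbyClasses.leftComplex Q R S X) →
      FoxbyClasses.BassClass D hD (FoxbyClasses.bimodRHom X I hI.homologicallyBounded) ∧
        FoxbyClasses.AuslanderClass D hD
          (FoxbyClasses.bimodLTensor X F hF.homologicallyBounded)) ∧
    (FoxbyClasses.BassClass D hD (FoxbyClasses.leftComplex Q R S X) →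
      FoxbyClasses.AuslanderClass D hD (FoxbyClasses.bimodRHom X I hI.homologicallyBounded) ∧
        FoxbyClasses.BassClass D hD
          (FoxbyClasses.bimodLTensor X F hF.homologicallyBounded)) := by
  obtain ⟨P, hP, auslander_iff, bass_iff⟩ := hD'.exists_isFinProjective hD
  simp only [auslander_iff, bass_iff]
  exact ⟨fun h ↦ ⟨h.bassFor_bimodHomComplex hP hI.isFinInjective,
      h.bimodTensorComplex hP hF.isFinInjective⟩,
    fun h ↦ ⟨h.auslanderFor_bimodHomComplex hP hI.isFinInjective,
      h.bimodTensorComplex hP hF.isFinInjective⟩⟩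

theorem proposition2p1 {Q : Type v} {R S : Type u} [CommRing Q] [CommRing R] [CommRing S]
    [Algebra Q R] [Algebra Q S] [IsNoetherianRing R] [IsLocalRing R] [IsNoetherianRing S]
    (D : CochainComplex (ModuleCat.{u} R) ℤ) (hD : FoxbyClasses.IsDualizingComplex D)
    (X Y : CochainComplex (ModuleCat.{u} (R ⊗[Q] S)) ℤ)
    (hX : FoxbyClasses.HomologicallyBounded X) (hY : FoxbyClasses.HomologicallyBounded Y)
    (F I : CochainComplex (ModuleCat.{u} S) ℤ)
    (hF : FoxbyClasses.HasFiniteFlatDim F) (hI : FoxbyClasses.HasFiniteInjDim I) :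
    (FoxbyClasses.AuslanderClass D hD.finiteInjDim.homologicallyBounded
        (FoxbyClasses.leftComplex Q R S X) →
      FoxbyClasses.BassClass D hD.finiteInjDim.homologicallyBounded
          (FoxbyClasses.bimodRHom X I hI.homologicallyBounded) ∧
        FoxbyClasses.AuslanderClass D hD.finiteInjDim.homologicallyBounded
          (FoxbyClasses.bimodLTensor X F hF.homologicallyBounded)) ∧
    (FoxbyClasses.BassClass D hD.finiteInjDim.homologicallyBounded
        (FoxbyClasses.leftComplex Q R S Y) →
      FoxbyClasses.AuslanderClass D hD.finiteInjDim.homologicallyBounded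
          (FoxbyClasses.bimodRHom Y I hI.homologicallyBounded) ∧
        FoxbyClasses.BassClass D hD.finiteInjDim.homologicallyBounded
          (FoxbyClasses.bimodLTensor Y F hF.homologicallyBounded)) := by
  have hD' := hD.finiteInjDim.homologicallyBounded.isPseudoCoherent hD.finite_homology
  exact ⟨(proposition2p1_general _ hD' X hF hI).1, (proposition2p1_general _ hD' Y hF hI).2⟩
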